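/- **Setting.** For a set $A\subset\mathbb C\setminus\{0\}$ without finite accumulation points let $S_A=\mathbb C\setminus\bigcup_{\alpha\in A}\{t\alpha: t\ge 1\}$. Let $f$ be a holomorphic germ at $0$. Its *principal branch* on $S_A$, if it exists, is the holomorphic function $F$ on the star-shaped domain $S_A$ with germ $f$ at $0$. For $p\neq0$ and a side $\sigma\in\{+1,-1\}$, consider the half-discs $\{|z-p|<\varepsilon,\ \sigma\operatorname{Im}(z/p)>0\}$, with $\varepsilon>0$ small. We say that the singularities of $F$ are *isolated and contained in $A$* if, for each side $\sigma$: (i) at every $p\notin A$, $p\ne0$, the restriction of $F$ to such a half-disc extends holomorphically to a neighbourhood of $p$; (ii) at every $\alpha\in A$, the restriction of $F$ to such a half-disc continues analytically along all paths in a small punctured disc centred at $\alpha$, so that it becomes a holomorphic function on the universal covering of this punctured disc (a *local branch* of $F$ at $\alpha$). For a local branch $\Phi$ at $\alpha$, $\Sigma_\alpha\Phi$ is its continuation along a loop turning once positively around $\alpha$, and $\Delta_\alpha=\Sigma_\alpha-\mathrm{Id}$. The singularity $\alpha$ is *integrable* if, for the local branches at $\alpha$ from both sides, $(z-\alpha)\Phi(z)\to0$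 as $z\to\alpha$ on the universal covering with $\arg(z-\alpha)$ bounded (for every bound). **Theorem.** Let $f(z)=\sum A_nz^n$ and $g(z)=\sum B_nz^n$ be holomorphic germs at $0$ having principal branches $F$ on $S_A$ and $G$ on $S_B$, whose singularities are isolated, contained in $A$ and $B$ respectively, and integrable. Let $f\odot g(z)=\sum A_nB_nz^n$ and $AB=\{\alpha\beta:\alpha\in A,\ \beta\in B\}$. Then: 1. $AB$ does not contain $0$ and has no finite accumulation point, $f\odot g$ has a principal branch $H$ on $S_{AB}$, and the singularities of $H$ are isolated and contained in $AB$. 2. Let $\gamma\in AB$. There are only finitely many pairs $(\alpha,\beta)\in A\times B$ with $\alpha\beta=\gamma$. Fix a side $\sigma$, and consider the local branches from the side $\sigma$ of $H$ at $\gamma$, of $F$ at the $\alpha\in A$, and of $G$ at the $\beta\in B$, denoted again by $H,F,G$. There is $\rho>0$ such that for every point $z$ of the universal covering of $\{0<|z-\gamma|<\rho|\gamma|\}$, all the integrals below converge (as improper integrals at both endpoints), and for all $N\ge1$ $$(\Sigma_\gamma^N-\mathrm{Id})H(z)=-\frac1{2\pi i}\sum_{\substack{\alpha\in A,\ \beta\in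 B\\ \alpha\beta=\gamma}}\ \sum_{k=0}^{N-1}\int_\alpha^{z/\beta}\Delta_\alpha(\Sigma_\alpha^kF)(u)\,\Delta_\beta(\Sigma_\beta^kG)(z/u)\,\frac{du}{u}.$$ Here the integral is along the segment $u=\alpha(1+s\zeta)$, $0<s<1$, where $z=\gamma(1+\zeta)$, and the branches are determined by $\arg(u/\alpha-1)=\arg\zeta$ and $\arg\big(\tfrac{z}{u\beta}-1\big)=\arg\zeta-\operatorname{Arg}(1+s\zeta)$, with $\operatorname{Arg}$ the principal argument and $\arg\zeta$ the argument given by the point $z$ of the covering. -/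

import Mathlib

open Complex Filter Topology Set

noncomputable section

/-- The `n`-th Taylor coefficient at `0` of a germ `f` at `0`. -/
def taylorCoeff (f : ℂ → ℂ) (n : ℕ) : ℂ :=
  iteratedDeriv n f 0 / (n.factorial : ℂ)

/-- The Hadamard product `∑ Aₙ Bₙ zⁿ` of the germs `∑ Aₙ zⁿ` and `∑ Bₙ zⁿ` at `0`.
It is only used as a germ at `0`, where the series converges. -/
def hadamardProduct (f g : ℂ → ℂ) : ℂ → ℂ :=
  fun z => ∑' n : ℕ, taylorCoeff f n * taylorCoeff g n * z ^ n

/-- The complex plane cut along the half-lines `[α, ∞·α)`, `α ∈ A`, pointing away from `0`. -/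
def starDomain (A : Set ℂ) : Set ℂ :=
  {z | ∀ α ∈ A, ∀ t : ℝ, 1 ≤ t → z ≠ (t : ℂ) * α}

/-- `F` is the principal branch of the germ `f` at `0`, on the star domain of `A`: the holomorphic
continuation of `f` along the segments starting at `0`. Values of `F` outside the star domain are
irrelevant. -/
structure IsPrincipalBranch (f : ℂ → ℂ) (A : Set ℂ) (F : ℂ → ℂ) : Prop where
  germ_eq : F =ᶠ[𝓝 0] f
  differentiableOn : DifferentiableOn ℂ F (starDomain A)

/-- The principal branch `F`, restricted to the side `σ = ±1` of the half-line through `p` (the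
side `0 < σ * Im (z / p)`), extends holomorphically to a full neighbourhood of `p`. -/
def IsRegularFromSide (F : ℂ → ℂ) (σ : ℝ) (p : ℂ) : Prop :=
  ∃ r : ℝ, 0 < r ∧ ∃ Q : ℂ → ℂ, DifferentiableOn ℂ Q (Metric.ball p r) ∧
    ∀ z ∈ Metric.ball p r, 0 < σ * (z / p).im → Q z = F z

/-- The map `w ↦ p * (1 + exp w)` is a universal covering of the punctured disc
`0 < |z - p| < r * |p|` by the half-plane `|exp w| < r`; in it, `Im w` is a determination of
`arg ((z - p) / p)`. The function `Φ` on the half-plane is the multivalued analytic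
continuation, to the punctured disc, of the restriction of `F` to the half-disc
`0 < σ * Im (z / p)` lying on the side `σ = ±1` of the half-line through `p`. -/
def IsLocalBranch (F : ℂ → ℂ) (σ : ℝ) (p : ℂ) (Φ : ℂ → ℂ) : Prop :=
  ∃ r : ℝ, 0 < r ∧ DifferentiableOn ℂ Φ {w | ‖exp w‖ < r} ∧
    ∀ w : ℂ, ‖exp w‖ < r → 0 < σ * w.im → σ * w.im < Real.pi → Φ w = F (p * (1 + exp w))

/-- The singularities of the principal branch `F` belong to `A` and are isolated:
`A` has no finite accumulation point; from either side, `F` extends holomorphically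
across every point that is not in `A`; and, from either side, it continues analytically along all
paths in a small punctured disc centred at any point of `A`. -/
structure HasIsolatedSingularities (F : ℂ → ℂ) (A : Set ℂ) : Prop where
  zero_notMem : (0 : ℂ) ∉ A
  finite_inter : ∀ R : ℝ, (A ∩ Metric.closedBall 0 R).Finite
  regular : ∀ σ : ℝ, σ = 1 ∨ σ = -1 → ∀ p : ℂ, p ∉ A → IsRegularFromSide F σ p
  isolated : ∀ σ : ℝ, σ = 1 ∨ σ = -1 → ∀ α ∈ A, ∃ Φ : ℂ → ℂ, IsLocalBranch F σ α Φ

/-- The singularity `α` of `F` is integrable: `(z - α) F(z) → 0` as `z → α` with `arg (z - α)`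
bounded (Stolz limit), for the multivalued continuation of `F` to a punctured disc at `α`. -/
def IsIntegrableSingularity (F : ℂ → ℂ) (α : ℂ) : Prop :=
  ∀ σ : ℝ, σ = 1 ∨ σ = -1 → ∃ Φ : ℂ → ℂ, IsLocalBranch F σ α Φ ∧
    ∀ M : ℝ, Tendsto (fun w : ℂ => (α * (1 + exp w) - α) * Φ w)
      (comap Complex.re atBot ⊓ 𝓟 {w : ℂ | |w.im| ≤ M}) (𝓝 0)

/-- The operator `Σ`: continuation along a loop turning once positively around the singularity,
that is, a translation by `2πi` on the universal covering. -/
def monodromyShift (Φ : ℂ → ℂ) : ℂ → ℂ :=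
  fun w => Φ (w + 2 * (Real.pi : ℂ) * I)

/-- The operator `Δ = Σ - Id`. -/
def monodromyDelta (Φ : ℂ → ℂ) : ℂ → ℂ :=
  fun w => monodromyShift Φ w - Φ w

/-- The (improper) integral `∫_α^{z/β} φ(u) ψ(z/u) du/u` along the segment from `α` to `z/β`
converges to `L`. Here `z = α * β * (1 + exp w)`, and `φ`, `ψ` are multivalued functions on
punctured discs centred at `α`, `β`, written on the universal coverings.
The segment is `u = α * (1 + s * exp w)`, `0 < s < 1`; the point over `u` is `w + log s`, one has
`z / u = β * (1 + (1 - s) * exp w / (1 + s * exp w))`, the point over `z / u` is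
`w + log (1 - s) - log (1 + s * exp w)`, and `du / u = exp w / (1 + s * exp w) ds`. -/
def HasConvolutionIntegral (φ ψ : ℂ → ℂ) (w L : ℂ) : Prop :=
  Tendsto
    (fun ε : ℝ × ℝ => ∫ s in ε.1..(1 - ε.2),
      φ (w + (Real.log s : ℂ)) *
        ψ (w + (Real.log (1 - s) : ℂ) - Complex.log (1 + (s : ℂ) * exp w)) *
        (exp w / (1 + (s : ℂ) * exp w)))
    (𝓝[>] (0 : ℝ) ×ˢ 𝓝[>] (0 : ℝ)) (𝓝 L)

end

noncomputable section

/-! ### Integrals along segments and primitives -/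

/-! For small $z$, $f\odot g(z)=\frac1{2\pi i}\oint F(u)G(z/u)\,du/u$ over a small circle. In
logarithmic coordinates $u=e^y$, $z=pe^\upsilon$, the circle becomes a vertical segment of length
$2\pi$. In each direction the cuts of $F$ run to the right in the $y$-plane, those of $u\mapsto
G(z/u)$ run to the left, and the latter advance to the right as $\operatorname{Re}\upsilon$ grows
from $-\infty$ to $0$.

If $p$ is in the star domain of $AB$, the opposed cuts never meet: each direction has a radius
separating them (`exists_separating_radius`), the contour is deformed arc by arc, and the integral
continues along a thin strip up to $p$ (`exists_open_continuation`). `exists_continuation_of_strips`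
glues these continuations into the principal branch $H$.

If $p\ne0$ is approached from the side $\sigma$, the contour can be led between the opposed cuts. Up
to a term holomorphic near $p$, the integral over a thin arc is then a limit of integrals along a
ray (`exists_continuation_to_sideSector`). The ray is subdivided so that each piece contains at most
one opposed pair $\alpha$, $\beta=p/\alpha$; contributions add up over the ray
(`exists_radial_pinch`) and over the circle (`exists_isPinchedArc_full_turn`).

Near one pair put $u=\alpha(1+e^v)$, $z=\alpha\beta(1+e^\omega)$. The integrand `convKernel` is
singular at $v=-\infty$, that is $u=\alpha$, and at $v\in\omega+2\pi i\mathbb Z$, that is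
$u=z/\beta$. `convBranch` integrates along a path between the two and is holomorphic on a whole
half-plane of $\omega$. When $\omega$ turns into $\omega+2\pi i$ the path is dragged along, and the
difference contracts to the segment from $\alpha$ to $z/\beta$ carrying $\Delta\Phi\,\Delta\Psi$;
integrability makes the small detours at both ends vanish (`hasConvolutionIntegral_of_primitives`,
`hasConvolutionIntegral_convBranch`). This is the case $N=1$ of the formula, and the general case
telescopes (`monodromyShift_iterate_sub`).

The local convolution is itself integrable (`isSmallBranch_convBranch`). Hence at $p\notin AB$,
where the variation is an empty sum, the singularity of $H$ is removable
(`isRegularFromSide_of_monodromyDelta_eq_zero`). -/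

theorem hasDerivAt_intervalIntegral_of_differentiableOn {g : ℂ → ℝ → ℂ} {U : Set ℂ} {a b : ℝ}
    (hab : a ≤ b) (hU : IsOpen U)
    (hc : ContinuousOn (Function.uncurry g) (U ×ˢ Icc a b))
    (hd : ∀ t ∈ Icc a b, DifferentiableOn ℂ (fun z => g z t) U) {z₀ : ℂ} (hz₀ : z₀ ∈ U) :
    HasDerivAt (fun z => ∫ t in a..b, g z t) (∫ t in a..b, deriv (fun z => g z t) z₀) z₀ := by
  obtain ⟨ε, hε, hball⟩ := Metric.isOpen_iff.1 hU z₀ hz₀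
  have hslice : ∀ z ∈ U, ContinuousOn (g z) (Icc a b) := fun z hz =>
    hc.comp (f := fun t => (z, t)) (by fun_prop) fun t ht => ⟨hz, ht⟩
  have hsub : Metric.closedBall z₀ (ε / 2) ⊆ U :=
    (Metric.closedBall_subset_ball (by linarith)).trans hball
  obtain ⟨C, hC⟩ := ((isCompact_closedBall z₀ (ε / 2)).prod
    (isCompact_Icc (a := a) (b := b))).exists_bound_of_continuousOn
    (hc.mono (prod_mono hsub le_rfl))
  have huI : uIoc a b ⊆ Icc a b := by
    rw [uIoc_of_le hab]; exact Ioc_subset_Icc_self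
  have hmeas : ∀ z ∈ U, MeasureTheory.AEStronglyMeasurable (g z)
      (MeasureTheory.volume.restrict (uIoc a b)) := fun z hz =>
    ((hslice z hz).mono huI).aestronglyMeasurable measurableSet_uIoc
  have hda : ∀ t ∈ Icc a b, ∀ z ∈ U, DifferentiableAt ℂ (fun z => g z t) z := fun t ht z hz =>
    (hd t ht).differentiableAt (hU.mem_nhds hz)
  -- Circles of radius ε/4 about points of the ball of radius ε/4 stay in the closed ball of radius
  -- ε/2, where `g` is bounded by `C`; Cauchy's estimate then gives the bound C/(ε/4).
  refine (intervalIntegral.hasDerivAt_integral_of_dominated_loc_of_deriv_le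
    (bound := fun _ => C / (ε / 4)) (F' := fun z t => deriv (fun z => g z t) z)
    (s := Metric.ball z₀ (ε / 4))
    (Metric.ball_mem_nhds _ (by positivity)) ?_ ?_ ?_ ?_ ?_ ?_).2
  · filter_upwards [hU.mem_nhds hz₀] with z hz using hmeas z hz
  · exact (hslice z₀ hz₀).intervalIntegrable_of_Icc hab
  -- The derivative is measurable in `t` as a pointwise limit of difference quotients along a
  -- sequence of increments, so its continuity in `t` is not needed.
  · let q : ℕ → ℝ → ℂ := fun n t =>
      ((ε / 2 / (n + 1) : ℝ) : ℂ)⁻¹ * (g (z₀ + (ε / 2 / (n + 1) : ℝ)) t - g z₀ t)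
    have hpos : ∀ n : ℕ, 0 < ε / 2 / ((n : ℝ) + 1) := fun n => by positivity
    have hin : ∀ n : ℕ, z₀ + (ε / 2 / ((n : ℝ) + 1) : ℝ) ∈ U := fun n => by
      apply hsub
      rw [Metric.mem_closedBall, dist_eq_norm, add_sub_cancel_left, Complex.norm_real,
        Real.norm_of_nonneg (hpos n).le]
      exact div_le_self (by positivity) (by linarith [n.cast_nonneg (α := ℝ)])
    refine aestronglyMeasurable_of_tendsto_ae atTop (f := q) (fun n => ?_) ?_
    · exact ((hmeas _ (hin n)).sub (hmeas _ hz₀)).const_mul _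
    · rw [MeasureTheory.ae_restrict_iff' measurableSet_uIoc]
      refine Eventually.of_forall fun t ht => ?_
      have h1 := (hda t (huI ht) z₀ hz₀).hasDerivAt.tendsto_slope_zero
      have h2 : Tendsto (fun n : ℕ => ((ε / 2 / ((n : ℝ) + 1) : ℝ) : ℂ)) atTop (𝓝[≠] 0) := by
        refine tendsto_nhdsWithin_iff.2 ⟨?_, Eventually.of_forall fun n => ?_⟩
        · have h3 := (tendsto_one_div_add_atTop_nhds_zero_nat (𝕜 := ℝ)).const_mul (ε / 2)
          have h4 := (Complex.continuous_ofReal.tendsto _).comp h3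
          simp only [mul_zero, Complex.ofReal_zero] at h4
          refine h4.congr fun n => ?_
          simp [div_eq_mul_inv]
        · exact Complex.ofReal_ne_zero.2 (hpos n).ne'
      simpa [q, Function.comp_def] using h1.comp h2
  · refine Eventually.of_forall fun t ht z hz => ?_
    have hsub2 : Metric.closedBall z (ε / 4) ⊆ Metric.closedBall z₀ (ε / 2) := by
      apply Metric.closedBall_subset_closedBall'
      rw [Metric.mem_ball] at hz
      linarith
    refine Complex.norm_deriv_le_of_forall_mem_sphere_norm_le (by positivity) ?_ fun w hw => ?_
    · refine (DifferentiableOn.diffContOnCl_ball (U := U) (hd t (huI ht)) (hsub2.trans hsub))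
    · exact hC (w, t) ⟨hsub2 (Metric.sphere_subset_closedBall hw), huI ht⟩
  · exact intervalIntegrable_const
  · refine Eventually.of_forall fun t ht z hz => (hda t (huI ht) z ?_).hasDerivAt
    exact hsub (Metric.ball_subset_closedBall (Metric.ball_subset_ball (by linarith) hz))

theorem differentiableOn_intervalIntegral {g : ℂ → ℝ → ℂ} {U : Set ℂ} {a b : ℝ}
    (hab : a ≤ b) (hU : IsOpen U)
    (hc : ContinuousOn (Function.uncurry g) (U ×ˢ Icc a b))
    (hd : ∀ t ∈ Icc a b, DifferentiableOn ℂ (fun z => g z t) U) :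
    DifferentiableOn ℂ (fun z => ∫ t in a..b, g z t) U := fun _ hz =>
  (hasDerivAt_intervalIntegral_of_differentiableOn hab hU hc hd
    hz).differentiableAt.differentiableWithinAt

/-- The integral of `f` along the segment from `a` to `b`. -/
def segInt (f : ℂ → ℂ) (a b : ℂ) : ℂ := ∫ t in (0 : ℝ)..1, f (a + t * (b - a)) * (b - a)

theorem mem_segment_param (a b : ℂ) {t : ℝ} (ht : t ∈ Icc (0 : ℝ) 1) :
    a + t * (b - a) ∈ segment ℝ a b := by
  rw [segment_eq_image']
  exact ⟨t, ht, by simp⟩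

theorem segInt_eq_sub {f P : ℂ → ℂ} {a b : ℂ} {U : Set ℂ}
    (hP : ∀ z ∈ U, HasDerivAt P (f z) z) (hf : DifferentiableOn ℂ f U)
    (hs : segment ℝ a b ⊆ U) : segInt f a b = P b - P a := by
  have hder : ∀ t ∈ uIcc (0 : ℝ) 1, HasDerivAt (fun t : ℝ => P (a + t * (b - a)))
      (f (a + t * (b - a)) * (b - a)) t := fun t ht => by
    rw [uIcc_of_le zero_le_one] at ht
    have h1 : HasDerivAt (fun t : ℂ => a + t * (b - a)) (b - a) (t : ℂ) := by
      simpa using ((hasDerivAt_id (t : ℂ)).mul_const (b - a)).const_add a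
    have h2 := (hP _ (hs (mem_segment_param a b ht))).comp (t : ℂ) h1
    exact h2.comp_ofReal
  rw [segInt, intervalIntegral.integral_eq_sub_of_hasDerivAt hder]
  · simp
  · apply ContinuousOn.intervalIntegrable
    rw [uIcc_of_le zero_le_one]
    refine ContinuousOn.mul ?_ continuousOn_const
    exact hf.continuousOn.comp (f := fun t : ℝ => a + t * (b - a)) (by fun_prop)
      fun t ht => hs (mem_segment_param a b ht)

/-- Integrate along segments from the centre. The derivative under the integral sign equals the
`t`-derivative of $t f(c+t(z-c))$, so its integral is $f(z)$ and no form of Cauchy's theorem is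
needed. -/
theorem exists_primitive_of_starConvex {f : ℂ → ℂ} {U : Set ℂ} {c : ℂ} (hU : IsOpen U)
    (hs : StarConvex ℝ c U) (hf : DifferentiableOn ℂ f U) :
    ∃ P : ℂ → ℂ, ∀ z ∈ U, HasDerivAt P (f z) z := by
  refine ⟨fun z => ∫ t in (0 : ℝ)..1, f (c + t * (z - c)) * (z - c), fun z hz => ?_⟩
  have hmem : ∀ z ∈ U, ∀ t ∈ Icc (0 : ℝ) 1, c + t * (z - c) ∈ U := fun z hz t ht =>
    hs.segment_subset hz (mem_segment_param c z ht)
  have hinner : ∀ t : ℝ, ∀ z : ℂ, HasDerivAt (fun z : ℂ => c + t * (z - c)) (t : ℂ) z :=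
    fun t z => by simpa using (((hasDerivAt_id z).sub_const c).const_mul (t : ℂ)).const_add c
  have hfa : ∀ z ∈ U, HasDerivAt f (deriv f z) z := fun z hz =>
    (hf.differentiableAt (hU.mem_nhds hz)).hasDerivAt
  have hder : ∀ t ∈ Icc (0 : ℝ) 1, ∀ z ∈ U, HasDerivAt (fun z => f (c + t * (z - c)) * (z - c))
      (deriv f (c + t * (z - c)) * t * (z - c) + f (c + t * (z - c)) * 1) z := fun t ht z hz =>
    ((hfa _ (hmem z hz t ht)).comp z (hinner t z)).mul ((hasDerivAt_id z).sub_const c)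
  have hmain := hasDerivAt_intervalIntegral_of_differentiableOn
    (g := fun z t => f (c + t * (z - c)) * (z - c)) zero_le_one hU ?_
    (fun t ht z hz => (hder t ht z hz).differentiableAt.differentiableWithinAt) hz
  · convert hmain using 1
    have hder2 : ∀ t ∈ uIcc (0 : ℝ) 1, HasDerivAt (fun t : ℝ => (t : ℂ) * f (c + t * (z - c)))
        (deriv (fun z => f (c + t * (z - c)) * (z - c)) z) t := fun t ht => by
      rw [uIcc_of_le zero_le_one] at ht
      have h1 : HasDerivAt (fun t : ℂ => c + t * (z - c)) (z - c) (t : ℂ) := by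
        simpa using ((hasDerivAt_id (t : ℂ)).mul_const (z - c)).const_add c
      have h2 := ((hasDerivAt_id (t : ℂ)).mul
        ((hfa _ (hmem z hz t ht)).comp (t : ℂ) h1)).comp_ofReal
      rw [(hder t ht z hz).deriv]
      refine HasDerivAt.congr_deriv (f := fun t : ℝ => (t : ℂ) * f (c + t * (z - c))) h2 ?_
      simp only [id, Function.comp_apply]
      ring
    rw [intervalIntegral.integral_eq_sub_of_hasDerivAt hder2]
    · simp
    · apply ContinuousOn.intervalIntegrable
      rw [uIcc_of_le zero_le_one]
      refine ContinuousOn.congr (f := fun t : ℝ =>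
        deriv f (c + t * (z - c)) * t * (z - c) + f (c + t * (z - c)) * 1) ?_
        fun t ht => (hder t ht z hz).deriv
      have h3 : ContinuousOn (fun t : ℝ => c + t * (z - c)) (Icc 0 1) := by fun_prop
      have h4 := (hf.deriv hU).continuousOn.comp h3 fun t ht => hmem z hz t ht
      have h5 := hf.continuousOn.comp h3 fun t ht => hmem z hz t ht
      exact ((h4.mul (by fun_prop)).mul continuousOn_const).add (h5.mul continuousOn_const)
  · refine ContinuousOn.mul (hf.continuousOn.comp
      (f := fun p : ℂ × ℝ => c + p.2 * (p.1 - c)) (by fun_prop) fun p hp =>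
      hmem p.1 hp.1 p.2 hp.2) (by fun_prop)

theorem exists_primitive_of_convex {f : ℂ → ℂ} {U : Set ℂ} (hU : IsOpen U)
    (hs : Convex ℝ U) (hf : DifferentiableOn ℂ f U) :
    ∃ P : ℂ → ℂ, ∀ z ∈ U, HasDerivAt P (f z) z := by
  rcases U.eq_empty_or_nonempty with rfl | ⟨c, hc⟩
  · exact ⟨0, by simp⟩
  · exact exists_primitive_of_starConvex hU (hs.starConvex hc) hf

/-- Compares primitives built on different cut planes, on a strip where the two determinations of
the integrand coincide. -/
theorem sub_eq_sub_of_hasDerivAt_eq {f g P Q : ℂ → ℂ} {U : Set ℂ} (hU : IsOpen U)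
    (hs : IsPreconnected U) (hP : ∀ z ∈ U, HasDerivAt P (f z) z)
    (hQ : ∀ z ∈ U, HasDerivAt Q (g z) z) (hfg : EqOn f g U) {a b : ℂ} (ha : a ∈ U) (hb : b ∈ U) :
    P a - Q a = P b - Q b := by
  have h : ∀ z ∈ U, HasDerivAt (fun z => P z - Q z) 0 z := fun z hz => by
    have h1 := (hP z hz).sub (hQ z hz)
    rwa [hfg hz, sub_self] at h1
  exact hU.is_const_of_deriv_eq_zero hs
    (fun z hz => (h z hz).differentiableAt.differentiableWithinAt) (fun z hz => (h z hz).deriv) ha hb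

theorem norm_sub_le_of_hasDerivAt {f P : ℂ → ℂ} {s : Set ℂ} (hs : Convex ℝ s)
    (hP : ∀ z ∈ s, HasDerivAt P (f z) z) {C : ℝ} (hC : ∀ z ∈ s, ‖f z‖ ≤ C) {a b : ℂ}
    (ha : a ∈ s) (hb : b ∈ s) : ‖P b - P a‖ ≤ C * ‖b - a‖ :=
  hs.norm_image_sub_le_of_norm_hasDerivWithin_le (fun z hz => (hP z hz).hasDerivWithinAt) hC ha hb

theorem differentiableOn_segInt {E : ℂ → ℂ → ℂ} {U : Set ℂ} {a b : ℂ → ℂ} (hU : IsOpen U)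
    (ha : DifferentiableOn ℂ a U) (hb : DifferentiableOn ℂ b U) {W : Set (ℂ × ℂ)}
    (hE : DifferentiableOn ℂ (Function.uncurry E) W)
    (hs : ∀ z ∈ U, ∀ x ∈ segment ℝ (a z) (b z), (z, x) ∈ W) :
    DifferentiableOn ℂ (fun z => segInt (E z) (a z) (b z)) U := by
  have hmem : ∀ z ∈ U, ∀ t ∈ Icc (0 : ℝ) 1, (z, a z + t * (b z - a z)) ∈ W := fun z hz t ht =>
    hs z hz _ (mem_segment_param _ _ ht)
  refine differentiableOn_intervalIntegral zero_le_one hU ?_ fun t ht => ?_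
  · have h1 : ContinuousOn (fun p : ℂ × ℝ => a p.1) (U ×ˢ Icc (0 : ℝ) 1) :=
      ha.continuousOn.comp continuousOn_fst fun p hp => hp.1
    have h2 : ContinuousOn (fun p : ℂ × ℝ => b p.1) (U ×ˢ Icc (0 : ℝ) 1) :=
      hb.continuousOn.comp continuousOn_fst fun p hp => hp.1
    have h3 : ContinuousOn (fun p : ℂ × ℝ => (p.1, a p.1 + p.2 * (b p.1 - a p.1)))
        (U ×ˢ Icc (0 : ℝ) 1) :=
      continuousOn_fst.prodMk (h1.add (ContinuousOn.mul (by fun_prop) (h2.sub h1)))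
    exact (hE.continuousOn.comp h3 fun p hp => hmem p.1 hp.1 p.2 hp.2).mul (h2.sub h1)
  · have h3 : DifferentiableOn ℂ (fun z => (z, a z + t * (b z - a z))) U :=
      differentiableOn_id.prodMk (ha.add ((hb.sub ha).const_mul _))
    exact (hE.comp h3 fun z hz => hmem z hz t ht).mul (hb.sub ha)

/-- A transitive relation on the line that holds across every point holds between points
close to the endpoints of any interval. -/
theorem exists_rel_of_locally {P : ℝ → ℝ → Prop} (htrans : ∀ x y z, P x y → P y z → P x z)
    {a b : ℝ} (hab : a ≤ b)
    (hloc : ∀ s ∈ Icc a b, ∃ δ > 0, ∀ x ∈ Ioo (s - δ) s, ∀ y ∈ Ioo s (s + δ), P x y)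
    {ε : ℝ} (hε : 0 < ε) :
    ∃ a' ∈ Ioo (a - ε) a, ∃ b' ∈ Ioo b (b + ε), P a' b' := by
  obtain ⟨δ, hδ, h0⟩ := hloc a ⟨le_rfl, hab⟩
  set a' := a - min ε δ / 2 with ha'
  have hm : 0 < min ε δ := lt_min hε hδ
  have hm1 := min_le_left ε δ
  have hm2 := min_le_right ε δ
  refine ⟨a', ⟨by linarith, by linarith⟩, ?_⟩
  -- Real induction: at the infimum of the points not yet reached from `a'`, the local relation
  -- reaches a whole interval to the right, a contradiction.
  have key : ∀ s ∈ Icc a b, ∃ δ > 0, ∀ y ∈ Ioo s (s + δ), P a' y := by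
    have hclosed : ∀ s ∈ Icc a b, (∀ t ∈ Ico a s, ∃ δ > 0, ∀ y ∈ Ioo t (t + δ), P a' y) →
        ∃ δ > 0, ∀ y ∈ Ioo s (s + δ), P a' y := by
      intro s hs hprev
      rcases hs.1.eq_or_lt with rfl | hlt
      · exact ⟨δ, hδ, fun y hy => h0 a' ⟨by linarith, by linarith⟩ y hy⟩
      · obtain ⟨δs, hδs, hP⟩ := hloc s hs
        obtain ⟨δt, hδt, hQ⟩ := hprev (max a (s - δs / 2)) ⟨le_max_left _ _, max_lt hlt (by linarith)⟩
        set t := max a (s - δs / 2)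
        have ht1 : t < s := max_lt hlt (by linarith)
        have ht2 : s - δs / 2 ≤ t := le_max_right _ _
        set x := t + min δt (s - t) / 2
        have hx0 : 0 < min δt (s - t) := lt_min hδt (by linarith)
        have hx1 := min_le_left δt (s - t)
        have hx2 := min_le_right δt (s - t)
        refine ⟨δs, hδs, fun y hy => htrans _ x _ (hQ x ⟨?_, ?_⟩) (hP x ⟨?_, ?_⟩ y hy)⟩ <;>
          simp only [x] <;> linarith
    by_contra hcon
    push Not at hcon
    obtain ⟨s₁, hs₁, hbad⟩ := hcon
    set S := {s | s ∈ Icc a b ∧ ¬ ∃ δ > 0, ∀ y ∈ Ioo s (s + δ), P a' y} with hS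
    have hSne : S.Nonempty := ⟨s₁, hs₁, by push Not; exact hbad⟩
    have hSb : BddBelow S := ⟨a, fun s hs => hs.1.1⟩
    set m := sInf S with hmdef
    have hm_mem : m ∈ Icc a b :=
      ⟨le_csInf hSne fun s hs => hs.1.1, (csInf_le hSb hSne.choose_spec).trans hSne.choose_spec.1.2⟩
    obtain ⟨δm, hδm, hPm⟩ := hclosed m hm_mem fun t ht => by
      by_contra h
      exact absurd (csInf_le hSb (show t ∈ S from ⟨⟨ht.1, ht.2.le.trans hm_mem.2⟩, h⟩))
        (not_le.2 ht.2)
    obtain ⟨s, hsS, hslt⟩ := exists_lt_of_csInf_lt hSne (show sInf S < m + δm by linarith)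
    have hms : m ≤ s := csInf_le hSb hsS
    exact hsS.2 ⟨m + δm - s, by linarith, fun y hy => hPm y ⟨by linarith [hy.1], by linarith [hy.2]⟩⟩
  obtain ⟨δb, hδb, hP⟩ := key b ⟨hab, le_rfl⟩
  have hmb : 0 < min ε δb := lt_min hε hδb
  have hmb1 := min_le_left ε δb
  have hmb2 := min_le_right ε δb
  exact ⟨b + min ε δb / 2, ⟨by linarith, by linarith⟩, hP _ ⟨by linarith, by linarith⟩⟩

end

noncomputable section

/-! ### The convolution kernel near a pair of singularities -/

/-- A determination of `log (1 - exp x)`, holomorphic off the translates of `[0, ∞)`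
by `2πiℤ`. -/
def logLeft (x : ℂ) : ℂ := Complex.log (1 - exp x)

/-- A determination of `log (1 - exp x)`, holomorphic off the translates of `(-∞, 0]`
by `2πiℤ`. -/
def logRight (x : ℂ) : ℂ := x + Real.pi * I + Complex.log (1 - exp (-x))

theorem one_sub_exp_mem_slitPlane_of_re {x : ℂ} (h : x.re < 0) : 1 - exp x ∈ slitPlane := by
  left
  have h1 : (exp x).re ≤ ‖exp x‖ := Complex.re_le_norm _
  rw [Complex.norm_exp] at h1
  have h2 := Real.exp_lt_one_iff.2 h
  simp only [sub_re, one_re]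
  linarith

/-- $1-e^x$ can be real and nonpositive only if $e^x\ge1$, which forces
$\operatorname{Im}x\in2\pi\mathbb Z$; in the open strip only $\operatorname{Im}x=0$ would remain. -/
theorem one_sub_exp_mem_slitPlane_of_im {x : ℂ} (h : |x.im| < 2 * Real.pi) (h0 : x.im ≠ 0) :
    1 - exp x ∈ slitPlane := by
  by_cases hs : Real.sin x.im = 0
  · left
    have hc : Real.cos x.im = -1 := by
      have h3 := Real.sin_sq_add_cos_sq x.im
      rw [hs] at h3
      have h4 : Real.cos x.im ^ 2 = 1 := by linarith
      rcases mul_self_eq_one_iff.1 (by rw [← sq]; exact h4 : Real.cos x.im * Real.cos x.im = 1) with h5 | h5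
      · exfalso
        obtain ⟨n, hn⟩ := (Real.cos_eq_one_iff _).1 h5
        rw [← hn] at h h0
        have hpi := Real.pi_pos
        rw [abs_mul, abs_of_pos (by positivity : 0 < 2 * Real.pi)] at h
        have h6 : |(n : ℝ)| < 1 := by nlinarith
        have h7 : |n| < 1 := by exact_mod_cast h6
        rw [Int.abs_lt_one_iff] at h7
        simp [h7] at h0
      · exact h5
    simp only [sub_re, one_re, exp_re, hc]
    have := Real.exp_pos x.re
    linarith
  · right
    simp only [sub_im, one_im, exp_im, zero_sub, neg_ne_zero]
    exact mul_ne_zero (Real.exp_pos _).ne' hs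

theorem exp_logLeft {x : ℂ} (h : 1 - exp x ≠ 0) : exp (logLeft x) = 1 - exp x :=
  Complex.exp_log h

/-- This is $1-e^x=e^{x+\pi i}(1-e^{-x})$. -/
theorem exp_logRight {x : ℂ} (h : 1 - exp (-x) ≠ 0) : exp (logRight x) = 1 - exp x := by
  rw [logRight, Complex.exp_add, Complex.exp_log h, Complex.exp_add, exp_pi_mul_I]
  have : exp x * exp (-x) = 1 := by rw [← Complex.exp_add]; simp
  linear_combination this

theorem logLeft_add_two_pi (x : ℂ) : logLeft (x + 2 * Real.pi * I) = logLeft x := by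
  rw [logLeft, Complex.exp_periodic x, logLeft]

theorem logRight_add_two_pi (x : ℂ) :
    logRight (x + 2 * Real.pi * I) = logRight x + 2 * Real.pi * I := by
  have : exp (-(x + 2 * Real.pi * I)) = exp (-x) := by
    rw [neg_add, ← sub_eq_add_neg, Complex.exp_periodic.sub_eq]
  rw [logRight, this, logRight]
  ring

theorem sign_im_log {σ : ℝ} (hσ : σ = 1 ∨ σ = -1) {z : ℂ} (h : 0 < σ * z.im) :
    0 < σ * (Complex.log z).im ∧ σ * (Complex.log z).im < Real.pi := by
  rw [Complex.log_im]
  rcases hσ with rfl | rfl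
  · have h0 : 0 < z.im := by linarith
    have h1 := Complex.arg_nonneg_iff.2 h0.le
    have h2 := Complex.arg_le_pi z
    have h3 : z.arg ≠ 0 := fun h => by
      have := (Complex.arg_eq_zero_iff.1 h).2; linarith
    have h4 : z.arg ≠ Real.pi := fun h => by
      have := (Complex.arg_eq_pi_iff.1 h).2; linarith
    exact ⟨by rw [one_mul]; exact lt_of_le_of_ne h1 (Ne.symm h3),
      by rw [one_mul]; exact lt_of_le_of_ne h2 h4⟩
  · have h0 : z.im < 0 := by linarith
    have h1 := Complex.arg_neg_iff.2 h0
    have h2 := Complex.neg_pi_lt_arg z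
    constructor <;> linarith

/-- Both sides are logarithms of $1-e^x$, so they differ by $2\pi i n$, and bounds on the imaginary
parts leave only $n=1$. This jump is what turns `Ψ` into its continuation once round the singularity
$u=z/\beta$. -/
theorem logRight_eq_add_of_im_pos {x : ℂ} (h0 : 0 < x.im) (h1 : x.im < 2 * Real.pi) :
    logRight x = logLeft x + 2 * Real.pi * I := by
  have hpi := Real.pi_pos
  have ha : |x.im| < 2 * Real.pi := by rw [abs_of_pos h0]; exact h1
  have hb : |(-x).im| < 2 * Real.pi := by rw [neg_im, abs_neg]; exact ha
  have hx := one_sub_exp_mem_slitPlane_of_im ha h0.ne'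
  have hnx := one_sub_exp_mem_slitPlane_of_im hb (by simpa using h0.ne')
  have hexp : exp (logRight x) = exp (logLeft x) := by
    rw [exp_logRight (slitPlane_ne_zero hnx), exp_logLeft (slitPlane_ne_zero hx)]
  obtain ⟨n, hn⟩ := Complex.exp_eq_exp_iff_exists_int.1 hexp
  suffices n = 1 by rw [hn, this]; simp
  have him : (logRight x).im = (logLeft x).im + n * (2 * Real.pi) := by
    rw [hn]; simp
  have hR : (logRight x).im = x.im + Real.pi + (Complex.log (1 - exp (-x))).im := by
    simp [logRight]
  have hL : (logLeft x).im = (Complex.log (1 - exp x)).im := rfl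
  have i1 : (1 - exp x).im = -(Real.exp x.re * Real.sin x.im) := by simp [exp_im]
  have i2 : (1 - exp (-x)).im = Real.exp (-x.re) * Real.sin x.im := by simp [exp_im]
  have e1 := Real.exp_pos x.re
  have e2 := Real.exp_pos (-x.re)
  have hlow : 0 < (n : ℝ) * (2 * Real.pi) ∧ (n : ℝ) * (2 * Real.pi) < 4 * Real.pi := by
    rcases lt_trichotomy x.im Real.pi with h | h | h
    · have hs := Real.sin_pos_of_pos_of_lt_pi h0 h
      have s1 := sign_im_log (Or.inr rfl) (z := 1 - exp x) (by rw [i1]; nlinarith [mul_pos e1 hs])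
      have s2 := sign_im_log (Or.inl rfl) (z := 1 - exp (-x))
        (by rw [i2]; nlinarith [mul_pos e2 hs])
      constructor <;> linarith [s1.1, s1.2, s2.1, s2.2]
    · have s1 : (Complex.log (1 - exp x)).im = 0 := by
        rw [Complex.log_im, Complex.arg_eq_zero_iff, i1, h, Real.sin_pi]
        simp [exp_re, h]; positivity
      have s2 : (Complex.log (1 - exp (-x))).im = 0 := by
        rw [Complex.log_im, Complex.arg_eq_zero_iff, i2, h, Real.sin_pi]
        simp [exp_re, h]; positivity
      constructor <;> linarith
    · have hs : Real.sin x.im < 0 := by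
        rw [← Real.sin_sub_two_pi]
        exact Real.sin_neg_of_neg_of_neg_pi_lt (by linarith) (by linarith)
      have s1 := sign_im_log (Or.inl rfl) (z := 1 - exp x) (by rw [i1]; nlinarith [mul_pos e1 (neg_pos.2 hs)])
      have s2 := sign_im_log (Or.inr rfl) (z := 1 - exp (-x))
        (by rw [i2]; nlinarith [mul_pos e2 (neg_pos.2 hs)])
      constructor <;> linarith [s1.1, s1.2, s2.1, s2.2]
  have n0 : 0 < (n : ℝ) := by nlinarith [hlow.1]
  have n2 : (n : ℝ) < 2 := by nlinarith [hlow.2]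
  have n0' : 0 < n := by exact_mod_cast n0
  have n2' : n < 2 := by exact_mod_cast n2
  omega

theorem logRight_eq_of_im_neg {x : ℂ} (h0 : x.im < 0) (h1 : -(2 * Real.pi) < x.im) :
    logRight x = logLeft x := by
  have h := logRight_eq_add_of_im_pos (x := x + 2 * Real.pi * I)
    (by simp; linarith) (by simp; linarith)
  rw [logRight_add_two_pi, logLeft_add_two_pi] at h
  exact add_right_cancel h

/-- The integrand `φ(u) ψ(z/u) du/u` at `u = α(1 + exp v)`, `z = αβ(1 + exp ω)`; here `l` is the
chosen determination of `log (1 - exp (v - ω))`. -/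
def convKernel (Φ Ψ : ℂ → ℂ) (ω l v : ℂ) : ℂ :=
  Φ v * Ψ (ω + l - Complex.log (1 + exp v)) * (exp v / (1 + exp v))

/-- `Φ` is `o(exp (-v))` as `Re v → -∞` with `Im v` bounded. -/
def IsSmallBranch (Φ : ℂ → ℂ) : Prop :=
  ∀ M : ℝ, Tendsto (fun v : ℂ => exp v * Φ v)
    (comap Complex.re atBot ⊓ 𝓟 {v : ℂ | |v.im| ≤ M}) (𝓝 0)

theorem one_add_exp_ne_zero {v : ℂ} {R : ℝ} (hR : R ≤ 1 / 4) (hv : ‖exp v‖ < R) :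
    1 + exp v ≠ 0 := fun h => by
  have : exp v = -1 := by linear_combination h
  rw [this] at hv
  norm_num at hv
  linarith

theorem one_add_exp_mem_slitPlane {v : ℂ} {R : ℝ} (hR : R ≤ 1 / 4) (hv : ‖exp v‖ < R) :
    1 + exp v ∈ slitPlane := by
  left
  have h1 := Complex.abs_re_le_norm (exp v)
  have h2 := neg_abs_le (exp v).re
  simp only [add_re, one_re]
  linarith

/-- The argument of `Ψ` lies over $\frac{z}{u\beta}-1=\frac{1+e^\omega}{1+e^v}-1$, for any logarithm
`l` of $1-e^{v-\omega}$. -/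
theorem exp_convKernel_arg {ω l v : ℂ} {R : ℝ} (hR : R ≤ 1 / 4) (hv : ‖exp v‖ < R)
    (hl : exp l = 1 - exp (v - ω)) :
    exp (ω + l - Complex.log (1 + exp v)) = (exp ω - exp v) / (1 + exp v) := by
  rw [Complex.exp_sub, Complex.exp_log (one_add_exp_ne_zero hR hv), Complex.exp_add, hl, mul_sub,
    ← Complex.exp_add]
  simp

/-- The quotient is less than $2R/(3/4)=8R/3$; the factor 4 leaves room. -/
theorem norm_exp_convKernel_arg_lt {ω l v : ℂ} {R r : ℝ} (hR : R ≤ 1 / 4) (hr : 4 * R ≤ r)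
    (hω : ‖exp ω‖ < R) (hv : ‖exp v‖ < R) (hl : exp l = 1 - exp (v - ω)) :
    ‖exp (ω + l - Complex.log (1 + exp v))‖ < r := by
  rw [exp_convKernel_arg hR hv hl, norm_div]
  have h1 : ‖exp ω - exp v‖ < 2 * R := (norm_sub_le _ _).trans_lt (by linarith)
  have h2 : 3 / 4 ≤ ‖1 + exp v‖ := by
    have := norm_sub_le (1 + exp v) (exp v)
    rw [add_sub_cancel_right, norm_one] at this
    linarith
  have hR0 : 0 < R := (norm_nonneg _).trans_lt hω
  rw [div_lt_iff₀ (by linarith)]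
  nlinarith

theorem isOpen_norm_exp_lt (r : ℝ) : IsOpen {w : ℂ | ‖exp w‖ < r} :=
  isOpen_lt (by fun_prop) continuous_const

/-- The source is an arbitrary normed space, so that one statement covers differentiation in the
variable of integration and joint differentiation in it and `ω`. -/
theorem convKernel_differentiableAt {X : Type*} [NormedAddCommGroup X] [NormedSpace ℂ X]
    {Φ Ψ : ℂ → ℂ} {R r : ℝ} (hR : R ≤ 1 / 4) (hr : 4 * R ≤ r)
    (hΦ : DifferentiableOn ℂ Φ {w | ‖exp w‖ < r}) (hΨ : DifferentiableOn ℂ Ψ {w | ‖exp w‖ < r})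
    {ω l v : X → ℂ} {x : X} (dω : DifferentiableAt ℂ ω x) (dl : DifferentiableAt ℂ l x)
    (dv : DifferentiableAt ℂ v x) (hω : ‖exp (ω x)‖ < R) (hv : ‖exp (v x)‖ < R)
    (hl : exp (l x) = 1 - exp (v x - ω x)) :
    DifferentiableAt ℂ (fun x => convKernel Φ Ψ (ω x) (l x) (v x)) x := by
  have hR0 : 0 < R := (norm_nonneg _).trans_lt hω
  have h1 : DifferentiableAt ℂ Φ (v x) := hΦ.differentiableAt
    ((isOpen_norm_exp_lt r).mem_nhds (by simp only [mem_ofPred_eq]; linarith))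
  have h2 : DifferentiableAt ℂ Ψ (ω x + l x - Complex.log (1 + exp (v x))) := hΨ.differentiableAt
    ((isOpen_norm_exp_lt r).mem_nhds (norm_exp_convKernel_arg_lt hR hr hω hv hl))
  have h3 : DifferentiableAt ℂ (fun x => Complex.log (1 + exp (v x))) x :=
    (dv.cexp.const_add 1).clog (one_add_exp_mem_slitPlane hR hv)
  have h4 : DifferentiableAt ℂ (fun x => ω x + l x - Complex.log (1 + exp (v x))) x :=
    (dω.add dl).sub h3
  have h5 : DifferentiableAt ℂ (fun x => Φ (v x)) x := h1.comp x dv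
  have h6 : DifferentiableAt ℂ (fun x => Ψ (ω x + l x - Complex.log (1 + exp (v x)))) x :=
    h2.comp x h4
  have h7 : DifferentiableAt ℂ (fun x => exp (v x) / (1 + exp (v x))) x :=
    DifferentiableAt.comp x (g := fun y : ℂ => exp y / (1 + exp y))
      (Complex.differentiableAt_exp.fun_div (Complex.differentiableAt_exp.const_add 1)
        (one_add_exp_ne_zero hR hv)) dv
  exact (h5.mul h6).mul h7

theorem logLeft_differentiableAt {x : ℂ} (h : 1 - exp x ∈ slitPlane) :
    DifferentiableAt ℂ logLeft x :=
  ((Complex.differentiable_exp x).const_sub 1).clog h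

theorem logRight_differentiableAt {x : ℂ} (h : 1 - exp (-x) ∈ slitPlane) :
    DifferentiableAt ℂ logRight x :=
  (differentiableAt_id.add_const _).add
    ((((differentiableAt_id (x := x)).neg).cexp.const_sub 1).clog h)

/-- The integrand in terms of its size at the two singularities. -/
theorem exp_mul_convKernel {Φ Ψ : ℂ → ℂ} {ω l v : ℂ} {R : ℝ} (hR : R ≤ 1 / 4)
    (hv : ‖exp v‖ < R) (hl : exp l = 1 - exp (v - ω)) :
    exp ω * convKernel Φ Ψ ω l v = (exp v * Φ v) *
      (exp (ω + l - Complex.log (1 + exp v)) * Ψ (ω + l - Complex.log (1 + exp v))) *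
        (1 - exp (v - ω))⁻¹ := by
  have h0 : 1 - exp (v - ω) ≠ 0 := hl ▸ Complex.exp_ne_zero _
  have h1 := one_add_exp_ne_zero hR hv
  have h2 : exp ω * (1 - exp (v - ω)) = exp ω - exp v := by
    rw [mul_sub, ← Complex.exp_add]; simp
  rw [convKernel]
  rw [exp_convKernel_arg hR hv hl, ← h2]
  field_simp

theorem IsSmallBranch.shift {Φ : ℂ → ℂ} (h : IsSmallBranch Φ) : IsSmallBranch (monodromyShift Φ) := by
  intro M
  have h1 := h (M + 2 * Real.pi)
  have h2 : Tendsto (fun v : ℂ => v + 2 * (Real.pi : ℂ) * I)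
      (comap Complex.re atBot ⊓ 𝓟 {v : ℂ | |v.im| ≤ M})
      (comap Complex.re atBot ⊓ 𝓟 {v : ℂ | |v.im| ≤ M + 2 * Real.pi}) := by
    refine tendsto_inf.2 ⟨?_, ?_⟩
    · rw [tendsto_comap_iff]
      refine (tendsto_comap.mono_left inf_le_left).congr fun v => ?_
      simp
    · refine tendsto_principal.2 (eventually_inf_principal.2 (Eventually.of_forall fun v hv => ?_))
      have h3 : (v + 2 * (Real.pi : ℂ) * I).im = v.im + 2 * Real.pi := by simp
      simp only [mem_ofPred_eq, h3] at hv ⊢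
      calc |v.im + 2 * Real.pi| ≤ |v.im| + |2 * Real.pi| := abs_add_le _ _
        _ ≤ _ := by rw [abs_of_pos (by positivity : 0 < 2 * Real.pi)]; linarith
  refine (h1.comp h2).congr fun v => ?_
  simp [monodromyShift, Complex.exp_periodic v]

theorem shift_differentiableOn {Φ : ℂ → ℂ} {r : ℝ}
    (h : DifferentiableOn ℂ Φ {w | ‖exp w‖ < r}) :
    DifferentiableOn ℂ (monodromyShift Φ) {w | ‖exp w‖ < r} :=
  h.comp (differentiableOn_id.add_const _) fun w hw => by
    simpa [Complex.exp_periodic w] using hw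

end

noncomputable section

/-! ### The convolution integral as a difference of primitives -/

/-- The part `Re x < B`, `|Im x| < 2π` of the plane cut along `[0, ∞)`. -/
def slitLeft (B : ℝ) : Set ℂ := {x | x.re < B ∧ |x.im| < 2 * Real.pi ∧ (x.re < 0 ∨ x.im ≠ 0)}

/-- The part `Re x < B`, `|Im x| < 2π` of the plane cut along `(-∞, 0]`. -/
def slitRight (B : ℝ) : Set ℂ := {x | x.re < B ∧ |x.im| < 2 * Real.pi ∧ (0 < x.re ∨ x.im ≠ 0)}

theorem isOpen_slitLeft (B : ℝ) : IsOpen (slitLeft B) := by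
  have h1 : IsOpen {x : ℂ | x.re < B} := isOpen_lt Complex.continuous_re continuous_const
  have h2 : IsOpen {x : ℂ | |x.im| < 2 * Real.pi} :=
    isOpen_lt Complex.continuous_im.abs continuous_const
  have h3 : IsOpen {x : ℂ | x.re < 0} := isOpen_lt (by fun_prop) (by fun_prop)
  have h4 : IsOpen {x : ℂ | x.im ≠ 0} := isOpen_ne_fun (by fun_prop) (by fun_prop)
  convert h1.inter (h2.inter (h3.union h4)) using 1
  ext
  simp [slitLeft]

theorem isOpen_slitRight (B : ℝ) : IsOpen (slitRight B) := by
  have h1 : IsOpen {x : ℂ | x.re < B} := isOpen_lt Complex.continuous_re continuous_const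
  have h2 : IsOpen {x : ℂ | |x.im| < 2 * Real.pi} :=
    isOpen_lt Complex.continuous_im.abs continuous_const
  have h3 : IsOpen {x : ℂ | 0 < x.re} := isOpen_lt (by fun_prop) (by fun_prop)
  have h4 : IsOpen {x : ℂ | x.im ≠ 0} := isOpen_ne_fun (by fun_prop) (by fun_prop)
  convert h1.inter (h2.inter (h3.union h4)) using 1
  ext
  simp [slitRight]

theorem starConvex_slitLeft {B : ℝ} (hB : 1 < B) : StarConvex ℝ (-1 : ℂ) (slitLeft B) := by
  rintro x ⟨h1, h2, h3⟩ a b ha hb hab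
  have hre : (a • (-1 : ℂ) + b • x).re = -a + b * x.re := by simp
  have him : (a • (-1 : ℂ) + b • x).im = b * x.im := by simp
  refine ⟨?_, ?_, ?_⟩
  · rw [hre]
    rcases hb.eq_or_lt with rfl | hb
    · linarith
    · nlinarith
  · rw [him, abs_mul, abs_of_nonneg hb]; nlinarith [abs_nonneg x.im]
  · rw [hre, him]
    rcases hb.eq_or_lt with rfl | hb
    · left; linarith
    · rcases h3 with h3 | h3
      · left; nlinarith
      · right; exact mul_ne_zero hb.ne' h3

theorem starConvex_slitRight {B : ℝ} (hB : 1 < B) : StarConvex ℝ (1 : ℂ) (slitRight B) := by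
  rintro x ⟨h1, h2, h3⟩ a b ha hb hab
  have hre : (a • (1 : ℂ) + b • x).re = a + b * x.re := by simp
  have him : (a • (1 : ℂ) + b • x).im = b * x.im := by simp
  refine ⟨?_, ?_, ?_⟩
  · rw [hre]
    rcases hb.eq_or_lt with rfl | hb
    · linarith
    · nlinarith
  · rw [him, abs_mul, abs_of_nonneg hb]; nlinarith [abs_nonneg x.im]
  · rw [hre, him]
    rcases hb.eq_or_lt with rfl | hb
    · left; linarith
    · rcases h3 with h3 | h3
      · left; nlinarith
      · right; exact mul_ne_zero hb.ne' h3

theorem one_sub_exp_mem_slitPlane_left {B : ℝ} {x : ℂ} (hx : x ∈ slitLeft B) :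
    1 - exp x ∈ slitPlane :=
  hx.2.2.elim one_sub_exp_mem_slitPlane_of_re (one_sub_exp_mem_slitPlane_of_im hx.2.1)

theorem one_sub_exp_mem_slitPlane_right {B : ℝ} {x : ℂ} (hx : x ∈ slitRight B) :
    1 - exp (-x) ∈ slitPlane :=
  hx.2.2.elim (fun h => one_sub_exp_mem_slitPlane_of_re (by simpa using h))
    (fun h => one_sub_exp_mem_slitPlane_of_im (by simpa using hx.2.1) (by simpa using h))

theorem norm_exp_add_lt {ω x : ℂ} {B R : ℝ} (hB : ‖exp ω‖ * Real.exp B ≤ R) (hx : x.re < B) :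
    ‖exp (ω + x)‖ < R := by
  rw [Complex.exp_add, norm_mul, Complex.norm_exp x]
  refine lt_of_lt_of_le ?_ hB
  exact mul_lt_mul_of_pos_left (Real.exp_lt_exp.2 hx) (norm_pos_iff.2 (Complex.exp_ne_zero _))

theorem kernelLeft_differentiableOn {Φ Ψ : ℂ → ℂ} {R r B : ℝ} {ω : ℂ} (hR : R ≤ 1 / 4)
    (hr : 4 * R ≤ r)
    (hΦ : DifferentiableOn ℂ Φ {w | ‖exp w‖ < r}) (hΨ : DifferentiableOn ℂ Ψ {w | ‖exp w‖ < r})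
    (hω : ‖exp ω‖ < R) (hB : ‖exp ω‖ * Real.exp B ≤ R) :
    DifferentiableOn ℂ (fun x => convKernel Φ Ψ ω (logLeft x) (ω + x)) (slitLeft B) := by
  intro x hx
  have h := one_sub_exp_mem_slitPlane_left hx
  refine (convKernel_differentiableAt hR hr hΦ hΨ (differentiableAt_const ω)
    (logLeft_differentiableAt h) (differentiableAt_id.const_add ω) hω
    (norm_exp_add_lt hB hx.1) ?_).differentiableWithinAt
  rw [exp_logLeft (slitPlane_ne_zero h), id, add_sub_cancel_left]

theorem kernelRight_differentiableOn {Φ Ψ : ℂ → ℂ} {R r B : ℝ} {ω : ℂ} (hR : R ≤ 1 / 4)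
    (hr : 4 * R ≤ r)
    (hΦ : DifferentiableOn ℂ Φ {w | ‖exp w‖ < r}) (hΨ : DifferentiableOn ℂ Ψ {w | ‖exp w‖ < r})
    (hω : ‖exp ω‖ < R) (hB : ‖exp ω‖ * Real.exp B ≤ R) :
    DifferentiableOn ℂ (fun x => convKernel Φ Ψ ω (logRight x) (ω + x)) (slitRight B) := by
  intro x hx
  have h := one_sub_exp_mem_slitPlane_right hx
  refine (convKernel_differentiableAt hR hr hΦ hΨ (differentiableAt_const ω)
    (logRight_differentiableAt h) (differentiableAt_id.const_add ω) hω
    (norm_exp_add_lt hB hx.1) ?_).differentiableWithinAt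
  rw [exp_logRight (slitPlane_ne_zero h), id, add_sub_cancel_left]

theorem abs_log_im_le_pi (z : ℂ) : |(Complex.log z).im| ≤ Real.pi :=
  abs_le.2 ⟨(Complex.neg_pi_lt_log_im z).le, Complex.log_im_le_pi z⟩

/-- At $x=0$, where $u=z/\beta$, the factor `Φ` is continuous, the factor of `Ψ` tends to zero by
integrability of `β`, and $x/(1-e^x)\to-1$. So the kernel is $o(1/x)$. The determination `l` is left
free, since both cut planes are needed. -/
theorem tendsto_mul_convKernel_zero {Φ Ψ : ℂ → ℂ} {R r : ℝ} {ω : ℂ} (hR : R ≤ 1 / 4)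
    (hr : 4 * R ≤ r) (hΦ : DifferentiableOn ℂ Φ {w | ‖exp w‖ < r}) (sΨ : IsSmallBranch Ψ)
    (hω : ‖exp ω‖ < R) {l : ℂ → ℂ} {S : Set ℂ} {M : ℝ} (h0 : (0 : ℂ) ∉ S)
    (hl : ∀ x ∈ S, exp (l x) = 1 - exp x) (hM : ∀ x ∈ S, |(l x).im| ≤ M) :
    Tendsto (fun x => x * convKernel Φ Ψ ω (l x) (ω + x)) (𝓝[S] 0) (𝓝 0) := by
  have hR0 : 0 < R := (norm_nonneg _).trans_lt hω
  have hcx : Tendsto (fun x : ℂ => ω + x) (𝓝[S] 0) (𝓝 ω) := by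
    have : Tendsto (fun x : ℂ => ω + x) (𝓝 0) (𝓝 (ω + 0)) := (continuous_const_add ω).tendsto 0
    rw [add_zero] at this
    exact this.mono_left nhdsWithin_le_nhds
  have hmem : {w : ℂ | ‖exp w‖ < R} ∈ 𝓝 ω := (isOpen_norm_exp_lt R).mem_nhds hω
  have hsmall : ∀ᶠ x in 𝓝[S] (0 : ℂ), ‖exp (ω + x)‖ < R := hcx.eventually hmem
  have hΦc : Tendsto (fun x : ℂ => exp (ω + x) * Φ (ω + x)) (𝓝[S] 0) (𝓝 (exp ω * Φ ω)) := by
    have h1 : ContinuousAt Φ ω := (hΦ.differentiableAt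
      ((isOpen_norm_exp_lt r).mem_nhds (by simp only [mem_ofPred_eq]; linarith))).continuousAt
    exact ((Complex.continuous_exp.continuousAt).mul h1).tendsto.comp hcx
  have hexp : Tendsto (fun x : ℂ => exp (ω + l x - Complex.log (1 + exp (ω + x)))) (𝓝[S] 0)
      (𝓝 0) := by
    have h2 : Tendsto (fun x : ℂ => (exp ω - exp (ω + x)) / (1 + exp (ω + x))) (𝓝[S] 0)
        (𝓝 ((exp ω - exp ω) / (1 + exp ω))) := by
      have h3 := (Complex.continuous_exp.tendsto ω).comp hcx
      exact (h3.const_sub _).div (h3.const_add _) (one_add_exp_ne_zero hR hω)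
    rw [sub_self, zero_div] at h2
    refine h2.congr' ?_
    filter_upwards [hsmall, self_mem_nhdsWithin] with x hx hxS
    rw [exp_convKernel_arg hR hx (by rw [hl x hxS, add_sub_cancel_left])]
  have hΨc : Tendsto (fun x : ℂ => exp (ω + l x - Complex.log (1 + exp (ω + x))) *
      Ψ (ω + l x - Complex.log (1 + exp (ω + x)))) (𝓝[S] 0) (𝓝 0) := by
    refine (sΨ (|ω.im| + M + Real.pi)).comp (tendsto_inf.2 ⟨?_, tendsto_principal.2 ?_⟩)
    · rw [← Complex.comap_exp_nhds_zero]
      exact tendsto_comap_iff.2 hexp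
    · filter_upwards [self_mem_nhdsWithin] with x hxS
      have h4 := hM x hxS
      have h5 : |(Complex.log (1 + exp (ω + x))).im| ≤ Real.pi := abs_log_im_le_pi _
      simp only [sub_im, add_im]
      calc _ ≤ |ω.im + (l x).im| + |(Complex.log (1 + exp (ω + x))).im| := abs_sub _ _
        _ ≤ |ω.im| + |(l x).im| + |(Complex.log (1 + exp (ω + x))).im| := by
          gcongr; exact abs_add_le _ _
        _ ≤ _ := by gcongr
  have hq : Tendsto (fun x : ℂ => x * (1 - exp x)⁻¹) (𝓝[S] 0) (𝓝 (-1)) := by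
    have h6 : Tendsto (fun x : ℂ => x⁻¹ * (exp x - 1)) (𝓝[≠] 0) (𝓝 1) := by
      have := (Complex.hasDerivAt_exp 0).tendsto_slope_zero
      simpa using this
    have h7 := (h6.inv₀ one_ne_zero).neg
    rw [inv_one] at h7
    refine (h7.mono_left (nhdsWithin_mono _ fun x hx hx0 => h0 (hx0 ▸ hx))).congr fun x => ?_
    rw [mul_inv, inv_inv, ← mul_neg, ← inv_neg, neg_sub]
  have hfin := ((hΦc.mul hΨc).mul hq).const_mul (exp ω)⁻¹
  simp only [mul_zero, zero_mul] at hfin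
  refine hfin.congr' ?_
  filter_upwards [hsmall, self_mem_nhdsWithin] with x hx hxS
  have h8 := exp_mul_convKernel (Φ := Φ) (Ψ := Ψ) (ω := ω) (l := l x) hR hx
    (by rw [hl x hxS, add_sub_cancel_left])
  rw [add_sub_cancel_left] at h8
  have h9 := Complex.exp_ne_zero ω
  field_simp
  linear_combination (-x) * h8

/-- At the other end $u\to\alpha$: the argument of `Ψ` tends to `ω`, a regular point, while
$e^v\Phi(v)\to0$ is the integrability of `α`. -/
theorem tendsto_convKernel_atBot {Φ Ψ : ℂ → ℂ} {R r : ℝ} {ω : ℂ}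
    (hr : 4 * R ≤ r) (hΨ : DifferentiableOn ℂ Ψ {w | ‖exp w‖ < r}) (sΦ : IsSmallBranch Φ)
    (hω : ‖exp ω‖ < R) (M : ℝ) :
    Tendsto (fun x => convKernel Φ Ψ ω (logLeft x) (ω + x))
      (comap Complex.re atBot ⊓ 𝓟 {x : ℂ | |x.im| ≤ M}) (𝓝 0) := by
  set 𝓕 := comap Complex.re atBot ⊓ 𝓟 {x : ℂ | |x.im| ≤ M}
  have hR0 : 0 < R := (norm_nonneg _).trans_lt hω
  have hre : Tendsto Complex.re 𝓕 atBot := tendsto_comap.mono_left inf_le_left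
  have hex : Tendsto exp 𝓕 (𝓝 0) := by
    have : Tendsto exp (comap Complex.re atBot) (𝓝 0) := by
      rw [← Complex.comap_exp_nhds_zero]; exact tendsto_comap
    exact this.mono_left inf_le_left
  have hshift : Tendsto (fun x : ℂ => ω + x) 𝓕
      (comap Complex.re atBot ⊓ 𝓟 {x : ℂ | |x.im| ≤ |ω.im| + M}) := by
    refine tendsto_inf.2 ⟨tendsto_comap_iff.2 ?_, tendsto_principal.2
      (eventually_inf_principal.2 (Eventually.of_forall fun x hx => ?_))⟩
    · exact (tendsto_atBot_add_const_left _ ω.re hre).congr fun x => by simp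
    · simp only [mem_ofPred_eq, add_im] at hx ⊢
      exact (abs_add_le _ _).trans (by linarith)
  have hexω : Tendsto (fun x => exp (ω + x)) 𝓕 (𝓝 0) := by
    simpa [Complex.exp_add] using hex.const_mul (exp ω)
  have hsmall : ∀ᶠ x in 𝓕, ‖exp (ω + x)‖ < R := by
    have := hexω.norm
    rw [norm_zero] at this
    exact this.eventually_lt_const hR0
  have hL : Tendsto logLeft 𝓕 (𝓝 0) := by
    have h1 : ContinuousAt (fun y : ℂ => Complex.log (1 - y)) 0 := by
      refine ContinuousAt.clog (by fun_prop) ?_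
      simp
    have h2 := h1.tendsto.comp hex
    rw [sub_zero, Complex.log_one] at h2
    exact h2
  have hlog : Tendsto (fun x => Complex.log (1 + exp (ω + x))) 𝓕 (𝓝 0) := by
    have h1 : ContinuousAt (fun y : ℂ => Complex.log (1 + y)) 0 := by
      refine ContinuousAt.clog (by fun_prop) ?_
      simp
    have h2 := h1.tendsto.comp hexω
    simpa [Function.comp_def] using h2
  have hy : Tendsto (fun x => ω + logLeft x - Complex.log (1 + exp (ω + x))) 𝓕 (𝓝 ω) := by
    simpa using (hL.const_add ω).sub hlog
  have hΨc : ContinuousAt Ψ ω := (hΨ.differentiableAt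
      ((isOpen_norm_exp_lt r).mem_nhds (by simp only [mem_ofPred_eq]; linarith))).continuousAt
  have h3 := (((sΦ (|ω.im| + M)).comp hshift).mul (hΨc.tendsto.comp hy)).mul
    ((hexω.const_add 1).inv₀ (by simp))
  simp only [zero_mul] at h3
  refine h3.congr fun x => ?_
  simp only [Function.comp_apply, convKernel]
  ring

theorem log_im_le_four_pi_left (x : ℂ) : |(logLeft x).im| ≤ 4 * Real.pi :=
  (abs_log_im_le_pi _).trans (by linarith [Real.pi_pos])

theorem log_im_le_four_pi_right {B : ℝ} {x : ℂ} (hx : x ∈ slitRight B) :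
    |(logRight x).im| ≤ 4 * Real.pi := by
  have h1 := hx.2.1
  have h2 : |(Complex.log (1 - exp (-x))).im| ≤ Real.pi := abs_log_im_le_pi _
  have h3 : (logRight x).im = x.im + Real.pi + (Complex.log (1 - exp (-x))).im := by simp [logRight]
  rw [h3]
  rw [abs_lt] at h1
  rw [abs_le] at h2 ⊢
  constructor <;> linarith [h1.1, h1.2, h2.1, h2.2]

end

/-! ### Primitives near the two ends of the segment from α to z/β -/

noncomputable section

/-- A segment staying at distances between ε and Cε from the origin has length at most 2Cε, so an
integrand that is $o(1/x)$ contributes $o(1)$. -/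
theorem tendsto_sub_of_tendsto_mul {E P : ℂ → ℂ} {S : Set ℂ} (hP : ∀ x ∈ S, HasDerivAt P (E x) x)
    (hE : Tendsto (fun x => x * E x) (𝓝[S] 0) (𝓝 0)) {a b : ℝ → ℂ} {C : ℝ} (hC : 0 < C)
    (hab : ∀ᶠ ε in 𝓝[>] (0 : ℝ), segment ℝ (a ε) (b ε) ⊆ S ∧
      ∀ x ∈ segment ℝ (a ε) (b ε), ε ≤ ‖x‖ ∧ ‖x‖ ≤ C * ε) :
    Tendsto (fun ε => P (b ε) - P (a ε)) (𝓝[>] 0) (𝓝 0) := by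
  rw [Metric.tendsto_nhds]
  intro η hη
  have h1 : ∀ᶠ x in 𝓝[S] (0 : ℂ), ‖x * E x‖ < η / (4 * C) := by
    have := (Metric.tendsto_nhds.1 hE) (η / (4 * C)) (by positivity)
    simpa [dist_eq_norm] using this
  rw [eventually_nhdsWithin_iff, Metric.eventually_nhds_iff] at h1
  obtain ⟨ρ, hρ, h2⟩ := h1
  have h3 : ∀ᶠ ε in 𝓝[>] (0 : ℝ), ε < ρ / C :=
    eventually_nhdsWithin_of_eventually_nhds (eventually_lt_nhds (by positivity))
  filter_upwards [hab, h3, self_mem_nhdsWithin] with ε h4 h5 hε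
  have hε : 0 < ε := hε
  have hbound : ∀ x ∈ segment ℝ (a ε) (b ε), ‖E x‖ ≤ η / (4 * C) / ε := fun x hx => by
    obtain ⟨h6, h7⟩ := h4.2 x hx
    have h8 := h2 (y := x) (by
      rw [dist_zero_right]
      rw [lt_div_iff₀ hC] at h5
      linarith) (h4.1 hx)
    rw [norm_mul] at h8
    rw [le_div_iff₀ hε]
    nlinarith [norm_nonneg (E x)]
  have h9 := norm_sub_le_of_hasDerivAt (convex_segment (a ε) (b ε))
    (fun z hz => hP z (h4.1 hz)) hbound (left_mem_segment ℝ _ _) (right_mem_segment ℝ _ _)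
  have h10 : ‖b ε - a ε‖ ≤ 2 * (C * ε) := by
    have ha := (h4.2 _ (left_mem_segment ℝ (a ε) (b ε))).2
    have hb := (h4.2 _ (right_mem_segment ℝ (a ε) (b ε))).2
    exact (norm_sub_le _ _).trans (by linarith)
  rw [dist_zero_right]
  calc _ ≤ η / (4 * C) / ε * ‖b ε - a ε‖ := h9
    _ ≤ η / (4 * C) / ε * (2 * (C * ε)) := by gcongr
    _ = η / 2 := by field_simp; norm_num
    _ < η := by linarith

theorem reim_mem_segment {a b x : ℂ} (h : x ∈ segment ℝ a b) :
    ∃ t ∈ Icc (0 : ℝ) 1, x.re = (1 - t) * a.re + t * b.re ∧ x.im = (1 - t) * a.im + t * b.im := by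
  obtain ⟨u, t, hu, ht, hut, rfl⟩ := h
  have : u = 1 - t := by linarith
  subst this
  exact ⟨t, ⟨ht, by linarith⟩, by simp, by simp⟩

theorem norm_le_add_of_reim {x : ℂ} {A : ℝ} (h1 : |x.re| ≤ A) (h2 : |x.im| ≤ A) :
    ‖x‖ ≤ 2 * A :=
  (Complex.norm_le_abs_re_add_abs_im x).trans (by linarith)

/-- The two sides of the cut `(-∞, 0]` of a primitive on `slitRight` meet at the tip. -/
theorem tendsto_sub_across_zero {E P : ℂ → ℂ} {B : ℝ} (hB : 1 < B)
    (hP : ∀ x ∈ slitRight B, HasDerivAt P (E x) x)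
    (hE : Tendsto (fun x => x * E x) (𝓝[slitRight B] 0) (𝓝 0)) :
    Tendsto (fun ε : ℝ => P (-ε + ε * I) - P (-ε - ε * I)) (𝓝[>] 0) (𝓝 0) := by
  have hsmall : ∀ᶠ ε in 𝓝[>] (0 : ℝ), 0 < ε ∧ ε < 1 := by
    filter_upwards [self_mem_nhdsWithin,
      eventually_nhdsWithin_of_eventually_nhds (eventually_lt_nhds one_pos)] with ε h1 h2
    exact ⟨h1, h2⟩
  have hpi := Real.pi_gt_three
  have key : ∀ x : ℂ, ∀ ε : ℝ, 0 < ε → ε < 1 → |x.re| ≤ ε → |x.im| ≤ ε →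
      (x.re = ε ∨ |x.im| = ε) → x ∈ slitRight B ∧ ε ≤ ‖x‖ ∧ ‖x‖ ≤ 2 * ε := by
    intro x ε h0 h1 h2 h3 h4
    refine ⟨⟨by linarith [le_abs_self x.re], by linarith, ?_⟩, ?_, norm_le_add_of_reim h2 h3⟩
    · rcases h4 with h4 | h4
      · left; linarith
      · right; intro h5; rw [h5, abs_zero] at h4; linarith
    · rcases h4 with h4 | h4
      · exact h4 ▸ (le_abs_self x.re).trans (Complex.abs_re_le_norm x)
      · exact h4 ▸ Complex.abs_im_le_norm x
  -- Three sides of the square of half-side ε lead round the tip, from below the cut to above it.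
  have t1 := tendsto_sub_of_tendsto_mul hP hE (a := fun ε => -ε - ε * I) (b := fun ε => ε - ε * I)
    two_pos (by
      filter_upwards [hsmall] with ε hε
      refine forall_and.1 fun x => forall_and.1 fun hx => ?_
      obtain ⟨t, ht, hr, hi⟩ := reim_mem_segment hx
      simp at hr hi
      refine key x ε hε.1 hε.2 ?_ ?_ (Or.inr ?_)
      · rw [abs_le]; constructor <;> nlinarith [ht.1, ht.2, hε.1]
      · rw [abs_le]; constructor <;> nlinarith [ht.1, ht.2, hε.1]
      · rw [show x.im = -ε by linarith, abs_neg, abs_of_pos hε.1])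
  have t2 := tendsto_sub_of_tendsto_mul hP hE (a := fun ε => ε - ε * I) (b := fun ε => ε + ε * I)
    two_pos (by
      filter_upwards [hsmall] with ε hε
      refine forall_and.1 fun x => forall_and.1 fun hx => ?_
      obtain ⟨t, ht, hr, hi⟩ := reim_mem_segment hx
      simp at hr hi
      refine key x ε hε.1 hε.2 ?_ ?_ (Or.inl ?_)
      · rw [abs_le]; constructor <;> nlinarith [ht.1, ht.2, hε.1]
      · rw [abs_le]; constructor <;> nlinarith [ht.1, ht.2, hε.1]
      · linarith)
  have t3 := tendsto_sub_of_tendsto_mul hP hE (a := fun ε => ε + ε * I) (b := fun ε => -ε + ε * I)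
    two_pos (by
      filter_upwards [hsmall] with ε hε
      refine forall_and.1 fun x => forall_and.1 fun hx => ?_
      obtain ⟨t, ht, hr, hi⟩ := reim_mem_segment hx
      simp at hr hi
      refine key x ε hε.1 hε.2 ?_ ?_ (Or.inr ?_)
      · rw [abs_le]; constructor <;> nlinarith [ht.1, ht.2, hε.1]
      · rw [abs_le]; constructor <;> nlinarith [ht.1, ht.2, hε.1]
      · rw [show x.im = ε by linarith, abs_of_pos hε.1])
  have := (t1.add t2).add t3
  simp only [add_zero] at this
  exact this.congr fun ε => by ring

theorem tendsto_sub_vertical_zero {E P : ℂ → ℂ} {B : ℝ} (hB : 1 < B) {s : ℝ} (hs : |s| = 1)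
    (hP : ∀ x ∈ slitLeft B, HasDerivAt P (E x) x)
    (hE : Tendsto (fun x => x * E x) (𝓝[slitLeft B] 0) (𝓝 0)) :
    Tendsto (fun ε : ℝ => P (-ε + s * ε * I) - P (-ε)) (𝓝[>] 0) (𝓝 0) := by
  refine tendsto_sub_of_tendsto_mul hP hE (a := fun ε => -ε) (b := fun ε => -ε + s * ε * I)
    two_pos ?_
  filter_upwards [self_mem_nhdsWithin,
      eventually_nhdsWithin_of_eventually_nhds (eventually_lt_nhds one_pos)] with ε h1 h2
  have h1 : 0 < ε := h1
  refine forall_and.1 fun x => forall_and.1 fun hx => ?_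
  obtain ⟨t, ht, hr, hi⟩ := reim_mem_segment hx
  simp at hr hi
  have hre : x.re = -ε := by linarith
  have him : |x.im| ≤ ε := by
    rw [hi, abs_mul, abs_mul, hs, abs_of_pos h1, abs_of_nonneg ht.1]; nlinarith [ht.2]
  have hpi := Real.pi_gt_three
  refine ⟨⟨by linarith, by linarith, Or.inl (by linarith)⟩, ?_,
    norm_le_add_of_reim (by rw [hre, abs_neg, abs_of_pos h1]) him⟩
  calc ε = |x.re| := by rw [hre, abs_neg, abs_of_pos h1]
    _ ≤ _ := Complex.abs_re_le_norm x

/-- Vertical segments of fixed length π, far to the left, contribute nothing because the integrand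
tends to zero there. -/
theorem tendsto_sub_vertical_atBot {E P : ℂ → ℂ} {B : ℝ} (hB : 1 < B) {s : ℝ} (hs : |s| = 1)
    (hP : ∀ x ∈ slitLeft B, HasDerivAt P (E x) x)
    (hE : Tendsto E (comap Complex.re atBot ⊓ 𝓟 {x : ℂ | |x.im| ≤ Real.pi}) (𝓝 0)) :
    Tendsto (fun T : ℝ => P (T + s * Real.pi * I) - P T) atBot (𝓝 0) := by
  rw [Metric.tendsto_nhds]
  intro η hη
  have hpi := Real.pi_pos
  have h1 : ∀ᶠ x in comap Complex.re atBot ⊓ 𝓟 {x : ℂ | |x.im| ≤ Real.pi},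
      ‖E x‖ < η / (2 * Real.pi) := by
    have := (Metric.tendsto_nhds.1 hE) (η / (2 * Real.pi)) (by positivity)
    simpa [dist_eq_norm] using this
  rw [eventually_inf_principal, eventually_comap, eventually_atBot] at h1
  obtain ⟨T₀, hT₀⟩ := h1
  filter_upwards [eventually_le_atBot T₀, eventually_lt_atBot 0] with T h2 h3
  have hseg : ∀ x ∈ segment ℝ (T : ℂ) (T + s * Real.pi * I), x ∈ slitLeft B ∧
      ‖E x‖ ≤ η / (2 * Real.pi) := fun x hx => by
    obtain ⟨t, ht, hr, hi⟩ := reim_mem_segment hx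
    simp at hr hi
    have hre : x.re = T := by linarith
    have him : |x.im| ≤ Real.pi := by
      rw [hi, abs_mul, abs_mul, hs, abs_of_pos hpi, abs_of_nonneg ht.1]; nlinarith [ht.2]
    exact ⟨⟨by linarith, by linarith, Or.inl (by linarith)⟩, (hT₀ T h2 x hre him).le⟩
  have h9 := norm_sub_le_of_hasDerivAt (convex_segment _ _)
    (fun z hz => hP z (hseg z hz).1) (fun z hz => (hseg z hz).2)
    (left_mem_segment ℝ _ _) (right_mem_segment ℝ _ _)
  rw [dist_zero_right]
  refine h9.trans_lt ?_
  have : ‖(T : ℂ) + s * Real.pi * I - T‖ = Real.pi := by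
    rw [add_sub_cancel_left, norm_mul, norm_mul, Complex.norm_real, Complex.norm_real,
      Complex.norm_I, Real.norm_eq_abs, Real.norm_eq_abs, hs, abs_of_pos hpi]
    ring
  rw [this]
  have : η / (2 * Real.pi) * Real.pi = η / 2 := by field_simp
  linarith

end

/-! ### The integral of the product of variations, by primitives on the two cut planes -/

noncomputable section

theorem isOpen_strip (a b B : ℝ) : IsOpen {x : ℂ | x.re < B ∧ a < x.im ∧ x.im < b} := by
  have h1 : IsOpen {x : ℂ | x.re < B} := isOpen_lt Complex.continuous_re continuous_const
  have h2 : IsOpen {x : ℂ | a < x.im} := isOpen_lt continuous_const Complex.continuous_im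
  have h3 : IsOpen {x : ℂ | x.im < b} := isOpen_lt Complex.continuous_im continuous_const
  exact h1.and (h2.and h3)

theorem convex_strip (a b B : ℝ) : Convex ℝ {x : ℂ | x.re < B ∧ a < x.im ∧ x.im < b} := by
  have h1 : Convex ℝ {x : ℂ | x.re < B} := convex_halfSpace_re_lt B
  have h2 : Convex ℝ {x : ℂ | a < x.im} := convex_halfSpace_im_gt a
  have h3 : Convex ℝ {x : ℂ | x.im < b} := convex_halfSpace_im_lt b
  exact h1.inter (h2.inter h3)

theorem upper_mem_slitRight {B : ℝ} {x : ℂ} (hx : x.re < B ∧ 0 < x.im ∧ x.im < 2 * Real.pi) :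
    x ∈ slitRight B :=
  ⟨hx.1, by rw [abs_of_pos hx.2.1]; exact hx.2.2, Or.inr hx.2.1.ne'⟩

theorem upper_mem_slitLeft {B : ℝ} {x : ℂ} (hx : x.re < B ∧ 0 < x.im ∧ x.im < 2 * Real.pi) :
    x ∈ slitLeft B :=
  ⟨hx.1, by rw [abs_of_pos hx.2.1]; exact hx.2.2, Or.inr hx.2.1.ne'⟩

theorem lower_mem_slitRight {B : ℝ} {x : ℂ} (hx : x.re < B ∧ -(2 * Real.pi) < x.im ∧ x.im < 0) :
    x ∈ slitRight B :=
  ⟨hx.1, by rw [abs_of_neg hx.2.2]; linarith [hx.2.1], Or.inr hx.2.2.ne⟩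

theorem lower_mem_slitLeft {B : ℝ} {x : ℂ} (hx : x.re < B ∧ -(2 * Real.pi) < x.im ∧ x.im < 0) :
    x ∈ slitLeft B :=
  ⟨hx.1, by rw [abs_of_neg hx.2.2]; linarith [hx.2.1], Or.inr hx.2.2.ne⟩

variable {Φ Ψ : ℂ → ℂ} {R r B : ℝ} {ω : ℂ}

theorem convKernel_logRight_upper {x : ℂ} (h0 : 0 < x.im) (h1 : x.im < 2 * Real.pi) (v : ℂ) :
    convKernel Φ Ψ ω (logRight x) v = convKernel Φ (monodromyShift Ψ) ω (logLeft x) v := by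
  rw [logRight_eq_add_of_im_pos h0 h1, convKernel, convKernel, monodromyShift]
  congr 3
  ring

theorem convKernel_logRight_lower {x : ℂ} (h0 : x.im < 0) (h1 : -(2 * Real.pi) < x.im) (v : ℂ) :
    convKernel Φ Ψ ω (logRight x) v = convKernel Φ Ψ ω (logLeft x) v := by
  rw [logRight_eq_of_im_neg h0 h1]

/-- The kernel with `logRight` agrees with that of $(\Phi,\Psi)$ below the cut and with that of
$(\Phi,\Sigma\Psi)$ above it. Hence `q` differs from `p` below and from `p'` above by constants,
readable at $1\mp\pi i$. Since `q` has no jump in the limit at the tip, $p'-p$ converges there. -/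
theorem tendsto_primitive_sub_zero (hR : R ≤ 1 / 4) (hr : 4 * R ≤ r)
    (hΦ : DifferentiableOn ℂ Φ {w | ‖exp w‖ < r}) (sΨ : IsSmallBranch Ψ)
    (hω : ‖exp ω‖ < R) (hB : 1 < B) {p p' q : ℂ → ℂ}
    (hp : ∀ x ∈ slitLeft B, HasDerivAt p (convKernel Φ Ψ ω (logLeft x) (ω + x)) x)
    (hp' : ∀ x ∈ slitLeft B,
      HasDerivAt p' (convKernel Φ (monodromyShift Ψ) ω (logLeft x) (ω + x)) x)
    (hq : ∀ x ∈ slitRight B, HasDerivAt q (convKernel Φ Ψ ω (logRight x) (ω + x)) x) :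
    Tendsto (fun ε : ℝ => p' (-ε) - p (-ε)) (𝓝[>] 0)
      (𝓝 (-(q (1 + Real.pi * I) - p' (1 + Real.pi * I)) +
        (q (1 - Real.pi * I) - p (1 - Real.pi * I)))) := by
  have hpi := Real.pi_pos
  have h0L : (0 : ℂ) ∉ slitLeft B := fun h => by simpa using h.2.2
  have h0R : (0 : ℂ) ∉ slitRight B := fun h => by simpa using h.2.2
  have eL : ∀ x ∈ slitLeft B, exp (logLeft x) = 1 - exp x := fun x hx =>
    exp_logLeft (slitPlane_ne_zero (one_sub_exp_mem_slitPlane_left hx))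
  have eR : ∀ x ∈ slitRight B, exp (logRight x) = 1 - exp x := fun x hx =>
    exp_logRight (slitPlane_ne_zero (one_sub_exp_mem_slitPlane_right hx))
  have t1 := tendsto_sub_across_zero hB hq (tendsto_mul_convKernel_zero hR hr hΦ sΨ hω h0R eR
    fun x hx => log_im_le_four_pi_right hx)
  have t2 := tendsto_sub_vertical_zero hB (s := 1) (by simp) hp'
    (tendsto_mul_convKernel_zero hR hr hΦ sΨ.shift hω h0L eL fun x _ => log_im_le_four_pi_left x)
  have t3 := tendsto_sub_vertical_zero hB (s := -1) (by simp) hp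
    (tendsto_mul_convKernel_zero hR hr hΦ sΨ hω h0L eL fun x _ => log_im_le_four_pi_left x)
  have t4 := ((t1.sub t2).add t3).add_const (-(q (1 + Real.pi * I) - p' (1 + Real.pi * I)) +
        (q (1 - Real.pi * I) - p (1 - Real.pi * I)))
  simp only [sub_zero, add_zero, zero_add] at t4
  refine t4.congr' ?_
  filter_upwards [self_mem_nhdsWithin,
      eventually_nhdsWithin_of_eventually_nhds (eventually_lt_nhds one_pos)] with ε h1 h2
  have h1 : 0 < ε := h1
  have hpi3 := Real.pi_gt_three
  have up := sub_eq_sub_of_hasDerivAt_eq (isOpen_strip 0 (2 * Real.pi) B)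
    (convex_strip 0 (2 * Real.pi) B).isPreconnected
    (fun x hx => hq x (upper_mem_slitRight hx)) (fun x hx => hp' x (upper_mem_slitLeft hx))
    (fun x hx => convKernel_logRight_upper hx.2.1 hx.2.2 _)
    (a := 1 + Real.pi * I) (b := -ε + ε * I) ⟨by simpa using hB, by simpa using hpi, by simp; linarith⟩
    ⟨by simp; linarith, by simpa using h1, by simp; linarith⟩
  have lo := sub_eq_sub_of_hasDerivAt_eq (isOpen_strip (-(2 * Real.pi)) 0 B)
    (convex_strip (-(2 * Real.pi)) 0 B).isPreconnected
    (fun x hx => hq x (lower_mem_slitRight hx)) (fun x hx => hp x (lower_mem_slitLeft hx))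
    (fun x hx => convKernel_logRight_lower hx.2.2 hx.2.1 _)
    (a := 1 - Real.pi * I) (b := -ε - ε * I) ⟨by simpa using hB, by simp; linarith, by simpa using hpi⟩
    ⟨by simp; linarith, by simp; linarith, by simpa using h1⟩
  rw [up, lo]
  have e1 : (-(ε : ℂ) + ((1 : ℝ) : ℂ) * ε * I) = -ε + ε * I := by simp
  have e2 : (-(ε : ℂ) + ((-1 : ℝ) : ℂ) * ε * I) = -ε - ε * I := by push_cast; ring
  rw [e1, e2]
  ring

/-- The kernel of $(\Sigma\Phi,\Psi)$ at $x-2\pi i$ is that of $(\Phi,\Psi)$ at $x$, because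
`logLeft` is $2\pi i$-periodic. So $p'(x-2\pi i)-p(x)$ is constant on the upper strip, and at
$-\infty$ both arguments can be moved back to the real axis. -/
theorem tendsto_primitive_sub_atBot (hr : 4 * R ≤ r)
    (hΨ : DifferentiableOn ℂ Ψ {w | ‖exp w‖ < r}) (sΦ : IsSmallBranch Φ)
    (hω : ‖exp ω‖ < R) (hB : 1 < B) {p p' : ℂ → ℂ}
    (hp : ∀ x ∈ slitLeft B, HasDerivAt p (convKernel Φ Ψ ω (logLeft x) (ω + x)) x)
    (hp' : ∀ x ∈ slitLeft B,
      HasDerivAt p' (convKernel (monodromyShift Φ) Ψ ω (logLeft x) (ω + x)) x) :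
    Tendsto (fun T : ℝ => p' T - p T) atBot
      (𝓝 (p' (1 - Real.pi * I) - p (1 + Real.pi * I))) := by
  have hpi := Real.pi_pos
  have t1 := tendsto_sub_vertical_atBot hB (s := 1) (by simp) hp
    (tendsto_convKernel_atBot hr hΨ sΦ hω _)
  have t2 := tendsto_sub_vertical_atBot hB (s := -1) (by simp) hp'
    (tendsto_convKernel_atBot hr hΨ sΦ.shift hω _)
  have t3 := (t1.sub t2).add_const (p' (1 - Real.pi * I) - p (1 + Real.pi * I))
  simp only [sub_zero, zero_add] at t3
  refine t3.congr' ?_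
  filter_upwards [eventually_lt_atBot 0] with T hT
  have hd : ∀ x ∈ {x : ℂ | x.re < B ∧ 0 < x.im ∧ x.im < 2 * Real.pi},
      HasDerivAt (fun x => p' (x - 2 * Real.pi * I))
        (convKernel Φ Ψ ω (logLeft x) (ω + x)) x := fun x hx => by
    have h1 := (hp' (x - 2 * Real.pi * I) (lower_mem_slitLeft
      ⟨by simpa using hx.1, by simpa using hx.2.1, by simpa using hx.2.2⟩)).comp x
      ((hasDerivAt_id x).sub_const _)
    refine h1.congr_deriv ?_
    have h2 : logLeft (x - 2 * Real.pi * I) = logLeft x := by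
      rw [← logLeft_add_two_pi]; simp
    have h3 : exp (ω + (x - 2 * Real.pi * I)) = exp (ω + x) := by
      rw [← add_sub_assoc, Complex.exp_periodic.sub_eq]
    rw [mul_one, h2, convKernel, convKernel, monodromyShift, h3]
    congr 3
    ring
  have up := sub_eq_sub_of_hasDerivAt_eq (isOpen_strip 0 (2 * Real.pi) B)
    (convex_strip 0 (2 * Real.pi) B).isPreconnected hd
    (fun x hx => hp x (upper_mem_slitLeft hx)) (fun x hx => rfl)
    (a := 1 + Real.pi * I) (b := T + Real.pi * I)
    ⟨by simpa using hB, by simpa using hpi, by simp; linarith⟩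
    ⟨by simp; linarith, by simpa using hpi, by simp; linarith⟩
  have e1 : (1 + Real.pi * I - 2 * Real.pi * I : ℂ) = 1 - Real.pi * I := by ring
  have e2 : (T + Real.pi * I - 2 * Real.pi * I : ℂ) = T - Real.pi * I := by ring
  have e3 : (T + ((1 : ℝ) : ℂ) * Real.pi * I) = T + Real.pi * I := by simp
  have e4 : (T + ((-1 : ℝ) : ℂ) * Real.pi * I) = T - Real.pi * I := by push_cast; ring
  simp only [e1, e2] at up
  rw [up, e3, e4]
  ring

/-- Expanding $\Delta\Phi\,\Delta\Psi$ gives four kernels, whose primitives need not converge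
singly. At the end $z/\beta$ pair those with the same first factor, $(p_1-p_3)-(p_2-p_0)$; at the
end $\alpha$ pair those with the same second factor, $(p_1-p_2)-(p_3-p_0)$. Each difference has a
limit. -/
theorem hasConvolutionIntegral_of_primitives (hR : R ≤ 1 / 4) (hr : 4 * R ≤ r)
    (hΦ : DifferentiableOn ℂ Φ {w | ‖exp w‖ < r}) (hΨ : DifferentiableOn ℂ Ψ {w | ‖exp w‖ < r})
    (sΦ : IsSmallBranch Φ) (sΨ : IsSmallBranch Ψ)
    (hω : ‖exp ω‖ < R) (hB : 1 < B) (hBR : ‖exp ω‖ * Real.exp B ≤ R) {p₀ p₁ q₀ q₁ : ℂ → ℂ}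
    (hp₀ : ∀ x ∈ slitLeft B, HasDerivAt p₀ (convKernel Φ Ψ ω (logLeft x) (ω + x)) x)
    (hp₁ : ∀ x ∈ slitLeft B, HasDerivAt p₁
      (convKernel (monodromyShift Φ) (monodromyShift Ψ) ω (logLeft x) (ω + x)) x)
    (hq₀ : ∀ x ∈ slitRight B, HasDerivAt q₀ (convKernel Φ Ψ ω (logRight x) (ω + x)) x)
    (hq₁ : ∀ x ∈ slitRight B,
      HasDerivAt q₁ (convKernel (monodromyShift Φ) Ψ ω (logRight x) (ω + x)) x) :
    HasConvolutionIntegral (monodromyDelta Φ) (monodromyDelta Ψ) ω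
      (-((q₁ (1 + Real.pi * I) - q₀ (1 + Real.pi * I)) -
        (q₁ (1 - Real.pi * I) - q₀ (1 - Real.pi * I)) -
        (p₁ (1 + Real.pi * I) - p₀ (1 + Real.pi * I)) +
        (p₁ (1 - Real.pi * I) - p₀ (1 - Real.pi * I)))) := by
  have hΦ' := shift_differentiableOn hΦ
  have hΨ' := shift_differentiableOn hΨ
  have dL : ∀ {φ ψ : ℂ → ℂ}, DifferentiableOn ℂ φ {w | ‖exp w‖ < r} →
      DifferentiableOn ℂ ψ {w | ‖exp w‖ < r} →
      DifferentiableOn ℂ (fun x => convKernel φ ψ ω (logLeft x) (ω + x)) (slitLeft B) :=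
    fun h h' => kernelLeft_differentiableOn hR hr h h' hω hBR
  obtain ⟨p₂, hp₂⟩ := exists_primitive_of_starConvex (isOpen_slitLeft B) (starConvex_slitLeft hB)
    (dL hΦ hΨ')
  obtain ⟨p₃, hp₃⟩ := exists_primitive_of_starConvex (isOpen_slitLeft B) (starConvex_slitLeft hB)
    (dL hΦ' hΨ)
  have z0 := tendsto_primitive_sub_zero hR hr hΦ sΨ hω hB hp₀ hp₂ hq₀
  have z1 := tendsto_primitive_sub_zero hR hr hΦ' sΨ hω hB hp₃ hp₁ hq₁
  have b0 := tendsto_primitive_sub_atBot hr hΨ sΦ hω hB hp₀ hp₃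
  have b1 := tendsto_primitive_sub_atBot hr hΨ' sΦ hω hB hp₂ hp₁
  set Q : ℂ → ℂ := fun x => p₁ x - p₃ x - (p₂ x - p₀ x) with hQdef
  have hQ : ∀ x ∈ slitLeft B, HasDerivAt Q
      (convKernel (monodromyDelta Φ) (monodromyDelta Ψ) ω (logLeft x) (ω + x)) x := fun x hx => by
    refine (((hp₁ x hx).sub (hp₃ x hx)).sub ((hp₂ x hx).sub (hp₀ x hx))).congr_deriv ?_
    simp only [convKernel, monodromyDelta]
    ring
  have hcont : ContinuousOn (fun x => convKernel (monodromyDelta Φ) (monodromyDelta Ψ) ω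
      (logLeft x) (ω + x)) (slitLeft B) :=
    (dL (hΦ'.sub hΦ) (hΨ'.sub hΨ)).continuousOn
  have l1 : Tendsto (fun ε : ℝ => Real.log (1 - ε)) (𝓝[>] 0) (𝓝[<] 0) := by
    refine tendsto_nhdsWithin_iff.2 ⟨?_, ?_⟩
    · have : ContinuousAt (fun ε : ℝ => Real.log (1 - ε)) 0 :=
        ContinuousAt.log (by fun_prop) (by simp)
      have h := this.tendsto.mono_left (nhdsWithin_le_nhds (s := Ioi 0))
      simpa using h
    · filter_upwards [self_mem_nhdsWithin,
        eventually_nhdsWithin_of_eventually_nhds (eventually_lt_nhds one_pos)] with ε h1 h2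
      have h1 : 0 < ε := h1
      exact Real.log_neg (by linarith) (by linarith)
  have l2 : Tendsto (fun ε : ℝ => -Real.log (1 - ε)) (𝓝[>] 0) (𝓝[>] 0) := by
    refine tendsto_nhdsWithin_iff.2 ⟨?_, ?_⟩
    · simpa using (l1.mono_right nhdsWithin_le_nhds).neg
    · filter_upwards [l1.eventually self_mem_nhdsWithin] with ε h
      exact neg_pos.2 h
  have u1 := (z1.sub z0).comp l2
  have u2 := (b1.sub b0).comp Real.tendsto_log_nhdsGT_zero
  have u3 := (u1.comp tendsto_snd).sub (u2.comp (tendsto_fst (f := 𝓝[>] (0:ℝ)) (g := 𝓝[>] (0:ℝ))))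
  unfold HasConvolutionIntegral
  refine (u3.congr' ?_).trans (le_of_eq ?_)
  · have hev : ∀ᶠ ε in 𝓝[>] (0 : ℝ), 0 < ε ∧ ε < 1 / 2 := by
      filter_upwards [self_mem_nhdsWithin, eventually_nhdsWithin_of_eventually_nhds
        (eventually_lt_nhds (by norm_num : (0 : ℝ) < 1 / 2))] with ε h1 h2
      exact ⟨h1, h2⟩
    filter_upwards [hev.prod_mk hev] with ε hε
    obtain ⟨⟨a1, a2⟩, b1, b2⟩ := hε
    have hle : ε.1 ≤ 1 - ε.2 := by linarith
    have hsub : ∀ s ∈ Icc ε.1 (1 - ε.2), ((Real.log s : ℝ) : ℂ) ∈ slitLeft B := fun s hs => by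
      have hs0 : Real.log s < 0 := Real.log_neg (by linarith [hs.1]) (by linarith [hs.2])
      refine ⟨?_, ?_, Or.inl ?_⟩
      · rw [Complex.ofReal_re]; linarith
      · simp [Real.pi_pos]
      · rwa [Complex.ofReal_re]
    -- The substitution $x=\log s$: `logLeft` becomes $\log(1-s)$, $e^{\omega+x}$ becomes
    -- $se^\omega$, and $dx=ds/s$.
    have hval : ∀ s ∈ Icc ε.1 (1 - ε.2),
        convKernel (monodromyDelta Φ) (monodromyDelta Ψ) ω (logLeft (Real.log s))
          (ω + Real.log s) * ((s⁻¹ : ℝ) : ℂ) =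
        monodromyDelta Φ (ω + (Real.log s : ℂ)) *
        monodromyDelta Ψ (ω + (Real.log (1 - s) : ℂ) - Complex.log (1 + (s : ℂ) * exp ω)) *
        (exp ω / (1 + (s : ℂ) * exp ω)) := fun s hs => by
      have hs0 : 0 < s := by linarith [hs.1]
      have hs1 : 0 < 1 - s := by linarith [hs.2]
      have e1 : exp ((Real.log s : ℝ) : ℂ) = s := by
        rw [← Complex.ofReal_exp, Real.exp_log hs0]
      have e2 : logLeft (Real.log s) = (Real.log (1 - s) : ℂ) := by
        rw [logLeft, e1, Complex.ofReal_log hs1.le]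
        push_cast
        rfl
      have e3 : exp (ω + Real.log s) = s * exp ω := by
        rw [Complex.exp_add, e1, mul_comm]
      have hsc : (s : ℂ) ≠ 0 := Complex.ofReal_ne_zero.2 hs0.ne'
      rw [convKernel, e2, e3]
      push_cast
      field_simp
    have hderiv : ∀ s ∈ uIcc ε.1 (1 - ε.2), HasDerivAt (fun s : ℝ => Q (Real.log s))
        (monodromyDelta Φ (ω + (Real.log s : ℂ)) *
        monodromyDelta Ψ (ω + (Real.log (1 - s) : ℂ) - Complex.log (1 + (s : ℂ) * exp ω)) *
        (exp ω / (1 + (s : ℂ) * exp ω))) s := fun s hs => by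
      rw [uIcc_of_le hle] at hs
      have hs0 : 0 < s := by linarith [hs.1]
      rw [← hval s hs]
      exact (hQ _ (hsub s hs)).comp s (Real.hasDerivAt_log hs0.ne').ofReal_comp
    rw [intervalIntegral.integral_eq_sub_of_hasDerivAt hderiv]
    · simp only [Function.comp_apply, hQdef]
      push_cast
      simp only [neg_neg]
      ring
    · apply ContinuousOn.intervalIntegrable
      rw [uIcc_of_le hle]
      refine ContinuousOn.congr (f := fun s : ℝ => convKernel (monodromyDelta Φ)
        (monodromyDelta Ψ) ω (logLeft (Real.log s)) (ω + Real.log s) * ((s⁻¹ : ℝ) : ℂ)) ?_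
        fun s hs => (hval s hs).symm
      have hpos : ∀ s ∈ Icc ε.1 (1 - ε.2), s ≠ 0 := fun s hs => by linarith [hs.1]
      have c1 : ContinuousOn (fun s : ℝ => ((Real.log s : ℝ) : ℂ)) (Icc ε.1 (1 - ε.2)) :=
        Complex.continuous_ofReal.comp_continuousOn (continuousOn_id.log hpos)
      have c2 : ContinuousOn (fun s : ℝ => ((s⁻¹ : ℝ) : ℂ)) (Icc ε.1 (1 - ε.2)) :=
        Complex.continuous_ofReal.comp_continuousOn (continuousOn_id.inv₀ hpos)
      exact (hcont.comp c1 hsub).mul c2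
  -- The values of the mixed primitives `p₂` and `p₃` cancel between the two ends.
  · congr 1
    ring

end

noncomputable section

/-! ### The local convolution as a multivalued function -/

/-- The half-strip of points `v` of the universal covering lying farther from the centre
than a given radius `exp a`, and inside the disc of radius `R`. -/
def outerStrip (a R : ℝ) : Set ℂ := {v | a < v.re ∧ ‖exp v‖ < R}

theorem isOpen_outerStrip (a R : ℝ) : IsOpen (outerStrip a R) :=
  IsOpen.and (isOpen_lt continuous_const Complex.continuous_re) (isOpen_norm_exp_lt R)

theorem convex_norm_exp_lt (R : ℝ) : Convex ℝ {v : ℂ | ‖exp v‖ < R} := by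
  by_cases hR : 0 < R
  · have : {v : ℂ | ‖exp v‖ < R} = {v : ℂ | v.re < Real.log R} := by
      ext v
      simp only [mem_ofPred_eq]
      rw [Complex.norm_exp, Real.lt_log_iff_exp_lt hR]
    rw [this]
    exact convex_halfSpace_re_lt _
  · have : {v : ℂ | ‖exp v‖ < R} = ∅ := by
      ext v
      simp only [mem_ofPred_eq, mem_empty_iff_false, iff_false, not_lt]
      exact (not_lt.1 hR).trans (norm_nonneg _)
    rw [this]
    exact convex_empty

theorem convex_outerStrip (a R : ℝ) : Convex ℝ (outerStrip a R) :=
  (convex_halfSpace_re_gt a).inter (convex_norm_exp_lt R)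

/-- The convolution of two local branches along a path from `P₁` to `P₂` that passes between the
two singularities, as a function on the universal covering. -/
def convBranch (Φ Ψ : ℂ → ℂ) (P₁ P₂ ω : ℂ) : ℂ :=
  segInt (fun v => convKernel Φ Ψ ω (logRight (v - ω) - 2 * Real.pi * I) v) P₁
      (ω + (1 + Real.pi * I)) +
    (segInt (fun x => convKernel Φ Ψ ω (logLeft x) (ω + x)) (1 + Real.pi * I) (-1) +
      segInt (fun x => convKernel Φ Ψ ω (logLeft x) (ω + x)) (-1) (1 - Real.pi * I)) +
    segInt (fun v => convKernel Φ Ψ ω (logRight (v - ω)) v) (ω + (1 - Real.pi * I)) P₂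

variable {Φ Ψ : ℂ → ℂ} {R r ρ : ℝ} {P₁ P₂ : ℂ}

theorem norm_exp_lt_of_two {ω : ℂ} (hρ : ρ * Real.exp 2 ≤ R) (hω : ‖exp ω‖ < ρ) : ‖exp ω‖ < R := by
  have h1 : 0 < ρ := (norm_nonneg _).trans_lt hω
  have h2 : 1 ≤ Real.exp 2 := Real.one_le_exp (by norm_num)
  nlinarith

/-- The factor $e^2$ keeps the fixed endpoints of the path to the right of the abscissa
$\operatorname{Re}\omega+2$, hence beyond the moving points $\omega+1\pm\pi i$. -/
theorem re_add_two_lt {ω P : ℂ} (hP : ρ * Real.exp 2 ≤ ‖exp P‖) (hω : ‖exp ω‖ < ρ) :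
    ω.re + 2 < P.re := by
  rw [Complex.norm_exp] at hP hω
  have : Real.exp (ω.re + 2) < Real.exp P.re := by
    rw [Real.exp_add]
    exact (mul_lt_mul_of_pos_right hω (Real.exp_pos 2)).trans_le hP
  exact Real.exp_lt_exp.1 this

theorem mem_outerStrip_of_re {ω x : ℂ} (hρ : ρ * Real.exp 2 ≤ R) (hω : ‖exp ω‖ < ρ)
    (h0 : 0 < x.re) (h2 : x.re < 2) : ω + x ∈ outerStrip ω.re R := by
  refine ⟨by simpa using h0, norm_exp_add_lt (B := 2) ?_ h2⟩
  have := Real.exp_pos 2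
  nlinarith

theorem mem_outerStrip_endpoint {ω P : ℂ} (hP : ρ * Real.exp 2 ≤ ‖exp P‖) (hPR : ‖exp P‖ < R)
    (hω : ‖exp ω‖ < ρ) : P ∈ outerStrip ω.re R :=
  ⟨by linarith [re_add_two_lt hP hω], hPR⟩

theorem one_add_pi_re : (1 + Real.pi * I : ℂ).re = 1 := by simp

theorem one_sub_pi_re : (1 - Real.pi * I : ℂ).re = 1 := by simp

theorem segment_left_upper : segment ℝ (1 + Real.pi * I : ℂ) (-1) ⊆ slitLeft 2 := by
  rw [segment_symm]
  refine (starConvex_slitLeft one_lt_two).segment_subset ?_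
  have := Real.pi_pos
  refine ⟨by simp, ?_, Or.inr (by simp)⟩
  simp [abs_of_pos this]; linarith

theorem segment_left_lower : segment ℝ (-1 : ℂ) (1 - Real.pi * I) ⊆ slitLeft 2 := by
  refine (starConvex_slitLeft one_lt_two).segment_subset ?_
  have := Real.pi_pos
  refine ⟨by simp, ?_, Or.inr (by simp)⟩
  simp [abs_of_pos this]; linarith

theorem exp_logRight_sub {ω v : ℂ} (h : ω.re < v.re) :
    exp (logRight (v - ω)) = 1 - exp (v - ω) :=
  exp_logRight (slitPlane_ne_zero (one_sub_exp_mem_slitPlane_of_re (by simpa using h)))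

theorem exp_logRight_sub' {ω v : ℂ} (h : ω.re < v.re) :
    exp (logRight (v - ω) - 2 * Real.pi * I) = 1 - exp (v - ω) := by
  rw [Complex.exp_periodic.sub_eq, exp_logRight_sub h]

theorem logRight_sub_differentiableAt {X : Type*} [NormedAddCommGroup X] [NormedSpace ℂ X]
    {ω v : X → ℂ} {x : X} (dω : DifferentiableAt ℂ ω x) (dv : DifferentiableAt ℂ v x)
    (h : (ω x).re < (v x).re) : DifferentiableAt ℂ (fun x => logRight (v x - ω x)) x :=
  DifferentiableAt.comp x (g := logRight) (f := fun x => v x - ω x)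
    (logRight_differentiableAt (one_sub_exp_mem_slitPlane_of_re (by simpa using h))) (dv.sub dω)

/-- The outer pieces use `logRight`, holomorphic on all of $\operatorname{Re}x>0$, since
$\operatorname{Im}(v-\omega)$ is unbounded when `ω` runs over the covering. The determinations match
`logLeft` at $1+\pi i$ (after subtracting $2\pi i$) and at $1-\pi i$, so one continuous branch is
integrated. The middle piece is fixed in the coordinate $x=v-\omega$. -/
theorem differentiableOn_convBranch (hR : R ≤ 1 / 4) (hr : 4 * R ≤ r)
    (hΦ : DifferentiableOn ℂ Φ {w | ‖exp w‖ < r}) (hΨ : DifferentiableOn ℂ Ψ {w | ‖exp w‖ < r})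
    (hρ : ρ * Real.exp 2 ≤ R) (h₁ : ρ * Real.exp 2 ≤ ‖exp P₁‖) (h₁' : ‖exp P₁‖ < R)
    (h₂ : ρ * Real.exp 2 ≤ ‖exp P₂‖) (h₂' : ‖exp P₂‖ < R) :
    DifferentiableOn ℂ (convBranch Φ Ψ P₁ P₂) {w | ‖exp w‖ < ρ} := by
  unfold convBranch
  refine DifferentiableOn.add (DifferentiableOn.add ?_ (DifferentiableOn.add ?_ ?_)) ?_
  · refine differentiableOn_segInt (isOpen_norm_exp_lt ρ) (differentiableOn_const P₁)
      (differentiableOn_id.add_const _)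
      (W := {p : ℂ × ℂ | ‖exp p.1‖ < ρ ∧ ‖exp p.2‖ < R ∧ p.1.re < p.2.re}) ?_ ?_
    · rintro p ⟨hp1, hp2, hp3⟩
      exact (convKernel_differentiableAt hR hr hΦ hΨ differentiableAt_fst
        ((logRight_sub_differentiableAt differentiableAt_fst differentiableAt_snd hp3).sub_const _)
        differentiableAt_snd (norm_exp_lt_of_two hρ hp1) hp2
        (exp_logRight_sub' hp3)).differentiableWithinAt
    · intro ω hω x hx
      have h3 := (convex_outerStrip ω.re R).segment_subset
        (mem_outerStrip_endpoint h₁ h₁' hω) (mem_outerStrip_of_re (x := 1 + Real.pi * I) hρ hω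
          (by simp) (by simp)) hx
      exact ⟨hω, h3.2, h3.1⟩
  · refine differentiableOn_segInt (isOpen_norm_exp_lt ρ) (differentiableOn_const _)
      (differentiableOn_const _)
      (W := {p : ℂ × ℂ | ‖exp p.1‖ < ρ ∧ p.2 ∈ slitLeft 2}) ?_
      fun ω hω x hx => ⟨hω, segment_left_upper hx⟩
    rintro p ⟨hp1, hp2⟩
    have h := one_sub_exp_mem_slitPlane_left hp2
    refine (convKernel_differentiableAt hR hr hΦ hΨ differentiableAt_fst
      (DifferentiableAt.comp p (logLeft_differentiableAt h) differentiableAt_snd)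
      (differentiableAt_fst.add differentiableAt_snd) (norm_exp_lt_of_two hρ hp1)
      (norm_exp_add_lt (B := 2) ?_ hp2.1) ?_).differentiableWithinAt
    · have := Real.exp_pos 2
      nlinarith
    · rw [Function.comp_apply, exp_logLeft (slitPlane_ne_zero h), Pi.add_apply, add_sub_cancel_left]
  · refine differentiableOn_segInt (isOpen_norm_exp_lt ρ) (differentiableOn_const _)
      (differentiableOn_const _)
      (W := {p : ℂ × ℂ | ‖exp p.1‖ < ρ ∧ p.2 ∈ slitLeft 2}) ?_
      fun ω hω x hx => ⟨hω, segment_left_lower hx⟩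
    rintro p ⟨hp1, hp2⟩
    have h := one_sub_exp_mem_slitPlane_left hp2
    refine (convKernel_differentiableAt hR hr hΦ hΨ differentiableAt_fst
      (DifferentiableAt.comp p (logLeft_differentiableAt h) differentiableAt_snd)
      (differentiableAt_fst.add differentiableAt_snd) (norm_exp_lt_of_two hρ hp1)
      (norm_exp_add_lt (B := 2) ?_ hp2.1) ?_).differentiableWithinAt
    · have := Real.exp_pos 2
      nlinarith
    · rw [Function.comp_apply, exp_logLeft (slitPlane_ne_zero h), Pi.add_apply, add_sub_cancel_left]
  · refine differentiableOn_segInt (isOpen_norm_exp_lt ρ) (differentiableOn_id.add_const _)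
      (differentiableOn_const P₂)
      (W := {p : ℂ × ℂ | ‖exp p.1‖ < ρ ∧ ‖exp p.2‖ < R ∧ p.1.re < p.2.re}) ?_ ?_
    · rintro p ⟨hp1, hp2, hp3⟩
      exact (convKernel_differentiableAt hR hr hΦ hΨ differentiableAt_fst
        (logRight_sub_differentiableAt differentiableAt_fst differentiableAt_snd hp3)
        differentiableAt_snd (norm_exp_lt_of_two hρ hp1) hp2
        (exp_logRight_sub hp3)).differentiableWithinAt
    · intro ω hω x hx
      have h3 := (convex_outerStrip ω.re R).segment_subset
        (mem_outerStrip_of_re (x := 1 - Real.pi * I) hρ hω (by simp) (by simp))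
        (mem_outerStrip_endpoint h₂ h₂' hω) hx
      exact ⟨hω, h3.2, h3.1⟩

theorem outerKernel_differentiableOn {ω : ℂ} (hR : R ≤ 1 / 4) (hr : 4 * R ≤ r)
    (hΦ : DifferentiableOn ℂ Φ {w | ‖exp w‖ < r}) (hΨ : DifferentiableOn ℂ Ψ {w | ‖exp w‖ < r})
    (hω : ‖exp ω‖ < R) (n : ℂ) (hn : exp n = 1) :
    DifferentiableOn ℂ (fun v => convKernel Φ Ψ ω (logRight (v - ω) - n) v)
      (outerStrip ω.re R) := fun v hv =>
  (convKernel_differentiableAt hR hr hΦ hΨ (differentiableAt_const ω)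
    ((logRight_sub_differentiableAt (differentiableAt_const ω) differentiableAt_id hv.1).sub_const
      n) differentiableAt_id hω hv.2 (by
      rw [Complex.exp_sub, hn, div_one, id, exp_logRight_sub hv.1])).differentiableWithinAt

/-- The monodromy of the local convolution is the convolution of the variations. -/
theorem hasConvolutionIntegral_convBranch {ω : ℂ} (hR : R ≤ 1 / 4) (hr : 4 * R ≤ r)
    (hΦ : DifferentiableOn ℂ Φ {w | ‖exp w‖ < r}) (hΨ : DifferentiableOn ℂ Ψ {w | ‖exp w‖ < r})
    (sΦ : IsSmallBranch Φ) (sΨ : IsSmallBranch Ψ)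
    (hρ : ρ * Real.exp 2 ≤ R) (h₁ : ρ * Real.exp 2 ≤ ‖exp P₁‖) (h₁' : ‖exp P₁‖ < R)
    (h₂ : ρ * Real.exp 2 ≤ ‖exp P₂‖) (h₂' : ‖exp P₂‖ < R) (hω : ‖exp ω‖ < ρ) :
    HasConvolutionIntegral (monodromyDelta Φ) (monodromyDelta Ψ) ω
      (-(convBranch Φ Ψ P₁ P₂ (ω + 2 * Real.pi * I) - convBranch Φ Ψ P₁ P₂ ω)) := by
  have hωR := norm_exp_lt_of_two hρ hω
  have hBR : ‖exp ω‖ * Real.exp 2 ≤ R := by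
    have := Real.exp_pos 2
    nlinarith
  have hΦ' := shift_differentiableOn hΦ
  have hΨ' := shift_differentiableOn hΨ
  have hpi := Real.pi_pos
  obtain ⟨p₀, hp₀⟩ := exists_primitive_of_starConvex (isOpen_slitLeft 2)
    (starConvex_slitLeft one_lt_two) (kernelLeft_differentiableOn hR hr hΦ hΨ hωR hBR)
  obtain ⟨p₁, hp₁⟩ := exists_primitive_of_starConvex (isOpen_slitLeft 2)
    (starConvex_slitLeft one_lt_two) (kernelLeft_differentiableOn hR hr hΦ' hΨ' hωR hBR)
  obtain ⟨q₀, hq₀⟩ := exists_primitive_of_starConvex (isOpen_slitRight 2)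
    (starConvex_slitRight one_lt_two) (kernelRight_differentiableOn hR hr hΦ hΨ hωR hBR)
  obtain ⟨q₁, hq₁⟩ := exists_primitive_of_starConvex (isOpen_slitRight 2)
    (starConvex_slitRight one_lt_two) (kernelRight_differentiableOn hR hr hΦ' hΨ hωR hBR)
  have hdG := outerKernel_differentiableOn hR hr hΦ hΨ hωR (2 * Real.pi * I) Complex.exp_two_pi_mul_I
  have hdH := outerKernel_differentiableOn hR hr hΦ hΨ hωR 0 Complex.exp_zero
  simp only [sub_zero] at hdH
  obtain ⟨G, hG⟩ := exists_primitive_of_convex (isOpen_outerStrip _ _) (convex_outerStrip _ _) hdG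
  obtain ⟨H, hH⟩ := exists_primitive_of_convex (isOpen_outerStrip _ _) (convex_outerStrip _ _) hdH
  convert hasConvolutionIntegral_of_primitives hR hr hΦ hΨ sΦ sΨ hωR one_lt_two hBR hp₀ hp₁ hq₀ hq₁
    using 2
  have m1 : P₁ ∈ outerStrip ω.re R := mem_outerStrip_endpoint h₁ h₁' hω
  have m2 : P₂ ∈ outerStrip ω.re R := mem_outerStrip_endpoint h₂ h₂' hω
  have mem : ∀ {x : ℂ}, 0 < x.re → x.re < 2 → ω + x ∈ outerStrip ω.re R :=
    fun h h' => mem_outerStrip_of_re hρ hω h h'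
  have mem2 : ∀ {x : ℂ}, 0 < x.re → x.re < 2 → ω + 2 * Real.pi * I + x ∈ outerStrip ω.re R :=
    fun {x} h h' => by
      have := mem_outerStrip_of_re (x := 2 * Real.pi * I + x) hρ hω (by simpa using h)
        (by simpa using h')
      rwa [← add_assoc] at this
  have sub : ∀ {a b : ℂ}, a ∈ outerStrip ω.re R → b ∈ outerStrip ω.re R →
      segment ℝ a b ⊆ outerStrip ω.re R := fun h h' => (convex_outerStrip _ _).segment_subset h h'
  have cper : ∀ l v : ℂ, convKernel Φ Ψ (ω + 2 * Real.pi * I) l v =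
      convKernel Φ Ψ ω (l + 2 * Real.pi * I) v := fun l v => by
    rw [convKernel, convKernel]; congr 3; ring
  -- Under $\omega\mapsto\omega+2\pi i$ the outer kernels are unchanged as functions of `v`; only
  -- the endpoints of their segments move. On the middle path, fixed in `x`, both factors are
  -- replaced by their shifts (`eL`).
  have eG : (fun v => convKernel Φ Ψ (ω + 2 * Real.pi * I)
      (logRight (v - (ω + 2 * Real.pi * I)) - 2 * Real.pi * I) v) =
      fun v => convKernel Φ Ψ ω (logRight (v - ω) - 2 * Real.pi * I) v := by
    funext v
    rw [cper, show v - ω = v - (ω + 2 * Real.pi * I) + 2 * Real.pi * I by ring,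
      logRight_add_two_pi]
    congr 1; ring
  have eH : (fun v => convKernel Φ Ψ (ω + 2 * Real.pi * I)
      (logRight (v - (ω + 2 * Real.pi * I))) v) =
      fun v => convKernel Φ Ψ ω (logRight (v - ω)) v := by
    funext v
    rw [cper, show v - ω = v - (ω + 2 * Real.pi * I) + 2 * Real.pi * I by ring,
      logRight_add_two_pi]
  have eL : (fun x => convKernel Φ Ψ (ω + 2 * Real.pi * I) (logLeft x)
      (ω + 2 * Real.pi * I + x)) =
      fun x => convKernel (monodromyShift Φ) (monodromyShift Ψ) ω (logLeft x) (ω + x) := by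
    funext x
    have h3 : exp (ω + 2 * Real.pi * I + x) = exp (ω + x) := by
      rw [show ω + 2 * Real.pi * I + x = ω + x + 2 * Real.pi * I by ring, Complex.exp_periodic]
    rw [convKernel, convKernel, monodromyShift, monodromyShift, h3]
    congr 3 <;> ring
  rw [convBranch, convBranch, eG, eH, eL,
    segInt_eq_sub hG hdG (sub m1 (mem2 (by simp) (by simp))),
    segInt_eq_sub hG hdG (sub m1 (mem (by simp) (by simp))),
    segInt_eq_sub hH hdH (sub (mem2 (by simp) (by simp)) m2),
    segInt_eq_sub hH hdH (sub (mem (by simp) (by simp)) m2),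
    segInt_eq_sub hp₀ (kernelLeft_differentiableOn hR hr hΦ hΨ hωR hBR) segment_left_upper,
    segInt_eq_sub hp₀ (kernelLeft_differentiableOn hR hr hΦ hΨ hωR hBR) segment_left_lower,
    segInt_eq_sub hp₁ (kernelLeft_differentiableOn hR hr hΦ' hΨ' hωR hBR) segment_left_upper,
    segInt_eq_sub hp₁ (kernelLeft_differentiableOn hR hr hΦ' hΨ' hωR hBR) segment_left_lower]
  set S : Set ℂ := slitRight 2 ∩ {x | 0 < x.re} with hS
  have hSo : IsOpen S := (isOpen_slitRight 2).inter (isOpen_lt continuous_const continuous_re)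
  have hSc : IsPreconnected S := by
    have : S = {x : ℂ | x.re < 2 ∧ -(2 * Real.pi) < x.im ∧ x.im < 2 * Real.pi} ∩ {x | 0 < x.re} := by
      ext x
      simp only [hS, slitRight, mem_inter_iff, mem_ofPred_eq, abs_lt]
      tauto
    rw [this]
    exact ((convex_strip _ _ _).inter (convex_halfSpace_re_gt 0)).isPreconnected
  have s1 : (1 + Real.pi * I : ℂ) ∈ S := by
    refine ⟨⟨by simp, ?_, by simp⟩, by simp⟩
    simp [abs_of_pos hpi]; linarith
  have s2 : (1 - Real.pi * I : ℂ) ∈ S := by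
    refine ⟨⟨by simp, ?_, by simp⟩, by simp⟩
    simp [abs_of_pos hpi]; linarith
  -- To the right of the origin the primitives of the outer kernels agree, up to constants, with
  -- those on the right cut plane: `H` with `q₀`, and `G`, one turn further, with `q₁`.
  have cH := sub_eq_sub_of_hasDerivAt_eq hSo hSc (P := fun x => H (ω + x))
    (fun x hx => (hH _ (mem hx.2 hx.1.1)).comp x ((hasDerivAt_id x).const_add ω))
    (fun x hx => hq₀ x hx.1) (fun x hx => by simp) s1 s2
  have cG := sub_eq_sub_of_hasDerivAt_eq hSo hSc (P := fun x => G (ω + 2 * Real.pi * I + x))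
    (fun x hx => (hG _ (mem2 hx.2 hx.1.1)).comp x ((hasDerivAt_id x).const_add _))
    (fun x hx => hq₁ x hx.1) (fun x hx => by
      have e1 : logRight (ω + 2 * Real.pi * I + x - ω) - 2 * Real.pi * I = logRight x := by
        rw [show ω + 2 * Real.pi * I + x - ω = x + 2 * Real.pi * I by ring, logRight_add_two_pi]
        ring
      have e2 : ω + 2 * Real.pi * I + x = ω + x + 2 * Real.pi * I := by ring
      have e3 : exp (ω + x + 2 * Real.pi * I) = exp (ω + x) := Complex.exp_periodic _
      simp only [e1, mul_one]
      rw [convKernel, convKernel, monodromyShift, e2, e3]) s1 s2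
  -- After one turn the lower junction point has taken the place of the upper one.
  have k1 : ω + 2 * Real.pi * I + (1 - Real.pi * I) = ω + (1 + Real.pi * I) := by ring
  simp only [k1] at cG ⊢
  linear_combination cG - cH

end

noncomputable section

/-! ### Growth of the local convolution -/

/-- The filter of points of the universal covering approaching the centre with bounded argument. -/
def stripAtBot (M : ℝ) : Filter ℂ := comap Complex.re atBot ⊓ 𝓟 {v : ℂ | |v.im| ≤ M}

theorem eventually_stripAtBot {M : ℝ} {p : ℂ → Prop} :
    (∀ᶠ v in stripAtBot M, p v) ↔ ∃ T : ℝ, ∀ v : ℂ, v.re ≤ T → |v.im| ≤ M → p v := by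
  rw [stripAtBot, eventually_inf_principal, eventually_comap, eventually_atBot]
  exact ⟨fun ⟨T, h⟩ => ⟨T, fun v hv => h _ hv v rfl⟩, fun ⟨T, h⟩ => ⟨T, fun x hx v hv => h v (hv ▸ hx)⟩⟩

theorem tendsto_re_stripAtBot (M : ℝ) : Tendsto Complex.re (stripAtBot M) atBot :=
  tendsto_comap.mono_left inf_le_left

theorem abs_im_le_stripAtBot (M : ℝ) : ∀ᶠ v in stripAtBot M, |v.im| ≤ M :=
  eventually_stripAtBot.2 ⟨0, fun _ _ h => h⟩

theorem isSmallBranch_iff {Φ : ℂ → ℂ} :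
    IsSmallBranch Φ ↔ ∀ M, Tendsto (fun v : ℂ => exp v * Φ v) (stripAtBot M) (𝓝 0) := Iff.rfl

/-- Far to the left the bound is η; on the compact remainder a constant is absorbed in a multiple of
$e^{\operatorname{Re}v}$, a term that becomes negligible after integration. -/
theorem IsSmallBranch.norm_le {Φ : ℂ → ℂ} {r R : ℝ} (sΦ : IsSmallBranch Φ)
    (hΦ : DifferentiableOn ℂ Φ {w | ‖exp w‖ < r}) (hR : R < r) (M : ℝ) {η : ℝ} (hη : 0 < η) :
    ∃ D, 0 ≤ D ∧ ∀ v : ℂ, ‖exp v‖ ≤ R → |v.im| ≤ M → ‖exp v * Φ v‖ ≤ η + D * Real.exp v.re := by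
  have h1 := (isSmallBranch_iff.1 sΦ M).norm.eventually_lt_const (by simpa using hη)
  obtain ⟨T, hT⟩ := eventually_stripAtBot.1 h1
  have hK : IsCompact ((Icc T R ×ℂ Icc (-M) M) ∩ {w : ℂ | ‖exp w‖ ≤ R}) :=
    (isCompact_Icc.reProdIm isCompact_Icc).inter_right (isClosed_le (by fun_prop) continuous_const)
  obtain ⟨C, hC⟩ := hK.exists_bound_of_continuousOn (f := fun v => exp v * Φ v)
    (Complex.continuous_exp.continuousOn.mul
      (hΦ.continuousOn.mono fun w hw => (lt_of_le_of_lt hw.2 hR : ‖exp w‖ < r)))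
  refine ⟨|C| * Real.exp (-T), by positivity, fun v hv hM => ?_⟩
  by_cases hvT : v.re ≤ T
  · have := hT v hvT hM
    have h2 : 0 ≤ |C| * Real.exp (-T) * Real.exp v.re := by positivity
    linarith
  · have hvR : v.re ≤ R := by
      rw [Complex.norm_exp] at hv
      linarith [Real.add_one_le_exp v.re]
    have h3 := hC v ⟨⟨⟨(not_le.1 hvT).le, hvR⟩, abs_le.1 hM⟩, hv⟩
    have h4 : 1 ≤ Real.exp (-T) * Real.exp v.re := by
      rw [← Real.exp_add]; exact Real.one_le_exp (by linarith [not_le.1 hvT])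
    have h5 := le_abs_self C
    have h6 := abs_nonneg C
    nlinarith

variable {Φ Ψ : ℂ → ℂ} {R r ρ : ℝ} {P₁ P₂ : ℂ}

/-- `C` is chosen before `η`: the factor of `Ψ` is merely bounded, and the smallness comes from `Φ`.
The strict inequality $4R<r$ provides the compactness behind the bound on `Ψ`. -/
theorem exists_norm_exp_mul_convKernel_le (hR : R ≤ 1 / 4) (hr : 4 * R < r)
    (hΦ : DifferentiableOn ℂ Φ {w | ‖exp w‖ < r}) (hΨ : DifferentiableOn ℂ Ψ {w | ‖exp w‖ < r})
    (sΦ : IsSmallBranch Φ) (sΨ : IsSmallBranch Ψ) (M : ℝ) :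
    ∃ C, 0 ≤ C ∧ ∀ η > 0, ∃ D, 0 ≤ D ∧ ∀ ω l v : ℂ, ‖exp ω‖ < R → ‖exp v‖ < R →
      exp l = 1 - exp (v - ω) → |ω.im| ≤ M → |v.im| ≤ M → |l.im| ≤ M →
      ‖exp ω * convKernel Φ Ψ ω l v‖ ≤
        C * (η + D * Real.exp v.re) * ‖(1 - exp (v - ω))⁻¹‖ := by
  by_cases hR0 : 0 < R
  swap
  · exact ⟨0, le_rfl, fun η _ => ⟨0, le_rfl, fun ω l v h =>
      absurd ((norm_nonneg _).trans_lt h) hR0⟩⟩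
  obtain ⟨D₁, hD₁, h1⟩ := sΨ.norm_le hΨ hr (M + M + Real.pi) one_pos
  refine ⟨1 + D₁ * (4 * R), by positivity, fun η hη => ?_⟩
  obtain ⟨D₂, hD₂, h2⟩ := sΦ.norm_le hΦ (by linarith : R < r) M hη
  refine ⟨D₂, hD₂, fun ω l v hω hv hl mω mv ml => ?_⟩
  have hy := norm_exp_convKernel_arg_lt hR (le_refl (4 * R)) hω hv hl
  rw [exp_mul_convKernel hR hv hl, norm_mul, norm_mul]
  set y := ω + l - Complex.log (1 + exp v) with hy_def
  have hyM : |y.im| ≤ M + M + Real.pi := by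
    have h5 : |(Complex.log (1 + exp v)).im| ≤ Real.pi := abs_log_im_le_pi _
    rw [hy_def]
    simp only [sub_im, add_im]
    rw [abs_le] at *
    constructor <;> linarith [mω.1, ml.1, h5.1, mω.2, ml.2, h5.2]
  have h3 := h1 y hy.le hyM
  have h4 := h2 v hv.le mv
  have h6 : ‖exp y * Ψ y‖ ≤ 1 + D₁ * (4 * R) := h3.trans (by
    rw [Complex.norm_exp] at hy
    gcongr)
  calc ‖exp v * Φ v‖ * ‖exp y * Ψ y‖ * ‖(1 - exp (v - ω))⁻¹‖
      ≤ (η + D₂ * Real.exp v.re) * (1 + D₁ * (4 * R)) * ‖(1 - exp (v - ω))⁻¹‖ := by gcongr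
    _ = _ := by ring

theorem segInt_symm (f : ℂ → ℂ) (a b : ℂ) : segInt f a b = -segInt f b a := by
  have h := intervalIntegral.integral_comp_sub_left
    (fun t : ℝ => f (b + t * (a - b)) * (a - b)) (a := 0) (b := 1) 1
  rw [segInt, segInt]
  simp only [sub_self, sub_zero] at h
  rw [← h, ← intervalIntegral.integral_neg]
  congr 1
  funext t
  rw [show b + ((1 - t : ℝ) : ℂ) * (a - b) = a + t * (b - a) by push_cast; ring]
  ring

theorem const_mul_segInt (c : ℂ) (f : ℂ → ℂ) (a b : ℂ) :
    c * segInt f a b = segInt (fun v => c * f v) a b := by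
  rw [segInt, segInt, ← intervalIntegral.integral_const_mul]
  simp only [mul_assoc]

theorem norm_segInt_le {f : ℂ → ℂ} {a b : ℂ} {C : ℝ} (h : ∀ v ∈ segment ℝ a b, ‖f v‖ ≤ C) :
    ‖segInt f a b‖ ≤ C * ‖b - a‖ := by
  have := intervalIntegral.norm_integral_le_of_norm_le_const (a := (0 : ℝ)) (b := 1)
    (f := fun t : ℝ => f (a + t * (b - a)) * (b - a)) (C := C * ‖b - a‖) fun t ht => by
      rw [norm_mul]
      rw [uIoc_of_le zero_le_one] at ht
      gcongr
      exact h _ (mem_segment_param _ _ ⟨ht.1.le, ht.2⟩)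
  simpa [segInt] using this

/-- The decaying term integrates to at most $A$ times the ratio of the length to the real extent,
which stays bounded when long segments are nearly horizontal. -/
theorem norm_segInt_le_of_exp {f : ℂ → ℂ} {a b : ℂ} {A B : ℝ} (hA : 0 ≤ A) (hab : a.re < b.re)
    (h : ∀ v ∈ segment ℝ a b, ‖f v‖ ≤ A * Real.exp (-(v.re - a.re)) + B) :
    ‖segInt f a b‖ ≤ ‖b - a‖ * (A / (b.re - a.re) + B) := by
  set ℓ := b.re - a.re with hℓ
  have hℓ0 : 0 < ℓ := by rw [hℓ]; linarith
  have hint : ∫ t in (0 : ℝ)..1, (‖b - a‖ * (A * Real.exp (-(t * ℓ)) + B)) =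
      ‖b - a‖ * (A * (1 - Real.exp (-ℓ)) / ℓ + B) := by
    rw [intervalIntegral.integral_eq_sub_of_hasDerivAt
      (f := fun t => ‖b - a‖ * (-(A * Real.exp (-(t * ℓ)) / ℓ) + B * t))]
    · simp; ring
    · intro t _
      have h1 : HasDerivAt (fun t : ℝ => -(t * ℓ)) (-(1 * ℓ)) t :=
        ((hasDerivAt_id t).mul_const ℓ).neg
      have h2 := ((((h1.exp.const_mul A).div_const ℓ).neg).add
        ((hasDerivAt_id t).const_mul B)).const_mul ‖b - a‖
      refine h2.congr_deriv ?_
      field_simp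
    · exact Continuous.intervalIntegrable (by fun_prop) _ _
  have h1 : ‖segInt f a b‖ ≤ ∫ t in (0 : ℝ)..1, (‖b - a‖ * (A * Real.exp (-(t * ℓ)) + B)) := by
    refine intervalIntegral.norm_integral_le_of_norm_le zero_le_one
      (MeasureTheory.ae_of_all _ fun t ht => ?_)
      (Continuous.intervalIntegrable (by fun_prop) _ _)
    rw [norm_mul, mul_comm]
    have h2 := h _ (mem_segment_param a b ⟨ht.1.le, ht.2⟩)
    have h3 : (a + t * (b - a)).re - a.re = t * ℓ := by simp [hℓ]
    rw [h3] at h2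
    gcongr
  refine h1.trans (hint.le.trans ?_)
  have := Real.exp_pos (-ℓ)
  gcongr
  nlinarith

theorem norm_inv_one_sub_exp_le {x : ℂ} (hx : 1 ≤ x.re) :
    ‖(1 - exp x)⁻¹‖ ≤ 2 * Real.exp (-x.re) := by
  have h1 : 2 ≤ Real.exp x.re := by
    linarith [Real.add_one_le_exp x.re]
  have h2 : Real.exp x.re - 1 ≤ ‖1 - exp x‖ := by
    have := norm_sub_norm_le (exp x) 1
    rw [norm_one, Complex.norm_exp, norm_sub_rev] at this
    exact this
  rw [norm_inv, Real.exp_neg]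
  rw [show 2 * (Real.exp x.re)⁻¹ = (Real.exp x.re / 2)⁻¹ by field_simp]
  exact inv_anti₀ (by linarith) (by linarith)

theorem tendsto_of_forall_eventually_le {l : Filter ℂ} {f : ℂ → ℂ} {K : ℝ}
    (h : ∀ η > 0, ∀ᶠ ω in l, ‖f ω‖ ≤ K * η) : Tendsto f l (𝓝 0) := by
  rw [Metric.tendsto_nhds]
  intro ε hε
  filter_upwards [h (ε / (|K| + 1)) (by positivity)] with ω hω
  rw [dist_zero_right]
  have h1 := le_abs_self K
  have h2 := abs_nonneg K
  calc ‖f ω‖ ≤ K * (ε / (|K| + 1)) := hω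
    _ ≤ |K| * (ε / (|K| + 1)) := by gcongr
    _ < ε := by rw [← mul_div_assoc, div_lt_iff₀ (by linarith)]; nlinarith

theorem eventually_norm_exp_lt (M : ℝ) {ρ : ℝ} (hρ : 0 < ρ) :
    ∀ᶠ ω in stripAtBot M, ‖exp ω‖ < ρ := by
  have := (Real.tendsto_exp_atBot.comp (tendsto_re_stripAtBot M)).eventually_lt_const hρ
  simpa [Complex.norm_exp] using this

/-- Here `x` stays on a compact segment off the singularity, while $v=\omega+x$ goes uniformly to
$-\infty$, where the factor of `Φ` is small. -/
theorem tendsto_exp_mul_segInt_left (hR : R ≤ 1 / 4) (hR0 : 0 < R) (hr : 4 * R < r)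
    (hΦ : DifferentiableOn ℂ Φ {w | ‖exp w‖ < r}) (hΨ : DifferentiableOn ℂ Ψ {w | ‖exp w‖ < r})
    (sΦ : IsSmallBranch Φ) (sΨ : IsSmallBranch Ψ) {a b : ℂ} (hab : segment ℝ a b ⊆ slitLeft 2)
    (M : ℝ) :
    Tendsto (fun ω => exp ω * segInt (fun x => convKernel Φ Ψ ω (logLeft x) (ω + x)) a b)
      (stripAtBot M) (𝓝 0) := by
  have hpi := Real.pi_pos
  obtain ⟨C, hC, h1⟩ := exists_norm_exp_mul_convKernel_le hR hr hΦ hΨ sΦ sΨ (|M| + 4 * Real.pi)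
  have hcont : ContinuousOn (fun x : ℂ => (1 - exp x)⁻¹) (segment ℝ a b) :=
    ContinuousOn.inv₀ (by fun_prop) fun x hx =>
      slitPlane_ne_zero (one_sub_exp_mem_slitPlane_left (hab hx))
  have hcomp : IsCompact (segment ℝ a b) := by
    rw [segment_eq_image']
    exact isCompact_Icc.image (by fun_prop)
  obtain ⟨Cs, hCs⟩ := hcomp.exists_bound_of_continuousOn hcont
  refine tendsto_of_forall_eventually_le (K := C * 2 * |Cs| * ‖b - a‖) fun η hη => ?_
  obtain ⟨D, hD, h2⟩ := h1 η hη
  have hsm : ∀ᶠ ω in stripAtBot M, D * (‖exp ω‖ * Real.exp 2) < η := by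
    filter_upwards [eventually_norm_exp_lt M
      (by positivity : 0 < η / ((D + 1) * Real.exp 2))] with ω hω
    rw [lt_div_iff₀ (by positivity)] at hω
    have := mul_nonneg (norm_nonneg (exp ω)) (Real.exp_pos 2).le
    nlinarith
  filter_upwards [hsm, eventually_norm_exp_lt M (by positivity : 0 < R / Real.exp 2),
    abs_im_le_stripAtBot M] with ω hω1 hω2 hωM
  rw [lt_div_iff₀ (Real.exp_pos 2)] at hω2
  have hωR : ‖exp ω‖ < R := norm_exp_lt_of_two (ρ := R / Real.exp 2)
    (by rw [div_mul_cancel₀ _ (Real.exp_pos 2).ne']) (by rwa [lt_div_iff₀ (Real.exp_pos 2)])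
  rw [const_mul_segInt]
  refine (norm_segInt_le (C := C * (2 * η) * |Cs|) fun x hx => ?_).trans (le_of_eq (by ring))
  have hx' := hab hx
  have hsl := one_sub_exp_mem_slitPlane_left hx'
  have h3 := h2 ω (logLeft x) (ω + x) hωR (norm_exp_add_lt hω2.le hx'.1)
    (by rw [add_sub_cancel_left, exp_logLeft (slitPlane_ne_zero hsl)])
    (hωM.trans (by linarith [le_abs_self M]))
    (by
      rw [add_im]
      refine (abs_add_le _ _).trans ?_
      linarith [le_abs_self M, hx'.2.1]) ((log_im_le_four_pi_left x).trans (by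
        linarith [abs_nonneg M]))
  refine h3.trans ?_
  rw [add_sub_cancel_left]
  have h4 : D * Real.exp (ω + x).re ≤ η := by
    refine le_trans ?_ hω1.le
    rw [add_re, Real.exp_add, Complex.norm_exp]
    gcongr
    exact hx'.1.le
  have h5 := (hCs x hx).trans (le_abs_self Cs)
  gcongr
  linarith

/-- The segment lengthens as $\operatorname{Re}\omega\to-\infty$, but the factor
$(1-e^{v-\omega})^{-1}$ decays along it. The η term of the bound contributes $O(\eta)$, the other
one a multiple of $|\operatorname{Re}\omega|\,e^{\operatorname{Re}\omega}$. -/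
theorem tendsto_exp_mul_segInt_right (hR : R ≤ 1 / 4) (hr : 4 * R < r)
    (hΦ : DifferentiableOn ℂ Φ {w | ‖exp w‖ < r}) (hΨ : DifferentiableOn ℂ Ψ {w | ‖exp w‖ < r})
    (sΦ : IsSmallBranch Φ) (sΨ : IsSmallBranch Ψ) (hρ0 : 0 < ρ)
    (hρ : ρ * Real.exp 2 ≤ R) {P n c : ℂ} (hP : ρ * Real.exp 2 ≤ ‖exp P‖) (hP' : ‖exp P‖ < R)
    (hn : exp n = 1) (hc : c.re = 1) (M : ℝ) :
    Tendsto (fun ω => exp ω * segInt (fun v => convKernel Φ Ψ ω (logRight (v - ω) - n) v)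
      (ω + c) P) (stripAtBot M) (𝓝 0) := by
  have hpi := Real.pi_pos
  set M₁ := |M| + |c.im| + |P.im| with hM₁
  have hM₁0 : 0 ≤ M₁ := by positivity
  obtain ⟨C, hC, h1⟩ := exists_norm_exp_mul_convKernel_le hR hr hΦ hΨ sΦ sΨ
    (2 * M₁ + 2 * Real.pi + |n.im|)
  refine tendsto_of_forall_eventually_le (K := (1 + 2 * M₁) * (2 * C * 2)) fun η hη => ?_
  obtain ⟨D, hD, h2⟩ := h1 η hη
  have hsm : ∀ᶠ ω in stripAtBot M, (D * Real.exp P.re) *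
      ((P.re - ω.re) * Real.exp (-(P.re - ω.re))) < η := by
    have h3 : Tendsto (fun ω : ℂ => P.re - ω.re) (stripAtBot M) atTop := by
      have := tendsto_neg_atBot_atTop.comp (tendsto_re_stripAtBot M)
      exact tendsto_atTop_add_const_left _ P.re this
    have h4 := ((Real.tendsto_pow_mul_exp_neg_atTop_nhds_zero 1).comp h3).const_mul
      (D * Real.exp P.re)
    rw [mul_zero] at h4
    simpa using h4.eventually_lt_const hη
  filter_upwards [hsm, eventually_norm_exp_lt M hρ0, abs_im_le_stripAtBot M] with ω hω1 hω2 hωM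
  have hωR := norm_exp_lt_of_two hρ hω2
  have hre := re_add_two_lt hP hω2
  have hcm : ω + c ∈ outerStrip ω.re R := mem_outerStrip_of_re hρ hω2 (by simp [hc]) (by
    rw [hc]; norm_num)
  have hPm := mem_outerStrip_endpoint hP hP' hω2
  rw [const_mul_segInt]
  have hωM' : |ω.im| ≤ |M| := hωM.trans (le_abs_self M)
  have him : |(ω + c).im| ≤ M₁ := by
    rw [add_im]
    refine (abs_add_le _ _).trans ?_
    linarith [abs_nonneg P.im]
  have hPim : |P.im| ≤ M₁ := by linarith [abs_nonneg c.im, abs_nonneg M]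
  have hbound : ∀ v ∈ segment ℝ (ω + c) P, ‖exp ω * convKernel Φ Ψ ω (logRight (v - ω) - n) v‖ ≤
      (2 * C * η) * Real.exp (-(v.re - (ω + c).re)) + 2 * C * D * Real.exp ω.re := by
    intro v hv
    have hvm := (convex_outerStrip ω.re R).segment_subset hcm hPm hv
    have hvre : 1 + ω.re ≤ v.re := by
      have : segment ℝ (ω + c) P ⊆ {v : ℂ | 1 + ω.re ≤ v.re} :=
        (convex_halfSpace_re_ge _).segment_subset
          (by simp only [mem_ofPred_eq, add_re, hc]; linarith)
          (by simp only [mem_ofPred_eq]; linarith)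
      exact this hv
    have hvim : |v.im| ≤ M₁ := by
      have : segment ℝ (ω + c) P ⊆ {v : ℂ | v.im ≤ M₁} ∩ {v : ℂ | -M₁ ≤ v.im} :=
        ((convex_halfSpace_im_le _).inter (convex_halfSpace_im_ge _)).segment_subset
          ⟨(abs_le.1 him).2, (abs_le.1 him).1⟩ ⟨(abs_le.1 hPim).2, (abs_le.1 hPim).1⟩
      exact abs_le.2 ⟨(this hv).2, (this hv).1⟩
    have hlim : |(logRight (v - ω) - n).im| ≤ 2 * M₁ + 2 * Real.pi + |n.im| := by
      have h5 : |(Complex.log (1 - exp (-(v - ω)))).im| ≤ Real.pi := abs_log_im_le_pi _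
      have h6 : (logRight (v - ω) - n).im = v.im - ω.im + Real.pi +
        (Complex.log (1 - exp (-(v - ω)))).im - n.im := by simp [logRight]
      have h7 := abs_nonneg P.im
      have h8 := abs_nonneg c.im
      rw [h6]
      have h9 := abs_le.1 (le_refl |n.im|)
      rw [abs_le] at h5 hωM' hvim ⊢
      constructor <;> linarith [h5.1, h5.2, hωM'.1, hωM'.2, hvim.1, hvim.2]
    have h3 := h2 ω (logRight (v - ω) - n) v hωR hvm.2
      (by rw [Complex.exp_sub, hn, div_one, exp_logRight_sub hvm.1])
      (hωM'.trans (by linarith [abs_nonneg P.im, abs_nonneg c.im, abs_nonneg n.im]))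
      (hvim.trans (by linarith [abs_nonneg n.im])) hlim
    refine h3.trans ?_
    have h4 := norm_inv_one_sub_exp_le (x := v - ω) (by rw [sub_re]; linarith)
    have h5 : Real.exp v.re * Real.exp (-(v.re - ω.re)) = Real.exp ω.re := by
      rw [← Real.exp_add]; ring_nf
    have h6 : Real.exp (-(v.re - ω.re)) ≤ Real.exp (-(v.re - (ω + c).re)) :=
      Real.exp_le_exp.2 (by rw [add_re, hc]; linarith)
    rw [sub_re] at h4
    calc C * (η + D * Real.exp v.re) * ‖(1 - exp (v - ω))⁻¹‖
        ≤ C * (η + D * Real.exp v.re) * (2 * Real.exp (-(v.re - ω.re))) := by gcongr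
      _ = 2 * C * η * Real.exp (-(v.re - ω.re)) +
          2 * C * D * (Real.exp v.re * Real.exp (-(v.re - ω.re))) := by ring
      _ ≤ _ := by rw [h5]; gcongr
  have hℓ : (1 : ℝ) ≤ P.re - (ω + c).re := by rw [add_re, hc]; linarith
  refine (norm_segInt_le_of_exp (by positivity) (by linarith) hbound).trans ?_
  set ℓ := P.re - (ω + c).re with hℓd
  have hn1 : ‖P - (ω + c)‖ ≤ ℓ * (1 + 2 * M₁) := by
    refine (Complex.norm_le_abs_re_add_abs_im _).trans ?_
    rw [sub_re, ← hℓd, abs_of_pos (by linarith), sub_im]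
    have := abs_sub P.im (ω + c).im
    nlinarith
  have hfin : ℓ * (D * Real.exp ω.re) ≤ η := by
    refine le_trans ?_ hω1.le
    have h7 : Real.exp ω.re = Real.exp P.re * Real.exp (-(P.re - ω.re)) := by
      rw [← Real.exp_add]; ring_nf
    have h8 : ℓ ≤ P.re - ω.re := by rw [hℓd, add_re, hc]; linarith
    calc ℓ * (D * Real.exp ω.re) ≤ (P.re - ω.re) * (D * Real.exp ω.re) := by gcongr
      _ = _ := by rw [h7]; ring
  have hℓ0 : 0 < ℓ := by linarith
  calc ‖P - (ω + c)‖ * (2 * C * η / ℓ + 2 * C * D * Real.exp ω.re)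
      ≤ (ℓ * (1 + 2 * M₁)) * (2 * C * η / ℓ + 2 * C * D * Real.exp ω.re) := by gcongr
    _ = (1 + 2 * M₁) * (2 * C * (η + ℓ * (D * Real.exp ω.re))) := by field_simp
    _ ≤ (1 + 2 * M₁) * (2 * C * (η + η)) := by gcongr
    _ = _ := by ring

theorem isSmallBranch_convBranch (hR : R ≤ 1 / 4) (hr : 4 * R < r)
    (hΦ : DifferentiableOn ℂ Φ {w | ‖exp w‖ < r}) (hΨ : DifferentiableOn ℂ Ψ {w | ‖exp w‖ < r})
    (sΦ : IsSmallBranch Φ) (sΨ : IsSmallBranch Ψ) (hρ0 : 0 < ρ)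
    (hρ : ρ * Real.exp 2 ≤ R) (h₁ : ρ * Real.exp 2 ≤ ‖exp P₁‖) (h₁' : ‖exp P₁‖ < R)
    (h₂ : ρ * Real.exp 2 ≤ ‖exp P₂‖) (h₂' : ‖exp P₂‖ < R) :
    IsSmallBranch (convBranch Φ Ψ P₁ P₂) := by
  intro M
  have hR0 : 0 < R := (norm_nonneg _).trans_lt h₁'
  have t1 := tendsto_exp_mul_segInt_right hR hr hΦ hΨ sΦ sΨ hρ0 hρ h₁ h₁'
    Complex.exp_two_pi_mul_I one_add_pi_re M
  have t2 := tendsto_exp_mul_segInt_left hR hR0 hr hΦ hΨ sΦ sΨ segment_left_upper M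
  have t3 := tendsto_exp_mul_segInt_left hR hR0 hr hΦ hΨ sΦ sΨ segment_left_lower M
  have t4 := tendsto_exp_mul_segInt_right hR hr hΦ hΨ sΦ sΨ hρ0 hρ h₂ h₂'
    Complex.exp_zero one_sub_pi_re M
  have h := (t1.neg.add (t2.add t3)).add t4
  simp only [neg_zero, add_zero, sub_zero] at h
  refine h.congr fun ω => ?_
  rw [convBranch, segInt_symm _ P₁]
  ring

end

noncomputable section

/-! ### The local convolution as a limit of integrals of the principal branches -/

variable {Φ Ψ : ℂ → ℂ} {R r ρ : ℝ} {P₁ P₂ : ℂ}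

/-- When the arguments of both endpoints are within $2\pi$ of that of `ω`, on opposite sides, the
whole path lies in the left cut plane, where every determination used is `logLeft`; so a single
primitive computes it. -/
theorem convBranch_eq_sub {ω : ℂ} {B : ℝ} {p : ℂ → ℂ} (hR : R ≤ 1 / 4) (hr : 4 * R ≤ r)
    (hΦ : DifferentiableOn ℂ Φ {w | ‖exp w‖ < r}) (hΨ : DifferentiableOn ℂ Ψ {w | ‖exp w‖ < r})
    (hωR : ‖exp ω‖ < R) (hB : ‖exp ω‖ * Real.exp B ≤ R) (h2B : 2 ≤ B)
    (hp : ∀ x ∈ slitLeft B, HasDerivAt p (convKernel Φ Ψ ω (logLeft x) (ω + x)) x)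
    (h₁ : (P₁ - ω).re < B ∧ 0 < (P₁ - ω).im ∧ (P₁ - ω).im < 2 * Real.pi)
    (h₂ : (P₂ - ω).re < B ∧ -(2 * Real.pi) < (P₂ - ω).im ∧ (P₂ - ω).im < 0) :
    convBranch Φ Ψ P₁ P₂ ω = p (P₂ - ω) - p (P₁ - ω) := by
  have hpi := Real.pi_pos
  have hd := kernelLeft_differentiableOn hR hr hΦ hΨ hωR hB
  have mono : slitLeft 2 ⊆ slitLeft B := fun x hx => ⟨hx.1.trans_le h2B, hx.2⟩
  have key : ∀ (l : ℂ → ℂ) (S : Set ℂ), Convex ℝ S → S ⊆ slitLeft B →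
      (∀ x ∈ S, l x = logLeft x) → ∀ a b : ℂ, a - ω ∈ S → b - ω ∈ S →
      segInt (fun v => convKernel Φ Ψ ω (l (v - ω)) v) a b = p (b - ω) - p (a - ω) := by
    intro l S hS hSB hl a b ha hb
    have hseg : ∀ v ∈ segment ℝ a b, v - ω ∈ S := fun v hv => by
      obtain ⟨s, t, hs, ht, hst, rfl⟩ := hv
      have := hS ha hb hs ht hst
      convert this using 1
      have : (s : ℂ) + t = 1 := by exact_mod_cast hst
      simp only [Complex.real_smul]
      linear_combination ω * this
    have e : segInt (fun v => convKernel Φ Ψ ω (l (v - ω)) v) a b =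
        segInt (fun v => convKernel Φ Ψ ω (logLeft (v - ω)) v) a b := by
      rw [segInt, segInt]
      refine intervalIntegral.integral_congr fun t ht => ?_
      rw [uIcc_of_le zero_le_one] at ht
      simp only [hl _ (hseg _ (mem_segment_param a b ht))]
    rw [e]
    refine segInt_eq_sub (P := fun v => p (v - ω)) (U := {v | v - ω ∈ slitLeft B}) ?_ ?_
      fun v hv => hSB (hseg v hv)
    · intro v hv
      have := (hp _ hv).comp v ((hasDerivAt_id v).sub_const ω)
      simpa [Function.comp_def] using this
    · intro v hv
      have h := (hd.differentiableAt ((isOpen_slitLeft B).mem_nhds hv)).comp v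
        (differentiableAt_id.sub_const ω)
      have h' : DifferentiableAt ℂ (fun v => convKernel Φ Ψ ω (logLeft (v - ω)) v) v := by
        simpa [Function.comp_def] using h
      exact h'.differentiableWithinAt
  have k1 := key (fun x => logRight x - 2 * Real.pi * I) _ (convex_strip 0 (2 * Real.pi) B)
    (fun x hx => upper_mem_slitLeft hx)
    (fun x hx => by rw [logRight_eq_add_of_im_pos hx.2.1 hx.2.2]; ring) P₁ (ω + (1 + Real.pi * I))
    h₁ (by rw [add_sub_cancel_left]; refine ⟨?_, ?_, ?_⟩ <;> simp <;> linarith)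
  have k2 := key logRight _ (convex_strip (-(2 * Real.pi)) 0 B)
    (fun x hx => lower_mem_slitLeft hx)
    (fun x hx => logRight_eq_of_im_neg hx.2.2 hx.2.1) (ω + (1 - Real.pi * I)) P₂
    (by rw [add_sub_cancel_left]; refine ⟨?_, ?_, ?_⟩ <;> simp <;> linarith) h₂
  rw [convBranch, k1, k2, segInt_eq_sub hp hd (segment_left_upper.trans mono),
    segInt_eq_sub hp hd (segment_left_lower.trans mono), add_sub_cancel_left, add_sub_cancel_left]
  ring

theorem log_eq_log_neg_add {σ : ℝ} (hσ : σ = 1 ∨ σ = -1) {z : ℂ} (hz : 0 < σ * z.im) :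
    Complex.log z = Complex.log (-z) + σ * Real.pi * I := by
  have hz0 : z ≠ 0 := by rintro rfl; simp at hz
  have h1 := sign_im_log hσ hz
  have h2 : 0 < -σ * (-z).im := by rw [neg_im]; linarith
  have h3 := sign_im_log (σ := -σ) (by rcases hσ with rfl | rfl <;> simp) h2
  have h4 : exp (Complex.log (-z) + σ * Real.pi * I) = z := by
    rw [Complex.exp_add, Complex.exp_log (neg_ne_zero.2 hz0)]
    rcases hσ with rfl | rfl <;> simp [Complex.exp_neg]
  conv_lhs => rw [← h4]
  have h5 : (Complex.log (-z) + σ * Real.pi * I).im = (Complex.log (-z)).im + σ * Real.pi := by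
    simp
  have hpi := Real.pi_pos
  apply Complex.log_exp
  · rw [h5]
    rcases hσ with rfl | rfl <;> linarith
  · rw [h5]
    rcases hσ with rfl | rfl <;> linarith

theorem im_exp_ofReal_add_mul_I (x y : ℝ) : (exp (x + y * I)).im = Real.exp x * Real.sin y := by
  rw [Complex.exp_im]; simp

theorem sin_sign_mul {σ : ℝ} (hσ : σ = 1 ∨ σ = -1) (h : ℝ) :
    σ * Real.sin (σ * h) = Real.sin h := by
  rcases hσ with rfl | rfl <;> simp

theorem sign_im_exp_sub_one {σ : ℝ} (hσ : σ = 1 ∨ σ = -1) {x h : ℝ} (h0 : 0 < h)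
    (h1 : h < Real.pi) : 0 < σ * (exp ((x : ℂ) + (σ * h : ℝ) * I) - 1).im := by
  rw [sub_im, one_im, sub_zero, im_exp_ofReal_add_mul_I, mul_left_comm, sin_sign_mul hσ]
  exact mul_pos (Real.exp_pos x) (Real.sin_pos_of_pos_of_lt_pi h0 h1)

/-- The lift to the universal covering of the point `exp (x + σ h i)` close to `1`. -/
theorem convKernel_eq_of_side {F G : ℂ → ℂ} {σ : ℝ} {α β ω : ℂ} {x h B : ℝ}
    (hσ : σ = 1 ∨ σ = -1) (hR : R ≤ 1 / 4) (hr : 4 * R ≤ r)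
    (eΦ : ∀ w : ℂ, ‖exp w‖ < r → 0 < σ * w.im → σ * w.im < Real.pi →
      Φ w = F (α * (1 + exp w)))
    (eΨ : ∀ w : ℂ, ‖exp w‖ < r → 0 < σ * w.im → σ * w.im < Real.pi →
      Ψ w = G (β * (1 + exp w)))
    (hω : ‖exp ω‖ < R) (ω0 : 0 < σ * ω.im) (ωpi : σ * ω.im < Real.pi)
    (hB : ‖exp ω‖ * Real.exp B = R)
    (h0 : 0 < h) (h1 : h < σ * ω.im) (hx : ‖exp ((x : ℂ) + (σ * h : ℝ) * I) - 1‖ < R)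
    (hz : 0 < σ * ((1 + exp ω) * exp (-((x : ℂ) + (σ * h : ℝ) * I))).im) :
    let X : ℂ := (x : ℂ) + (σ * h : ℝ) * I
    let v := Complex.log (exp X - 1)
    exp v = exp X - 1 ∧ v - ω ∈ slitLeft B ∧
      convKernel Φ Ψ ω (logLeft (v - ω)) v * (exp X / (exp X - 1)) =
        F (α * exp X) * G (β * (1 + exp ω) * exp (-X)) := by
  intro X v
  have hpi := Real.pi_pos
  have him := sign_im_exp_sub_one hσ (x := x) h0 (h1.trans ωpi)
  have hne : exp X - 1 ≠ 0 := by
    intro h'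
    rw [show exp ((x : ℂ) + (σ * h : ℝ) * I) - 1 = 0 from h'] at him
    simp at him
  have hev : exp v = exp X - 1 := Complex.exp_log hne
  have hv := sign_im_log hσ him
  have hev1 : 1 + exp v = exp X := by rw [hev]; ring
  have hvR : ‖exp v‖ < R := by rw [hev]; exact hx
  have hXlog : Complex.log (1 + exp v) = X := by
    rw [hev1]
    have hXim : X.im = σ * h := by simp [X]
    apply Complex.log_exp
    · rw [hXim]; rcases hσ with rfl | rfl <;> linarith
    · rw [hXim]; rcases hσ with rfl | rfl <;> linarith
  have hωpos : 0 < ‖exp ω‖ := norm_pos_iff.2 (Complex.exp_ne_zero ω)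
  have hvim : |(v - ω).im| < Real.pi := by
    rw [sub_im, abs_lt]
    rcases hσ with rfl | rfl <;> constructor <;> linarith [hv.1, hv.2]
  have hslit : v - ω ∈ slitLeft B := by
    refine ⟨?_, by linarith, ?_⟩
    · have : Real.exp (v - ω).re < Real.exp B := by
        rw [← Complex.norm_exp, Complex.exp_sub, norm_div, div_lt_iff₀ hωpos]
        linarith
      exact Real.exp_lt_exp.1 this
    -- If $v=\omega+q$ with `q` real, then $\operatorname{Im}(z/u)$ has, up to the positive factor
    -- $1/|1+e^v|^2$ and the scale of β, the value $\operatorname{Im}(e^\omega)(1-e^q)$. The side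
    -- condition forces $q<0$, so the cut is avoided.
    · by_cases him0 : (v - ω).im = 0
      swap
      · exact Or.inr him0
      left
      set q := (v - ω).re with hq
      have hvω : v = ω + (q : ℂ) := by
        apply Complex.ext
        · simp [hq]
        · rw [sub_im] at him0; simp; linarith
      have hexpv : exp v = exp ω * (Real.exp q : ℝ) := by
        rw [hvω, Complex.exp_add]; simp
      have hX1 : exp (-X) = (1 + exp ω * (Real.exp q : ℝ))⁻¹ := by
        rw [Complex.exp_neg, ← hev1, hexpv]
      have hz' : 0 < σ * ((1 + exp ω) * (1 + exp ω * (Real.exp q : ℝ))⁻¹).im := by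
        rw [← hX1]; exact hz
      have hωim : 0 < σ * (exp ω).im := by
        rw [Complex.exp_im, mul_left_comm]
        refine mul_pos (Real.exp_pos _) ?_
        have h2 := Real.sin_pos_of_pos_of_lt_pi ω0 ωpi
        rcases hσ with rfl | rfl
        · simpa using h2
        · simpa using h2
      have hns : 0 < Complex.normSq (1 + exp ω * (Real.exp q : ℝ)) := by
        rw [Complex.normSq_pos, ← hexpv, hev1]
        exact Complex.exp_ne_zero X
      have hcalc : ((1 + exp ω) * (1 + exp ω * (Real.exp q : ℝ))⁻¹).im =
          (exp ω).im * (1 - Real.exp q) / Complex.normSq (1 + exp ω * (Real.exp q : ℝ)) := by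
        rw [Complex.mul_im, Complex.inv_re, Complex.inv_im]
        simp only [add_re, add_im, one_re, one_im, mul_re, mul_im, ofReal_re, ofReal_im]
        field_simp
        ring
      rw [hcalc, ← mul_div_assoc, ← mul_assoc] at hz'
      have h3 := (div_pos_iff_of_pos_right hns).1 hz'
      have h4 := (mul_pos_iff_of_pos_left hωim).1 h3
      have h5 : Real.exp q < 1 := by linarith
      simpa using h5
  have hsl := one_sub_exp_mem_slitPlane_left hslit
  have hl : exp (logLeft (v - ω)) = 1 - exp (v - ω) := exp_logLeft (slitPlane_ne_zero hsl)
  refine ⟨hev, hslit, ?_⟩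
  have hy := exp_convKernel_arg (ω := ω) hR hvR hl
  have hyr := norm_exp_convKernel_arg_lt hR hr hω hvR hl
  rw [convKernel]
  rw [hXlog] at hy hyr ⊢
  set y := ω + logLeft (v - ω) - X with hyd
  have hy1 : 1 + exp y = (1 + exp ω) * exp (-X) := by
    rw [hy, hev1, hev, Complex.exp_neg]
    have := Complex.exp_ne_zero X
    field_simp
    ring
  have hysin : 0 < Real.sin (σ * y.im) := by
    rw [← hy1, add_im, one_im, zero_add, Complex.exp_im, mul_left_comm] at hz
    have h2 := (mul_pos_iff_of_pos_left (Real.exp_pos _)).1 hz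
    rcases hσ with rfl | rfl
    · simpa using h2
    · simpa using h2
  have hyim : σ * y.im = σ * ω.im + σ * (logLeft (v - ω)).im - h := by
    rw [hyd]
    have : σ * σ = 1 := by rcases hσ with rfl | rfl <;> norm_num
    simp only [sub_im, add_im, X, ofReal_im, mul_im, I_re, I_im, ofReal_re]
    linear_combination (-h) * this
  have hlog := abs_le.1 (abs_log_im_le_pi (1 - exp (v - ω)))
  have hσl : -Real.pi ≤ σ * (logLeft (v - ω)).im ∧ σ * (logLeft (v - ω)).im ≤ Real.pi := by
    rw [logLeft]
    rcases hσ with rfl | rfl <;> constructor <;> linarith [hlog.1, hlog.2]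
  -- A priori $\sigma\operatorname{Im}y$ lies between $-\pi$ and $2\pi$; there a positive sine
  -- leaves only $(0,\pi)$, the range where `Ψ` equals `G`.
  have hyrange : 0 < σ * y.im ∧ σ * y.im < Real.pi := by
    constructor
    · by_contra hcon
      have := Real.sin_nonpos_of_nonpos_of_neg_pi_le (not_lt.1 hcon)
        (by rw [hyim]; linarith [hσl.1])
      linarith
    · by_contra hcon
      have h6 := Real.sin_nonneg_of_nonneg_of_le_pi (x := σ * y.im - Real.pi)
        (by linarith [not_lt.1 hcon]) (by rw [hyim]; linarith [hσl.2])
      rw [Real.sin_sub_pi] at h6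
      linarith
  have hR0 : 0 < R := (norm_nonneg _).trans_lt hω
  rw [eΦ v (by linarith) hv.1 hv.2, eΨ y hyr hyrange.1 hyrange.2, hev1, hy1, hev]
  have := Complex.exp_ne_zero X
  field_simp

theorem tendsto_exp_add_side (σ x : ℝ) :
    Tendsto (fun h : ℝ => exp ((x : ℂ) + (σ * h : ℝ) * I)) (𝓝[>] 0) (𝓝 (exp x)) := by
  have : Continuous fun h : ℝ => exp ((x : ℂ) + (σ * h : ℝ) * I) := by fun_prop
  have h := this.tendsto 0
  simp only [mul_zero, ofReal_zero, zero_mul, add_zero] at h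
  exact h.mono_left nhdsWithin_le_nhds

/-- The endpoint over `exp c`, `c > 0`. -/
theorem tendsto_log_side_pos (σ : ℝ) {c : ℝ} (hc : 0 < c) :
    Tendsto (fun h : ℝ => Complex.log (exp ((c : ℂ) + (σ * h : ℝ) * I) - 1)) (𝓝[>] 0)
      (𝓝 (Real.log (Real.exp c - 1) : ℝ)) := by
  have h1 : 0 < Real.exp c - 1 := by linarith [Real.add_one_le_exp c]
  have h2 : exp (c : ℂ) - 1 ∈ slitPlane := by
    left
    rw [← ofReal_exp, ← ofReal_one, ← ofReal_sub, ofReal_re]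
    exact h1
  have := ((tendsto_exp_add_side σ c).sub_const 1).clog h2
  rwa [Complex.ofReal_log h1.le, ofReal_sub, ofReal_exp, ofReal_one]

/-- The endpoint over `exp c`, `c < 0`. -/
theorem tendsto_log_side_neg {σ : ℝ} (hσ : σ = 1 ∨ σ = -1) {c : ℝ} (hc : c < 0) :
    Tendsto (fun h : ℝ => Complex.log (exp ((c : ℂ) + (σ * h : ℝ) * I) - 1)) (𝓝[>] 0)
      (𝓝 ((Real.log (1 - Real.exp c) : ℝ) + σ * Real.pi * I)) := by
  have h1 : 0 < 1 - Real.exp c := by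
    have := Real.exp_lt_exp.2 hc
    rw [Real.exp_zero] at this
    linarith
  have h2 : -(exp (c : ℂ) - 1) ∈ slitPlane := by
    left
    rw [neg_sub, ← ofReal_exp, ← ofReal_one, ← ofReal_sub, ofReal_re]
    exact h1
  have h3 := (((tendsto_exp_add_side σ c).sub_const 1).neg.clog h2).add_const (σ * Real.pi * I : ℂ)
  have h4 : -(exp (c : ℂ) - 1) = ((1 - Real.exp c : ℝ) : ℂ) := by push_cast; ring
  rw [h4, ← Complex.ofReal_log h1.le] at h3
  refine h3.congr' ?_
  filter_upwards [Ioo_mem_nhdsGT Real.pi_pos] with h hh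
  exact (log_eq_log_neg_add hσ (sign_im_exp_sub_one hσ hh.1 hh.2)).symm

theorem eventually_norm_exp_side_lt {σ c₁ c₂ : ℝ}
    (h₁ : 1 - Real.exp c₁ < R) (h₂ : Real.exp c₂ - 1 < R) :
    ∀ᶠ h : ℝ in 𝓝[>] 0, ∀ x ∈ Icc c₁ c₂, ‖exp ((x : ℂ) + (σ * h : ℝ) * I) - 1‖ < R := by
  obtain ⟨R', hR1, hR2, hR'⟩ : ∃ R', 1 - Real.exp c₁ ≤ R' ∧ Real.exp c₂ - 1 ≤ R' ∧ R' < R :=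
    ⟨_, le_max_left _ _, le_max_right _ _, max_lt h₁ h₂⟩
  have ht := ((tendsto_exp_add_side σ 0).sub_const 1).norm
  simp only [ofReal_zero, zero_add, exp_zero, sub_self, norm_zero] at ht
  have hpos : 0 < (R - R') / Real.exp c₂ := div_pos (by linarith) (Real.exp_pos _)
  filter_upwards [ht.eventually_lt_const hpos] with h hh x hx
  rw [lt_div_iff₀ (Real.exp_pos _)] at hh
  have e1 : exp ((x : ℂ) + (σ * h : ℝ) * I) - 1 =
      (Real.exp x : ℝ) * (exp ((σ * h : ℝ) * I) - 1) + ((Real.exp x - 1 : ℝ) : ℂ) := by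
    rw [Complex.exp_add]; push_cast; ring
  rw [e1]
  refine (norm_add_le _ _).trans_lt ?_
  rw [norm_mul, Complex.norm_real, Complex.norm_real, Real.norm_of_nonneg (Real.exp_pos x).le,
    Real.norm_eq_abs]
  have e2 := Real.exp_le_exp.2 hx.1
  have e3 := Real.exp_le_exp.2 hx.2
  have e4 : |Real.exp x - 1| ≤ R' := abs_le.2 ⟨by linarith, by linarith⟩
  have e5 := norm_nonneg (exp ((σ * h : ℝ) * I) - 1)
  nlinarith

theorem eventually_sign_im_side_pos {σ : ℝ} (hσ : σ = 1 ∨ σ = -1) {ω : ℂ} (ω0 : 0 < σ * ω.im)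
    (ωpi : σ * ω.im < Real.pi) :
    ∀ᶠ h : ℝ in 𝓝[>] 0, ∀ x : ℝ,
      0 < σ * ((1 + exp ω) * exp (-((x : ℂ) + (σ * h : ℝ) * I))).im := by
  have hcont : Continuous fun h : ℝ => σ * ((1 + exp ω) * exp (-((σ * h : ℝ) * I))).im :=
    continuous_const.mul (Complex.continuous_im.comp (by fun_prop))
  have ht := hcont.tendsto 0
  have hpos : 0 < σ * ((1 + exp ω) * exp (-((σ * 0 : ℝ) * I))).im := by
    simp only [mul_zero, ofReal_zero, zero_mul, neg_zero, exp_zero, mul_one, add_im, one_im,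
      zero_add, Complex.exp_im]
    rw [mul_left_comm]
    refine mul_pos (Real.exp_pos _) ?_
    have h2 := Real.sin_pos_of_pos_of_lt_pi ω0 ωpi
    rcases hσ with rfl | rfl
    · simpa using h2
    · simpa using h2
  filter_upwards [(ht.mono_left nhdsWithin_le_nhds).eventually_const_lt hpos] with h hh x
  have : (1 + exp ω) * exp (-((x : ℂ) + (σ * h : ℝ) * I)) =
      (Real.exp (-x) : ℝ) * ((1 + exp ω) * exp (-((σ * h : ℝ) * I))) := by
    rw [neg_add, Complex.exp_add]; push_cast; ring
  rw [this, Complex.im_ofReal_mul, mul_left_comm]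
  exact mul_pos (Real.exp_pos _) hh

/-- Near a point over which the singularities of the two factors are opposed, the convolution of the
principal branches along the cut is a local branch with an explicit variation. -/
theorem exists_local_convolution {F G : ℂ → ℂ} {σ : ℝ} {α β : ℂ} (hσ : σ = 1 ∨ σ = -1)
    (hΦ : IsLocalBranch F σ α Φ) (hΨ : IsLocalBranch G σ β Ψ) (sΦ : IsSmallBranch Φ)
    (sΨ : IsSmallBranch Ψ) :
    ∃ δ > 0, ∀ c₁ ∈ Ioo (-δ) 0, ∀ c₂ ∈ Ioo 0 δ, ∃ ρ > 0, ∃ Θ : ℂ → ℂ,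
      DifferentiableOn ℂ Θ {w | ‖exp w‖ < ρ} ∧ IsSmallBranch Θ ∧
      (∀ ω : ℂ, ‖exp ω‖ < ρ → 0 < σ * ω.im → σ * ω.im < Real.pi →
        (∀ᶠ h : ℝ in 𝓝[>] 0, IntervalIntegrable (fun x : ℝ =>
          F (α * exp ((x : ℂ) + (σ * h : ℝ) * I)) *
            G (β * (1 + exp ω) * exp (-((x : ℂ) + (σ * h : ℝ) * I))))
          MeasureTheory.volume c₁ c₂) ∧
        Tendsto (fun h : ℝ => ∫ x in c₁..c₂, F (α * exp ((x : ℂ) + (σ * h : ℝ) * I)) *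
          G (β * (1 + exp ω) * exp (-((x : ℂ) + (σ * h : ℝ) * I)))) (𝓝[>] 0) (𝓝 (Θ ω))) ∧
      ∀ ω : ℂ, ‖exp ω‖ < ρ → HasConvolutionIntegral (monodromyDelta Φ) (monodromyDelta Ψ) ω
        (-σ * (Θ (ω + 2 * Real.pi * I) - Θ ω)) := by
  obtain ⟨r₁, hr₁, dΦ, eΦ⟩ := hΦ
  obtain ⟨r₂, hr₂, dΨ, eΨ⟩ := hΨ
  obtain ⟨r, hr0, hrr1, hrr2⟩ : ∃ r, 0 < r ∧ r ≤ r₁ ∧ r ≤ r₂ :=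
    ⟨min r₁ r₂, lt_min hr₁ hr₂, min_le_left _ _, min_le_right _ _⟩
  replace dΦ : DifferentiableOn ℂ Φ {w | ‖exp w‖ < r} :=
    dΦ.mono fun w hw => lt_of_lt_of_le hw hrr1
  replace dΨ : DifferentiableOn ℂ Ψ {w | ‖exp w‖ < r} :=
    dΨ.mono fun w hw => lt_of_lt_of_le hw hrr2
  replace eΦ : ∀ w : ℂ, ‖exp w‖ < r → 0 < σ * w.im → σ * w.im < Real.pi →
      Φ w = F (α * (1 + exp w)) := fun w hw => eΦ w (hw.trans_le hrr1)
  replace eΨ : ∀ w : ℂ, ‖exp w‖ < r → 0 < σ * w.im → σ * w.im < Real.pi →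
      Ψ w = G (β * (1 + exp w)) := fun w hw => eΨ w (hw.trans_le hrr2)
  -- Dividing `r` by 5 makes $4R<r$ strict, as the growth estimate requires.
  obtain ⟨R, hR0, hR, hr⟩ : ∃ R, 0 < R ∧ R ≤ 1 / 4 ∧ 4 * R < r :=
    ⟨min (1 / 4) (r / 5), by positivity, min_le_left _ _, by
      have := min_le_right (1 / 4) (r / 5); linarith⟩
  have hpi := Real.pi_pos
  -- With $|c|<R/2$ and $R\le1/4$ one has $|e^c-1|<R$.
  refine ⟨R / 2, by positivity, fun c₁ hc₁ c₂ hc₂ => ?_⟩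
  have k1 : 1 - Real.exp c₁ < R := by linarith [Real.add_one_le_exp c₁, hc₁.1]
  have k1' : 0 < 1 - Real.exp c₁ := by linarith [Real.exp_lt_exp.2 hc₁.2, Real.exp_zero]
  have k2' : 0 < Real.exp c₂ - 1 := by linarith [Real.add_one_le_exp c₂, hc₂.1]
  have k2 : Real.exp c₂ - 1 < R := by
    have := Real.add_one_le_exp (-c₂)
    rw [Real.exp_neg] at this
    have h3 := Real.exp_pos c₂
    have h4 : (1 - c₂) * Real.exp c₂ ≤ 1 := by
      calc (1 - c₂) * Real.exp c₂ ≤ (Real.exp c₂)⁻¹ * Real.exp c₂ := by gcongr; linarith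
        _ = 1 := inv_mul_cancel₀ h3.ne'
    nlinarith [hc₂.2]
  -- `Q₁` and `Q₂` are the limits over `c₁` and `c₂` of $\log(e^{x+i\sigma h}-1)$ as $h\to0^+$: seen
  -- from the side σ the arguments are $\sigma\pi$ and $0$.
  set Q₁ : ℂ := ((Real.log (1 - Real.exp c₁) : ℝ) : ℂ) + σ * Real.pi * I with hQ₁
  set Q₂ : ℂ := ((Real.log (Real.exp c₂ - 1) : ℝ) : ℂ) with hQ₂
  have Q₁re : Q₁.re = Real.log (1 - Real.exp c₁) := by simp [hQ₁]
  have Q₁im : Q₁.im = σ * Real.pi := by simp [hQ₁]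
  have Q₂re : Q₂.re = Real.log (Real.exp c₂ - 1) := by simp [hQ₂]
  have Q₂im : Q₂.im = 0 := by simp [hQ₂]
  have nQ₁ : ‖exp Q₁‖ = 1 - Real.exp c₁ := by rw [Complex.norm_exp, Q₁re, Real.exp_log k1']
  have nQ₂ : ‖exp Q₂‖ = Real.exp c₂ - 1 := by rw [Complex.norm_exp, Q₂re, Real.exp_log k2']
  obtain ⟨ρ', hρ'0, hρ'1, hρ'2, hρ'3⟩ : ∃ ρ', 0 < ρ' ∧ ρ' ≤ R ∧ ρ' ≤ 1 - Real.exp c₁ ∧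
      ρ' ≤ Real.exp c₂ - 1 :=
    ⟨min R (min (1 - Real.exp c₁) (Real.exp c₂ - 1)), lt_min hR0 (lt_min k1' k2'),
      min_le_left _ _, (min_le_right _ _).trans (min_le_left _ _),
      (min_le_right _ _).trans (min_le_right _ _)⟩
  set ρ := ρ' / Real.exp 2 with hρd
  have he2 := Real.exp_pos 2
  have hρ0 : 0 < ρ := by positivity
  have hρρ : ρ * Real.exp 2 = ρ' := div_mul_cancel₀ _ he2.ne'
  have hρ : ρ * Real.exp 2 ≤ R := hρρ.le.trans hρ'1
  -- `convBranch` runs from a point above `ω` to one below it. For $\sigma=-1$ the roles of `Q₁` and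
  -- `Q₂` are exchanged, which accounts for the factor σ in `Θ`.
  obtain ⟨P₁, P₂, hPP⟩ : ∃ P₁ P₂ : ℂ, (σ = 1 ∧ P₁ = Q₁ ∧ P₂ = Q₂) ∨
      (σ = -1 ∧ P₁ = Q₂ ∧ P₂ = Q₁) := by
    rcases hσ with h | h
    · exact ⟨Q₁, Q₂, Or.inl ⟨h, rfl, rfl⟩⟩
    · exact ⟨Q₂, Q₁, Or.inr ⟨h, rfl, rfl⟩⟩
  have hP : (ρ * Real.exp 2 ≤ ‖exp P₁‖ ∧ ‖exp P₁‖ < R) ∧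
      (ρ * Real.exp 2 ≤ ‖exp P₂‖ ∧ ‖exp P₂‖ < R) := by
    rw [hρρ]
    rcases hPP with ⟨_, rfl, rfl⟩ | ⟨_, rfl, rfl⟩ <;> rw [nQ₁, nQ₂]
    · exact ⟨⟨hρ'2, k1⟩, hρ'3, k2⟩
    · exact ⟨⟨hρ'3, k2⟩, hρ'2, k1⟩
  have hσσ : (σ : ℂ) * σ = 1 := by rcases hσ with rfl | rfl <;> norm_num
  refine ⟨ρ, hρ0, fun ω => σ * convBranch Φ Ψ P₁ P₂ ω, ?_, ?_, ?_, ?_⟩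
  · exact (differentiableOn_convBranch hR hr.le dΦ dΨ hρ hP.1.1 hP.1.2 hP.2.1 hP.2.2).const_mul _
  · intro M
    have h := (isSmallBranch_convBranch hR hr dΦ dΨ sΦ sΨ hρ0 hρ hP.1.1 hP.1.2 hP.2.1 hP.2.2
      M).const_mul (σ : ℂ)
    rw [mul_zero] at h
    exact h.congr fun ω => by ring
  · intro ω hω ω0 ωpi
    have hωR := norm_exp_lt_of_two hρ hω
    have hωpos : 0 < ‖exp ω‖ := norm_pos_iff.2 (Complex.exp_ne_zero ω)
    -- With this `B`, the condition $\operatorname{Re}x<B$ says exactly that $\omega+x$ lies over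
    -- the disc of radius `R`.
    obtain ⟨B, hB⟩ : ∃ B, ‖exp ω‖ * Real.exp B = R :=
      ⟨Real.log (R / ‖exp ω‖), by rw [Real.exp_log (by positivity)]; field_simp⟩
    have h2B : 2 < B := by
      refine Real.exp_lt_exp.1 ?_
      by_contra hcon
      have : R ≤ ‖exp ω‖ * Real.exp 2 := by
        rw [← hB]; exact mul_le_mul_of_nonneg_left (not_lt.1 hcon) hωpos.le
      nlinarith
    have hBre : ∀ P : ℂ, ‖exp P‖ < R → (P - ω).re < B := fun P h => by
      refine Real.exp_lt_exp.1 ?_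
      rw [← Complex.norm_exp, Complex.exp_sub, norm_div, div_lt_iff₀ hωpos]
      linarith
    obtain ⟨p, hp⟩ := exists_primitive_of_starConvex (isOpen_slitLeft B)
      (starConvex_slitLeft (by linarith)) (kernelLeft_differentiableOn hR hr.le dΦ dΨ hωR hB.le)
    have hK : (σ : ℂ) * convBranch Φ Ψ P₁ P₂ ω = p (Q₂ - ω) - p (Q₁ - ω) := by
      rw [convBranch_eq_sub hR hr.le dΦ dΨ hωR hB.le h2B.le hp]
      · rcases hPP with ⟨h, rfl, rfl⟩ | ⟨h, rfl, rfl⟩ <;> rw [h]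
        · simp
        · simp
      · refine ⟨hBre _ hP.1.2, ?_⟩
        rcases hPP with ⟨rfl, rfl, rfl⟩ | ⟨rfl, rfl, rfl⟩ <;> rw [sub_im] <;>
          simp only [Q₁im, Q₂im] <;> constructor <;> linarith
      · refine ⟨hBre _ hP.2.2, ?_⟩
        rcases hPP with ⟨rfl, rfl, rfl⟩ | ⟨rfl, rfl, rfl⟩ <;> rw [sub_im] <;>
          simp only [Q₁im, Q₂im] <;> constructor <;> linarith
    have hmem₁ : Q₁ - ω ∈ slitLeft B := by
      refine ⟨hBre _ (nQ₁ ▸ k1), ?_, Or.inr ?_⟩ <;> rw [sub_im, Q₁im]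
      · rw [abs_lt]; rcases hσ with rfl | rfl <;> constructor <;> linarith
      · rcases hσ with rfl | rfl <;> intro h <;> linarith
    have hmem₂ : Q₂ - ω ∈ slitLeft B := by
      refine ⟨hBre _ (nQ₂ ▸ k2), ?_, Or.inr ?_⟩ <;> rw [sub_im, Q₂im]
      · rw [abs_lt]; rcases hσ with rfl | rfl <;> constructor <;> linarith
      · rcases hσ with rfl | rfl <;> intro h <;> linarith
    have hev : ∀ᶠ h : ℝ in 𝓝[>] 0, IntervalIntegrable (fun x : ℝ =>
          F (α * exp ((x : ℂ) + (σ * h : ℝ) * I)) *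
            G (β * (1 + exp ω) * exp (-((x : ℂ) + (σ * h : ℝ) * I))))
          MeasureTheory.volume c₁ c₂ ∧
        ∫ x in c₁..c₂, F (α * exp ((x : ℂ) + (σ * h : ℝ) * I)) *
          G (β * (1 + exp ω) * exp (-((x : ℂ) + (σ * h : ℝ) * I))) =
        p (Complex.log (exp ((c₂ : ℂ) + (σ * h : ℝ) * I) - 1) - ω) -
        p (Complex.log (exp ((c₁ : ℂ) + (σ * h : ℝ) * I) - 1) - ω) := by
      filter_upwards [eventually_norm_exp_side_lt (σ := σ) k1 k2,
        eventually_sign_im_side_pos hσ ω0 ωpi, Ioo_mem_nhdsGT ω0] with h e1 e2 e3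
      have hcc : c₁ ≤ c₂ := by linarith [hc₁.2, hc₂.1]
      have key := fun x (hx : x ∈ Icc c₁ c₂) => convKernel_eq_of_side (F := F) (G := G) (α := α)
        (β := β) hσ hR hr.le eΦ eΨ hωR ω0 ωpi hB e3.1 e3.2 (e1 x hx) (e2 x)
      have hder : ∀ x ∈ Icc c₁ c₂, HasDerivAt (fun x : ℝ =>
          p (Complex.log (exp ((x : ℂ) + (σ * h : ℝ) * I) - 1) - ω))
          (F (α * exp ((x : ℂ) + (σ * h : ℝ) * I)) *
            G (β * (1 + exp ω) * exp (-((x : ℂ) + (σ * h : ℝ) * I)))) x := by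
        intro x hx
        obtain ⟨q1, q2, q3⟩ := key x hx
        have him := sign_im_exp_sub_one hσ (x := x) e3.1 (e3.2.trans ωpi)
        have hsl : exp ((x : ℂ) + (σ * h : ℝ) * I) - 1 ∈ slitPlane := Or.inr fun h' => by
          rw [h'] at him; simp at him
        have d1 : HasDerivAt (fun x : ℂ => exp (x + (σ * h : ℝ) * I) - 1)
            (exp ((x : ℂ) + (σ * h : ℝ) * I)) (x : ℂ) := by
          simpa using (((hasDerivAt_id (x : ℂ)).add_const _).cexp).sub_const 1
        have d2 := (d1.clog hsl).sub_const ω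
        have d3 := (hp _ q2).comp (x : ℂ) d2
        refine d3.comp_ofReal.congr_deriv ?_
        rw [add_sub_cancel]
        exact q3
      have hcont : ContinuousOn (fun x : ℝ => F (α * exp ((x : ℂ) + (σ * h : ℝ) * I)) *
            G (β * (1 + exp ω) * exp (-((x : ℂ) + (σ * h : ℝ) * I)))) (Icc c₁ c₂) := by
        have hc1 : ContinuousOn (fun x : ℝ => exp ((x : ℂ) + (σ * h : ℝ) * I)) (Icc c₁ c₂) := by
          fun_prop
        have hsl : ∀ x ∈ Icc c₁ c₂, exp ((x : ℂ) + (σ * h : ℝ) * I) - 1 ∈ slitPlane :=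
          fun x _ => Or.inr fun h' => by
            have him := sign_im_exp_sub_one hσ (x := x) e3.1 (e3.2.trans ωpi)
            rw [h'] at him; simp at him
        have hc2 : ContinuousOn (fun x : ℝ =>
            Complex.log (exp ((x : ℂ) + (σ * h : ℝ) * I) - 1) - ω) (Icc c₁ c₂) :=
          ((hc1.sub continuousOn_const).clog hsl).sub continuousOn_const
        have hc3 := (kernelLeft_differentiableOn hR hr.le dΦ dΨ hωR hB.le).continuousOn.comp hc2
          fun x hx => (key x hx).2.1
        refine (hc3.mul (hc1.div (hc1.sub continuousOn_const)
          fun x hx => slitPlane_ne_zero (hsl x hx))).congr fun x hx => ?_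
        have := (key x hx).2.2
        simp only [Pi.mul_apply, Function.comp_apply, add_sub_cancel]
        exact this.symm
      have hint := hcont.intervalIntegrable_of_Icc hcc (μ := MeasureTheory.volume)
      refine ⟨hint, intervalIntegral.integral_eq_sub_of_hasDerivAt (f := fun x : ℝ =>
          p (Complex.log (exp ((x : ℂ) + (σ * h : ℝ) * I) - 1) - ω)) (fun x hx => ?_) hint⟩
      exact hder x (by rwa [uIcc_of_le hcc] at hx)
    refine ⟨hev.mono fun _ h => h.1, ?_⟩
    simp only [hK]
    refine Tendsto.congr' (hev.mono fun _ h => h.2.symm) ?_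
    have t2 := ((hp _ hmem₂).continuousAt.tendsto).comp
      ((tendsto_log_side_pos σ hc₂.1).sub_const ω)
    have t1 := ((hp _ hmem₁).continuousAt.tendsto).comp
      ((tendsto_log_side_neg hσ hc₁.2).sub_const ω)
    exact t2.sub t1
  · intro ω hω
    have h := hasConvolutionIntegral_convBranch hR hr.le dΦ dΨ sΦ sΨ hρ hP.1.1 hP.1.2 hP.2.1
      hP.2.2 hω
    convert h using 1
    linear_combination -(convBranch Φ Ψ P₁ P₂ (ω + 2 * Real.pi * I) -
      convBranch Φ Ψ P₁ P₂ ω) * hσσ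

end

noncomputable section

/-! ### Star domains -/

section StarDomain

variable {A : Set ℂ}

theorem mem_starDomain_iff (h0 : (0 : ℂ) ∉ A) {z : ℂ} :
    z ∈ starDomain A ↔ ∀ α ∈ A, ¬((z / α).im = 0 ∧ 1 ≤ (z / α).re) := by
  constructor
  · rintro h α hα ⟨h1, h2⟩
    refine h α hα (z / α).re h2 ?_
    have hα0 : α ≠ 0 := fun h => h0 (h ▸ hα)
    have : ((z / α).re : ℂ) = z / α := Complex.ext (by simp) (by simp [h1])
    rw [this, div_mul_cancel₀ _ hα0]
  · rintro h α hα t ht rfl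
    have hα0 : α ≠ 0 := fun h => h0 (h ▸ hα)
    refine h α hα ?_
    rw [mul_div_cancel_right₀ _ hα0]
    exact ⟨by simp, by simpa using ht⟩

theorem zero_mem_starDomain (h0 : (0 : ℂ) ∉ A) : (0 : ℂ) ∈ starDomain A :=
  (mem_starDomain_iff h0).2 fun α _ h => by
    have := h.2
    norm_num at this

theorem smul_mem_starDomain (h0 : (0 : ℂ) ∉ A) {z : ℂ} (hz : z ∈ starDomain A) {s : ℝ} (hs : 0 ≤ s)
    (hs1 : s ≤ 1) : (s : ℂ) * z ∈ starDomain A := by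
  rw [mem_starDomain_iff h0] at *
  rintro α hα ⟨h1, h2⟩
  refine hz α hα ?_
  rw [mul_div_assoc] at h1 h2
  simp only [im_ofReal_mul, re_ofReal_mul] at h1 h2
  have hs0 : s ≠ 0 := by rintro rfl; norm_num at h2
  refine ⟨(mul_eq_zero.1 h1).resolve_left hs0, ?_⟩
  by_contra hcon
  rcases le_or_gt 0 (z / α).re with h | h <;> nlinarith [not_le.1 hcon]

/-- Near `z` only the cuts starting in a fixed closed ball matter, and these are finitely many
closed sets. -/
theorem isOpen_starDomain (h0 : (0 : ℂ) ∉ A) (hfin : ∀ R : ℝ, (A ∩ Metric.closedBall 0 R).Finite) :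
    IsOpen (starDomain A) := by
  rw [isOpen_iff_mem_nhds]
  intro z hz
  have h1 : ∀ᶠ w in 𝓝 z, ∀ α ∈ A ∩ Metric.closedBall 0 (‖z‖ + 1),
      ¬((w / α).im = 0 ∧ 1 ≤ (w / α).re) := by
    rw [eventually_all_finite (hfin _)]
    intro α hα
    have hcl : IsClosed {w : ℂ | (w / α).im = 0 ∧ 1 ≤ (w / α).re} := by
      have hc : Continuous fun w : ℂ => w / α := continuous_id.div_const α
      exact (isClosed_eq (continuous_im.comp hc) continuous_const).inter
        (isClosed_le continuous_const (continuous_re.comp hc))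
    exact hcl.isOpen_compl.mem_nhds ((mem_starDomain_iff h0).1 hz α hα.1)
  have h2 : ∀ᶠ w in 𝓝 z, ‖w‖ < ‖z‖ + 1 :=
    continuous_norm.continuousAt.eventually_lt_const (by linarith)
  filter_upwards [h1, h2] with w hw1 hw2
  rw [mem_starDomain_iff h0]
  intro α hα h
  refine hw1 α ⟨hα, ?_⟩ h
  rw [mem_closedBall_zero_iff]
  have hα0 : 0 < ‖α‖ := norm_pos_iff.2 fun h => h0 (h ▸ hα)
  have h3 : 1 ≤ ‖w / α‖ := h.2.trans (Complex.re_le_norm _)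
  rw [norm_div, le_div_iff₀ hα0] at h3
  linarith

theorem exists_ball_subset_starDomain (h0 : (0 : ℂ) ∉ A)
    (hfin : ∀ R : ℝ, (A ∩ Metric.closedBall 0 R).Finite) :
    ∃ r > 0, ∀ z : ℂ, ‖z‖ < r → z ∈ starDomain A := by
  obtain ⟨r, hr, h⟩ := Metric.isOpen_iff.1 (isOpen_starDomain h0 hfin) 0 (zero_mem_starDomain h0)
  exact ⟨r, hr, fun z hz => h (by simpa using hz)⟩

/-- Apart from its axis, a thin truncated sector lies in the star domain. -/
theorem exists_sector_subset_starDomain (h0 : (0 : ℂ) ∉ A)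
    (hfin : ∀ R : ℝ, (A ∩ Metric.closedBall 0 R).Finite) {q : ℂ} (hq : q ≠ 0) (R : ℝ) :
    ∃ η > 0, ∀ υ : ℂ, υ.im ≠ 0 → |υ.im| < η → υ.re < R → q * exp υ ∈ starDomain A := by
  have hpi := Real.pi_pos
  have h1 : ∀ᶠ η : ℝ in 𝓝[>] 0, ∀ α ∈ A ∩ Metric.closedBall 0 (‖q‖ * Real.exp R),
      ∀ υ : ℂ, υ.im ≠ 0 → |υ.im| < η → ∀ t : ℝ, 1 ≤ t → q * exp υ ≠ t * α := by
    rw [eventually_all_finite (hfin _)]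
    intro α hα
    have hα0 : α ≠ 0 := fun h => h0 (h ▸ hα.1)
    -- A point $qe^\upsilon=t\alpha$ forces $\operatorname{Im}\upsilon=-\arg(q/\alpha)$. The width
    -- is taken below this argument when it is not zero, and below π so that the principal logarithm
    -- applies.
    have hpos : 0 < if (Complex.log (q / α)).im = 0 then Real.pi
        else min Real.pi |(Complex.log (q / α)).im| := by
      split_ifs with h
      · exact hpi
      · exact lt_min hpi (abs_pos.2 h)
    filter_upwards [Ioo_mem_nhdsGT hpos] with η hη υ hυ0 hυ t ht heq
    have hηpi : η < Real.pi := by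
      refine hη.2.trans_le ?_
      split_ifs with h
      · exact le_rfl
      · exact min_le_left _ _
    have ht0 : 0 < t := by linarith
    have h2 : q / α = exp ((Real.log t : ℝ) - υ) := by
      rw [Complex.exp_sub, ← ofReal_exp, Real.exp_log ht0, div_eq_div_iff hα0 (Complex.exp_ne_zero _),
        heq]
    have him : ((Real.log t : ℝ) - υ).im = -υ.im := by simp
    have hυ' := abs_lt.1 hυ
    have h3 : (Complex.log (q / α)).im = -υ.im := by
      rw [h2, Complex.log_exp] <;> rw [him] <;> linarith [hυ'.1, hυ'.2]
    have h4 := hη.2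
    rw [if_neg (by rw [h3]; simpa using hυ0), h3, abs_neg] at h4
    have := (lt_min_iff.1 h4).2
    linarith
  obtain ⟨η, hη, hη0⟩ := (h1.and self_mem_nhdsWithin).exists
  refine ⟨η, hη0, fun υ hυ0 hυ hR α hα t ht heq => hη α ⟨hα, ?_⟩ υ hυ0 hυ t ht heq⟩
  rw [mem_closedBall_zero_iff]
  have h2 := congrArg norm heq
  rw [norm_mul, norm_mul, Complex.norm_exp, Complex.norm_real, Real.norm_of_nonneg (by linarith)]
    at h2
  have h3 : ‖q‖ * Real.exp υ.re ≤ ‖q‖ * Real.exp R := by gcongr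
  nlinarith [norm_nonneg α]

end StarDomain

/-! ### Local branches -/

section LocalBranch

theorem sign_im_exp_pos {σ : ℝ} (hσ : σ = 1 ∨ σ = -1) {ω : ℂ} (h0 : 0 < σ * ω.im)
    (h1 : σ * ω.im < Real.pi) : 0 < σ * (exp ω).im := by
  rw [Complex.exp_im, mul_left_comm]
  refine mul_pos (Real.exp_pos _) ?_
  have h2 := Real.sin_pos_of_pos_of_lt_pi h0 h1
  rcases hσ with rfl | rfl
  · simpa using h2
  · simpa using h2

theorem tendsto_exp_stripAtBot (M : ℝ) : Tendsto exp (stripAtBot M) (𝓝 0) :=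
  tendsto_zero_iff_norm_tendsto_zero.2 (by
    simpa [Complex.norm_exp, Function.comp_def] using
      Real.tendsto_exp_atBot.comp (tendsto_re_stripAtBot M))

theorem isSmallBranch_comp_exp {Q : ℂ → ℂ} (hQ : ContinuousAt Q 0) :
    IsSmallBranch fun w => Q (exp w) := fun M => by
  have h := (tendsto_exp_stripAtBot M).mul (hQ.tendsto.comp (tendsto_exp_stripAtBot M))
  rwa [zero_mul] at h

variable {F : ℂ → ℂ} {A : Set ℂ} {σ : ℝ} {α : ℂ}

/-- Every point other than `0` carries an integrable local branch, without variation if the point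
is regular. -/
theorem exists_small_localBranch (hσ : σ = 1 ∨ σ = -1) (hFA : HasIsolatedSingularities F A)
    (hint : ∀ α ∈ A, IsIntegrableSingularity F α) (hα : α ≠ 0) :
    ∃ Φ : ℂ → ℂ, IsLocalBranch F σ α Φ ∧ IsSmallBranch Φ ∧
      (α ∉ A → ∀ w, monodromyDelta Φ w = 0) := by
  by_cases hαA : α ∈ A
  · obtain ⟨Φ, h1, h2⟩ := hint α hαA σ hσ
    refine ⟨Φ, h1, fun M => ?_, fun h => absurd hαA h⟩
    have h3 := (h2 M).const_mul α⁻¹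
    rw [mul_zero] at h3
    refine h3.congr fun w => ?_
    field_simp
    ring
  · obtain ⟨r, hr, Q, dQ, eQ⟩ := hFA.regular σ hσ α hαA
    have hα0 : 0 < ‖α‖ := norm_pos_iff.2 hα
    have hmem : ∀ w : ℂ, ‖exp w‖ < r / ‖α‖ → α * (1 + exp w) ∈ Metric.ball α r := fun w hw => by
      rw [Metric.mem_ball, dist_eq_norm, show α * (1 + exp w) - α = α * exp w by ring, norm_mul]
      rw [lt_div_iff₀ hα0] at hw
      linarith
    refine ⟨fun w => Q (α * (1 + exp w)), ⟨r / ‖α‖, by positivity, ?_, ?_⟩, ?_, ?_⟩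
    · exact dQ.comp (by fun_prop) fun w hw => hmem w hw
    · intro w hw h0 h1
      refine eQ _ (hmem w hw) ?_
      rw [mul_div_cancel_left₀ _ hα, add_im, one_im, zero_add]
      exact sign_im_exp_pos hσ h0 h1
    · refine isSmallBranch_comp_exp (Q := fun x => Q (α * (1 + x))) ?_
      have h1 : ContinuousAt Q (α * (1 + 0)) := by
        rw [add_zero, mul_one]
        exact (dQ.differentiableAt (Metric.ball_mem_nhds α hr)).continuousAt
      exact ContinuousAt.comp (f := fun x : ℂ => α * (1 + x)) h1 (by fun_prop)
    · intro _ w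
      rw [monodromyDelta, monodromyShift, Complex.exp_periodic w, sub_self]

/-- The identity theorem on a half-plane: both branches equal `F` on the strip
$0<\sigma\operatorname{Im}w<\pi$. This frees the final formula from the choice of local branches. -/
theorem IsLocalBranch.eqOn {Φ Φ' : ℂ → ℂ} (hσ : σ = 1 ∨ σ = -1) (h : IsLocalBranch F σ α Φ)
    (h' : IsLocalBranch F σ α Φ') : ∃ r > 0, ∀ w : ℂ, ‖exp w‖ < r → Φ w = Φ' w := by
  obtain ⟨r₁, hr₁, d₁, e₁⟩ := h
  obtain ⟨r₂, hr₂, d₂, e₂⟩ := h'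
  have hr : 0 < min r₁ r₂ := lt_min hr₁ hr₂
  refine ⟨min r₁ r₂, hr, ?_⟩
  have hU : IsOpen {w : ℂ | ‖exp w‖ < min r₁ r₂} := isOpen_norm_exp_lt _
  have hc : IsPreconnected {w : ℂ | ‖exp w‖ < min r₁ r₂} := (convex_norm_exp_lt _).isPreconnected
  have hpi := Real.pi_pos
  have a₁ : AnalyticOnNhd ℂ Φ {w : ℂ | ‖exp w‖ < min r₁ r₂} :=
    DifferentiableOn.analyticOnNhd
      (d₁.mono fun w (hw : ‖exp w‖ < _) => lt_of_lt_of_le hw (min_le_left _ _)) hU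
  have a₂ : AnalyticOnNhd ℂ Φ' {w : ℂ | ‖exp w‖ < min r₁ r₂} :=
    DifferentiableOn.analyticOnNhd
      (d₂.mono fun w (hw : ‖exp w‖ < _) => lt_of_lt_of_le hw (min_le_right _ _)) hU
  set w₀ : ℂ := ((Real.log (min r₁ r₂) - 1 : ℝ) : ℂ) + σ * (Real.pi / 2) * I with hw₀
  have him : σ * w₀.im = Real.pi / 2 := by
    rcases hσ with rfl | rfl <;> simp [hw₀]
  have hw₀m : ‖exp w₀‖ < min r₁ r₂ := by
    rw [Complex.norm_exp, ← Real.lt_log_iff_exp_lt hr]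
    simp [hw₀]
  have hev : Φ =ᶠ[𝓝 w₀] Φ' := by
    have h1 : ∀ᶠ w : ℂ in 𝓝 w₀, 0 < σ * w.im :=
      (continuous_const.mul continuous_im).continuousAt.eventually_const_lt (by
        change 0 < σ * w₀.im
        rw [him]; positivity)
    have h2 : ∀ᶠ w : ℂ in 𝓝 w₀, σ * w.im < Real.pi :=
      (continuous_const.mul continuous_im).continuousAt.eventually_lt_const (by
        change σ * w₀.im < Real.pi
        rw [him]; linarith)
    filter_upwards [h1, h2, hU.mem_nhds hw₀m] with w k1 k2 k3
    rw [e₁ w (lt_of_lt_of_le k3 (min_le_left _ _)) k1 k2,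
      e₂ w (lt_of_lt_of_le k3 (min_le_right _ _)) k1 k2]
  exact fun w hw => a₁.eqOn_of_preconnected_of_eventuallyEq a₂ hc hw₀m hev hw

theorem monodromyShift_iterate (Φ : ℂ → ℂ) (k : ℕ) (w : ℂ) :
    (monodromyShift^[k] Φ) w = Φ (w + k * (2 * Real.pi * I)) := by
  induction k generalizing w with
  | zero => simp
  | succ k ih =>
    rw [Function.iterate_succ_apply', monodromyShift, ih]
    push_cast
    ring_nf

end LocalBranch

/-! ### Convolution integrals -/

section ConvolutionIntegral

theorem HasConvolutionIntegral.unique {φ ψ : ℂ → ℂ} {w L L' : ℂ}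
    (h : HasConvolutionIntegral φ ψ w L) (h' : HasConvolutionIntegral φ ψ w L') : L = L' :=
  tendsto_nhds_unique h h'

theorem hasConvolutionIntegral_of_mul_eq_zero {φ ψ : ℂ → ℂ} (h : ∀ x y, φ x * ψ y = 0) (w : ℂ) :
    HasConvolutionIntegral φ ψ w 0 := by
  simp [HasConvolutionIntegral, h]

/-- Besides $e^w$, the integral sees the two factors only over the disc of radius $2|e^w|$: for
$|e^w|<1/2$ the denominator $1+se^w$ has modulus above $1/2$. Used to move between sheets and
between choices of branches. -/
theorem HasConvolutionIntegral.congr {φ ψ φ' ψ' : ℂ → ℂ} {w w' L : ℂ} {r : ℝ}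
    (h : HasConvolutionIntegral φ ψ w L) (hw : exp w' = exp w) (hw4 : ‖exp w‖ < 1 / 2)
    (hwr : 2 * ‖exp w‖ ≤ r)
    (hφ : ∀ x : ℂ, ‖exp (w + x)‖ < r → φ' (w' + x) = φ (w + x))
    (hψ : ∀ x : ℂ, ‖exp (w + x)‖ < r → ψ' (w' + x) = ψ (w + x)) :
    HasConvolutionIntegral φ' ψ' w' L := by
  refine Tendsto.congr' ?_ h
  have h1 : ∀ᶠ ε : ℝ × ℝ in 𝓝[>] (0 : ℝ) ×ˢ 𝓝[>] (0 : ℝ),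
      ε.1 ∈ Ioo (0 : ℝ) (1 / 2) ∧ ε.2 ∈ Ioo (0 : ℝ) (1 / 2) :=
    Filter.Eventually.prod_mk (Ioo_mem_nhdsGT (by norm_num)) (Ioo_mem_nhdsGT (by norm_num))
  filter_upwards [h1] with ε hε
  refine intervalIntegral.integral_congr fun s hs => ?_
  rw [uIcc_of_le (by linarith [hε.1.2, hε.2.2])] at hs
  have hs0 : 0 < s := lt_of_lt_of_le hε.1.1 hs.1
  have hs1 : 0 < 1 - s := by linarith [hs.2, hε.2.1]
  have hw0 : 0 < ‖exp w‖ := norm_pos_iff.2 (Complex.exp_ne_zero w)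
  have e1 : φ' (w' + (Real.log s : ℂ)) = φ (w + (Real.log s : ℂ)) := by
    refine hφ _ ?_
    rw [Complex.exp_add, ← ofReal_exp, Real.exp_log hs0, norm_mul, Complex.norm_real,
      Real.norm_of_nonneg hs0.le]
    nlinarith
  have hden : 1 / 2 < ‖1 + (s : ℂ) * exp w‖ := by
    have h2 := norm_sub_le (1 + (s : ℂ) * exp w) ((s : ℂ) * exp w)
    rw [add_sub_cancel_right, norm_one, norm_mul, Complex.norm_real,
      Real.norm_of_nonneg hs0.le] at h2
    nlinarith
  have e2 : ψ' (w' + ((Real.log (1 - s) : ℂ) - Complex.log (1 + (s : ℂ) * exp w))) =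
      ψ (w + ((Real.log (1 - s) : ℂ) - Complex.log (1 + (s : ℂ) * exp w))) := by
    refine hψ _ ?_
    have hne : 1 + (s : ℂ) * exp w ≠ 0 := norm_pos_iff.1 (by linarith)
    rw [Complex.exp_add, Complex.exp_sub, Complex.exp_log hne, ← ofReal_exp, Real.exp_log hs1,
      norm_mul, norm_div, Complex.norm_real, Real.norm_of_nonneg hs1.le]
    refine lt_of_lt_of_le ?_ hwr
    rw [mul_comm]
    refine mul_lt_mul_of_pos_right ?_ hw0
    rw [div_lt_iff₀ (by linarith)]
    linarith
  simp only [← add_sub_assoc] at e2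
  simp only [hw, e1, e2]

end ConvolutionIntegral

end

noncomputable section

/-! ### Functions with a pinch -/

/-- In terms of `υ`, where `z = p * exp υ`, the values determined by `L` for `υ` close to `0` on the
side `σ` are those of an integrable multivalued function, whose variation is `D`. -/
def IsPinch (σ : ℝ) (L : ℂ → ℂ → Prop) (D : ℂ → ℂ) : Prop :=
  ∃ ρ > 0, ∃ Θ : ℂ → ℂ, DifferentiableOn ℂ Θ {w | ‖exp w‖ < ρ} ∧ IsSmallBranch Θ ∧
    (∀ ω : ℂ, ‖exp ω‖ < ρ → 0 < σ * ω.im → σ * ω.im < Real.pi →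
      L (Complex.log (1 + exp ω)) (Θ ω)) ∧
    ∀ ω : ℂ, ‖exp ω‖ < ρ → Θ (ω + 2 * Real.pi * I) - Θ ω = D ω

section Pinch

variable {σ : ℝ} {L L₁ L₂ : ℂ → ℂ → Prop} {D D₁ D₂ : ℂ → ℂ}

theorem exists_norm_log_one_add_exp_lt {η : ℝ} (hη : 0 < η) :
    ∃ ρ > 0, ρ ≤ 1 / 4 ∧ ∀ ω : ℂ, ‖exp ω‖ < ρ → ‖Complex.log (1 + exp ω)‖ < η := by
  have hc : ContinuousAt (fun x : ℂ => Complex.log (1 + x)) 0 :=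
    ContinuousAt.clog (by fun_prop) (by simp)
  have h := Metric.continuousAt_iff.1 hc η hη
  obtain ⟨ρ, hρ, h⟩ := h
  refine ⟨min ρ (1 / 4), lt_min hρ (by norm_num), min_le_right _ _, fun ω hω => ?_⟩
  have := h (x := exp ω) (by simpa using hω.trans_le (min_le_left _ _))
  simpa using this

theorem sign_im_log_one_add_exp (hσ : σ = 1 ∨ σ = -1) {ω : ℂ} (h0 : 0 < σ * ω.im)
    (h1 : σ * ω.im < Real.pi) : 0 < σ * (Complex.log (1 + exp ω)).im := by
  refine (sign_im_log hσ ?_).1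
  rw [add_im, one_im, zero_add]
  exact sign_im_exp_pos hσ h0 h1

/-- The values are carried by a relation because a side integral is known only as a limit; this
lemma passes from one description of the values to another valid near $\upsilon=0$. -/
theorem IsPinch.mono (hσ : σ = 1 ∨ σ = -1) (h : IsPinch σ L₁ D) {η : ℝ} (hη : 0 < η)
    (hL : ∀ υ c, ‖υ‖ < η → 0 < σ * υ.im → L₁ υ c → L υ c) : IsPinch σ L D := by
  obtain ⟨ρ, hρ, Θ, h1, h2, h3, h4⟩ := h
  obtain ⟨ρ', hρ', _, h5⟩ := exists_norm_log_one_add_exp_lt hη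
  refine ⟨min ρ ρ', lt_min hρ hρ', Θ, h1.mono fun w (hw : ‖exp w‖ < _) => lt_of_lt_of_le hw (min_le_left _ _), h2,
    fun ω hω h0 hpi => ?_, fun ω hω => h4 ω (hω.trans_le (min_le_left _ _))⟩
  exact hL _ _ (h5 ω (hω.trans_le (min_le_right _ _))) (sign_im_log_one_add_exp hσ h0 hpi)
    (h3 ω (hω.trans_le (min_le_left _ _)) h0 hpi)

theorem IsPinch.congr_variation (h : IsPinch σ L D₁) (hD : ∀ ω, D₁ ω = D₂ ω) : IsPinch σ L D₂ := by
  rwa [← show D₁ = D₂ from funext hD]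

theorem IsPinch.add (h₁ : IsPinch σ L₁ D₁) (h₂ : IsPinch σ L₂ D₂)
    (hL : ∀ υ c₁ c₂, L₁ υ c₁ → L₂ υ c₂ → L υ (c₁ + c₂)) : IsPinch σ L (fun ω => D₁ ω + D₂ ω) := by
  obtain ⟨ρ₁, hρ₁, Θ₁, a1, a2, a3, a4⟩ := h₁
  obtain ⟨ρ₂, hρ₂, Θ₂, b1, b2, b3, b4⟩ := h₂
  have l1 : ∀ {w : ℂ}, ‖exp w‖ < min ρ₁ ρ₂ → ‖exp w‖ < ρ₁ := fun h => h.trans_le (min_le_left _ _)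
  have l2 : ∀ {w : ℂ}, ‖exp w‖ < min ρ₁ ρ₂ → ‖exp w‖ < ρ₂ := fun h => h.trans_le (min_le_right _ _)
  refine ⟨min ρ₁ ρ₂, lt_min hρ₁ hρ₂, fun w => Θ₁ w + Θ₂ w,
    (a1.mono fun w hw => l1 hw).add (b1.mono fun w hw => l2 hw), fun M => ?_,
    fun ω hω h0 hpi => hL _ _ _ (a3 ω (l1 hω) h0 hpi) (b3 ω (l2 hω) h0 hpi), fun ω hω => ?_⟩
  · have := (a2 M).add (b2 M)
    rw [add_zero] at this
    exact this.congr fun w => by ring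
  · beta_reduce
    rw [← a4 ω (l1 hω), ← b4 ω (l2 hω)]; ring

/-- A holomorphic function of $\upsilon=\log(1+e^\omega)$ near $0$ is $2\pi i$-periodic in `ω`,
hence without variation: regular terms may be added freely. -/
theorem isPinch_of_differentiableOn {W : ℂ → ℂ} {η : ℝ} (hη : 0 < η)
    (hW : DifferentiableOn ℂ W (Metric.ball 0 η)) : IsPinch σ (fun υ c => c = W υ) fun _ => 0 := by
  obtain ⟨ρ, hρ, hρ4, h⟩ := exists_norm_log_one_add_exp_lt hη
  refine ⟨ρ, hρ, fun ω => W (Complex.log (1 + exp ω)), ?_, ?_, fun _ _ _ _ => rfl, fun ω _ => ?_⟩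
  · refine hW.comp (fun w hw => ?_) fun w hw => by simpa using h w hw
    exact (((Complex.differentiable_exp w).const_add 1).clog
      (one_add_exp_mem_slitPlane hρ4 hw)).differentiableWithinAt
  · refine isSmallBranch_comp_exp (Q := fun x => W (Complex.log (1 + x))) ?_
    refine ContinuousAt.comp (g := W) (f := fun x : ℂ => Complex.log (1 + x)) ?_
      (ContinuousAt.clog (by fun_prop) (by simp))
    simpa using (hW.differentiableAt (Metric.ball_mem_nhds 0 hη)).continuousAt
  · beta_reduce
    rw [Complex.exp_periodic ω, sub_self]

end Pinch

/-! ### Integrals along segments -/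

section Segments

variable {f g E : ℂ → ℂ} {K : Set ℂ} {a b c : ℂ}

theorem segInt_add (hK : IsOpen K) (hc : Convex ℝ K) (hE : DifferentiableOn ℂ E K) (ha : a ∈ K)
    (hb : b ∈ K) (hcK : c ∈ K) : segInt E a b + segInt E b c = segInt E a c := by
  obtain ⟨P, hP⟩ := exists_primitive_of_convex hK hc hE
  rw [segInt_eq_sub hP hE (hc.segment_subset ha hb), segInt_eq_sub hP hE (hc.segment_subset hb hcK),
    segInt_eq_sub hP hE (hc.segment_subset ha hcK)]
  ring

theorem segInt_congr (h : ∀ y ∈ segment ℝ a b, f y = g y) : segInt f a b = segInt g a b := by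
  rw [segInt, segInt]
  refine intervalIntegral.integral_congr fun t ht => ?_
  rw [uIcc_of_le zero_le_one] at ht
  simp only [h _ (mem_segment_param a b ht)]

theorem tendsto_segInt_right (hK : IsOpen K) (hc : Convex ℝ K) (hE : DifferentiableOn ℂ E K)
    (ha : a ∈ K) (hb : b ∈ K) {l : Filter ℝ} {x : ℝ → ℂ} (hx : Tendsto x l (𝓝 b)) :
    Tendsto (fun h => segInt E a (x h)) l (𝓝 (segInt E a b)) := by
  obtain ⟨P, hP⟩ := exists_primitive_of_convex hK hc hE
  rw [segInt_eq_sub hP hE (hc.segment_subset ha hb)]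
  refine ((((hP b hb).continuousAt.tendsto).comp hx).sub_const _).congr' ?_
  filter_upwards [hx.eventually (hK.mem_nhds hb)] with h hh
  rw [segInt_eq_sub hP hE (hc.segment_subset ha hh)]
  rfl

theorem segInt_horizontal (E : ℂ → ℂ) (x₁ x₂ : ℝ) (c : ℂ) :
    segInt E (x₁ + c) (x₂ + c) = ∫ x in x₁..x₂, E (x + c) := by
  have h := intervalIntegral.smul_integral_comp_add_mul (a := 0) (b := 1)
    (fun x : ℝ => E ((x : ℂ) + c)) (x₂ - x₁) x₁
  rw [mul_zero, add_zero, mul_one, add_sub_cancel] at h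
  rw [← h, segInt, ← intervalIntegral.integral_smul]
  refine intervalIntegral.integral_congr fun t _ => ?_
  simp only [real_smul]
  push_cast
  rw [mul_comm]
  ring_nf

theorem segInt_translate (E : ℂ → ℂ) (c a b : ℂ) :
    segInt E (c + a) (c + b) = segInt (fun y => E (c + y)) a b := by
  rw [segInt, segInt]
  refine intervalIntegral.integral_congr fun t _ => ?_
  rw [add_sub_add_left_eq_sub, add_assoc]

end Segments

/-! ### Two factors with opposed singularities on the real axis -/

/-- A truncated strip, cut along the real axis from `a` on. -/
def slitStrip (δ a b : ℝ) : Set ℂ := {y | |y.im| < δ ∧ y.re < b ∧ (y.re < a ∨ y.im ≠ 0)}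

theorem isOpen_slitStrip (δ a b : ℝ) : IsOpen (slitStrip δ a b) :=
  IsOpen.and (isOpen_lt continuous_im.abs continuous_const)
    (IsOpen.and (isOpen_lt continuous_re continuous_const)
      ((isOpen_lt continuous_re continuous_const).union
        (isOpen_ne_fun continuous_im continuous_const)))

/-- The integrand of the multiplicative convolution in logarithmic coordinates. -/
def pairKernel (f g : ℂ → ℂ) (υ y : ℂ) : ℂ := f y * g (υ - y)

/-- A convex region for the variable of integration, with conditions on both factors. -/
def pairBox (σ l₁ u₁ r₁ l₂ u₂ r₂ : ℝ) (υ : ℂ) : Set ℂ :=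
  {y | (l₁ < σ * y.im ∧ σ * y.im < u₁ ∧ y.re < r₁) ∧
    (l₂ < σ * (υ - y).im ∧ σ * (υ - y).im < u₂ ∧ (υ - y).re < r₂)}

/-- The part of a truncated strip on one side of the real axis. -/
def sideSector (σ η : ℝ) : Set ℂ := {υ | 0 < σ * υ.im ∧ σ * υ.im < η ∧ υ.re < η}

section Box

variable {σ δ l₁ u₁ r₁ l₂ u₂ r₂ a₁ b₁ a₂ b₂ : ℝ} {υ : ℂ} {f g : ℂ → ℂ}

theorem isOpen_sideSector (σ η : ℝ) : IsOpen (sideSector σ η) :=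
  IsOpen.and (isOpen_lt continuous_const (continuous_const.mul continuous_im))
    (IsOpen.and (isOpen_lt (continuous_const.mul continuous_im) continuous_const)
      (isOpen_lt continuous_re continuous_const))

theorem convex_sideSector (σ η : ℝ) : Convex ℝ (sideSector σ η) := by
  intro x hx y hy s t hs ht hst
  simp only [sideSector, mem_ofPred_eq, add_im, add_re, smul_im, smul_re, smul_eq_mul] at *
  have key : ∀ p q c d : ℝ, (p < c) → (q < d) → s * p + t * q < s * c + t * d := by
    intro p q c d h1 h2
    rcases hs.eq_or_lt with rfl | hs0
    · have : t = 1 := by linarith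
      subst this; linarith
    · nlinarith
  refine ⟨?_, ?_, ?_⟩
  · have := key _ _ _ _ hx.1 hy.1
    linarith
  · have := key _ _ _ _ hx.2.1 hy.2.1
    have e : s * η + t * η = η := by rw [← add_mul, hst, one_mul]
    linarith
  · have := key _ _ _ _ hx.2.2 hy.2.2
    have e : s * η + t * η = η := by rw [← add_mul, hst, one_mul]
    linarith

theorem isOpen_pairBox : IsOpen (pairBox σ l₁ u₁ r₁ l₂ u₂ r₂ υ) := by
  refine IsOpen.and (IsOpen.and ?_ (IsOpen.and ?_ ?_)) (IsOpen.and ?_ (IsOpen.and ?_ ?_))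
  · exact isOpen_lt continuous_const (continuous_const.mul continuous_im)
  · exact isOpen_lt (continuous_const.mul continuous_im) continuous_const
  · exact isOpen_lt continuous_re continuous_const
  · exact isOpen_lt continuous_const (continuous_const.mul (continuous_im.comp (by fun_prop)))
  · exact isOpen_lt (continuous_const.mul (continuous_im.comp (by fun_prop))) continuous_const
  · exact isOpen_lt (continuous_re.comp (by fun_prop)) continuous_const

theorem convex_pairBox : Convex ℝ (pairBox σ l₁ u₁ r₁ l₂ u₂ r₂ υ) := by
  intro x hx y hy s t hs ht hst
  simp only [pairBox, mem_ofPred_eq, add_im, add_re, sub_im, sub_re, smul_im, smul_re,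
    smul_eq_mul] at *
  have key : ∀ p q c : ℝ, p < c → q < c → s * p + t * q < c := by
    intro p q c h1 h2
    have e : s * c + t * c = c := by rw [← add_mul, hst, one_mul]
    rcases hs.eq_or_lt with rfl | hs0
    · have : t = 1 := by linarith
      subst this; linarith
    · nlinarith
  have key' : ∀ p q c : ℝ, c < p → c < q → c < s * p + t * q := by
    intro p q c h1 h2
    have := key (-p) (-q) (-c) (by linarith) (by linarith)
    linarith
  have e1 : s * υ.im + t * υ.im = υ.im := by rw [← add_mul, hst, one_mul]
  have e2 : s * υ.re + t * υ.re = υ.re := by rw [← add_mul, hst, one_mul]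
  obtain ⟨⟨p1, p2, p3⟩, p4, p5, p6⟩ := hx
  obtain ⟨⟨q1, q2, q3⟩, q4, q5, q6⟩ := hy
  refine ⟨⟨?_, ?_, ?_⟩, ?_, ?_, ?_⟩
  · have := key' _ _ _ p1 q1
    linarith
  · have := key _ _ _ p2 q2
    linarith
  · exact key _ _ _ p3 q3
  · have := key' _ _ _ p4 q4
    have e3 : s * (σ * (υ.im - x.im)) + t * (σ * (υ.im - y.im)) =
      σ * (υ.im - (s * x.im + t * y.im)) := by linear_combination σ * e1
    linarith
  · have := key _ _ _ p5 q5
    have e3 : s * (σ * (υ.im - x.im)) + t * (σ * (υ.im - y.im)) =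
      σ * (υ.im - (s * x.im + t * y.im)) := by linear_combination σ * e1
    linarith
  · have := key _ _ _ p6 q6
    have e3 : s * (υ.re - x.re) + t * (υ.re - y.re) =
      υ.re - (s * x.re + t * y.re) := by linear_combination e2
    linarith

theorem mem_slitStrip_of_side (hσ : σ = 1 ∨ σ = -1) {y : ℂ} {l u r a b : ℝ}
    (hl : -δ ≤ l) (hu : u ≤ δ) (hr : r ≤ b) (h : r ≤ a ∨ 0 ≤ l ∨ u ≤ 0) (h1 : l < σ * y.im)
    (h2 : σ * y.im < u) (h3 : y.re < r) : y ∈ slitStrip δ a b := by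
  refine ⟨?_, h3.trans_le hr, ?_⟩
  · rw [abs_lt]
    rcases hσ with rfl | rfl <;> constructor <;> linarith
  · rcases h with h | h | h
    · exact Or.inl (h3.trans_le h)
    · refine Or.inr fun h0 => ?_
      rw [h0] at h1; linarith
    · refine Or.inr fun h0 => ?_
      rw [h0] at h2; linarith

/-- Each disjunction lists the three ways of avoiding a cut: staying to the left of its start, or on
one of its two sides. -/
theorem pairBox_subset (hσ : σ = 1 ∨ σ = -1) (hl₁ : -δ ≤ l₁) (hu₁ : u₁ ≤ δ) (hr₁ : r₁ ≤ b₁)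
    (h₁ : r₁ ≤ a₁ ∨ 0 ≤ l₁ ∨ u₁ ≤ 0) (hl₂ : -δ ≤ l₂) (hu₂ : u₂ ≤ δ) (hr₂ : r₂ ≤ b₂)
    (h₂ : r₂ ≤ a₂ ∨ 0 ≤ l₂ ∨ u₂ ≤ 0) :
    pairBox σ l₁ u₁ r₁ l₂ u₂ r₂ υ ⊆ {y | y ∈ slitStrip δ a₁ b₁ ∧ υ - y ∈ slitStrip δ a₂ b₂} :=
  fun _ hy => ⟨mem_slitStrip_of_side hσ hl₁ hu₁ hr₁ h₁ hy.1.1 hy.1.2.1 hy.1.2.2,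
    mem_slitStrip_of_side hσ hl₂ hu₂ hr₂ h₂ hy.2.1 hy.2.2.1 hy.2.2.2⟩

theorem pairKernel_differentiableOn {S₁ S₂ : Set ℂ} (h₁ : IsOpen S₁) (h₂ : IsOpen S₂)
    (hf : DifferentiableOn ℂ f S₁) (hg : DifferentiableOn ℂ g S₂) :
    DifferentiableOn ℂ (Function.uncurry (pairKernel f g))
      {q : ℂ × ℂ | q.2 ∈ S₁ ∧ q.1 - q.2 ∈ S₂} := by
  rintro q ⟨hq1, hq2⟩
  have d1 : DifferentiableAt ℂ (fun q : ℂ × ℂ => f q.2) q :=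
    DifferentiableAt.comp q (hf.differentiableAt (h₁.mem_nhds hq1)) differentiableAt_snd
  have d2 : DifferentiableAt ℂ (fun q : ℂ × ℂ => g (q.1 - q.2)) q :=
    DifferentiableAt.comp q (f := fun q : ℂ × ℂ => q.1 - q.2)
      (hg.differentiableAt (h₂.mem_nhds hq2)) (differentiableAt_fst.sub differentiableAt_snd)
  exact (d1.mul d2).differentiableWithinAt

theorem pairKernel_differentiableOn_right {S₁ S₂ : Set ℂ} (h₁ : IsOpen S₁) (h₂ : IsOpen S₂)
    (hf : DifferentiableOn ℂ f S₁) (hg : DifferentiableOn ℂ g S₂) (υ : ℂ) :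
    DifferentiableOn ℂ (pairKernel f g υ) {y | y ∈ S₁ ∧ υ - y ∈ S₂} := by
  rintro y ⟨hq1, hq2⟩
  have d1 : DifferentiableAt ℂ f y := hf.differentiableAt (h₁.mem_nhds hq1)
  have d2 : DifferentiableAt ℂ (fun y : ℂ => g (υ - y)) y :=
    DifferentiableAt.comp y (f := fun y : ℂ => υ - y)
      (hg.differentiableAt (h₂.mem_nhds hq2)) (differentiableAt_id.const_sub υ)
  exact (d1.mul d2).differentiableWithinAt

end Box

end

noncomputable section

/-! ### Continuation of an arc integral up to a pinch -/

/-- The integral along the real segment `[x₁, x₂]`, as a limit from the side `σ`, exists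
and equals `c`. -/
def HasSideIntegral (f g : ℂ → ℂ) (σ x₁ x₂ : ℝ) (υ c : ℂ) : Prop :=
  (∀ᶠ h : ℝ in 𝓝[>] 0, IntervalIntegrable
    (fun x : ℝ => pairKernel f g υ ((x : ℂ) + (σ * h : ℝ) * I)) MeasureTheory.volume x₁ x₂) ∧
  Tendsto (fun h : ℝ => ∫ x in x₁..x₂, pairKernel f g υ ((x : ℂ) + (σ * h : ℝ) * I)) (𝓝[>] 0) (𝓝 c)

/-- The integrability clause of the definition is what permits joining adjacent integrals. -/
theorem HasSideIntegral.add {f g : ℂ → ℂ} {σ x₁ x₂ x₃ : ℝ} {υ c c' : ℂ}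
    (h : HasSideIntegral f g σ x₁ x₂ υ c) (h' : HasSideIntegral f g σ x₂ x₃ υ c') :
    HasSideIntegral f g σ x₁ x₃ υ (c + c') := by
  refine ⟨?_, (h.2.add h'.2).congr' ?_⟩
  · filter_upwards [h.1, h'.1] with t h1 h2 using h1.trans h2
  · filter_upwards [h.1, h'.1] with t h1 h2 using
      intervalIntegral.integral_add_adjacent_intervals h1 h2

/-- The function `f` extends across the real point `x` from the side `σ`. -/
def ExtendsAcross (σ : ℝ) (f : ℂ → ℂ) (x : ℝ) : Prop :=
  ∃ r > 0, ∃ Q : ℂ → ℂ, DifferentiableOn ℂ Q (Metric.ball (x : ℂ) r) ∧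
    ∀ y ∈ Metric.ball (x : ℂ) r, 0 < σ * y.im → f y = Q y

theorem sign_mul_im_mk {σ : ℝ} (hσ : σ = 1 ∨ σ = -1) (x h : ℝ) :
    σ * ((x : ℂ) + (σ * h : ℝ) * I).im = h := by
  rcases hσ with rfl | rfl <;> simp

variable {f g : ℂ → ℂ} {σ δ m M a b x₁ x₂ : ℝ} {D : ℂ → ℂ}

/-- Continuation of the arc integral to a thin sector on the side `σ`, in the presence of
singularities of both factors on the real axis. -/
theorem exists_continuation_to_sideSector (hσ : σ = 1 ∨ σ = -1)
    (hf : DifferentiableOn ℂ f (slitStrip δ (m + 1) (M + 1)))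
    (hg : DifferentiableOn ℂ g (slitStrip δ (-M + 1) (-m + 1))) (hmM : m + 1 ≤ M)
    (ha : -δ < a) (ha0 : a < 0) (hb0 : 0 < b) (hb : b < δ)
    (hx₁ : x₁ ∈ Ioo m (m + 1 / 2)) (hx₂ : x₂ ∈ Ioo (M - 1 / 2) M)
    (ef : ExtendsAcross σ f x₂) (eg : ExtendsAcross σ g (-x₁))
    (hD : IsPinch σ (HasSideIntegral f g σ x₁ x₂) D) :
    ∃ η > 0, ∃ N : ℝ, ∃ T : ℂ → ℂ, DifferentiableOn ℂ T (sideSector σ η) ∧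
      (∀ υ ∈ sideSector σ η, υ.re < -N →
        T υ = segInt (pairKernel f g υ) (m + (σ * a : ℝ) * I) (m + (σ * b : ℝ) * I)) ∧
      IsPinch σ (fun υ c => c = T υ) D := by
  have hfo := isOpen_slitStrip δ (m + 1) (M + 1)
  have hgo := isOpen_slitStrip δ (-M + 1) (-m + 1)
  set A : ℂ := m + (σ * a : ℝ) * I with hA
  set Dp : ℂ := x₂ + (σ * b : ℝ) * I with hDp
  set Ep : ℂ := m + (σ * b : ℝ) * I with hEp
  have reA : A.re = m := by simp [hA]
  have reD : Dp.re = x₂ := by simp [hDp]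
  have reE : Ep.re = m := by simp [hEp]
  have imA : σ * A.im = a := sign_mul_im_mk hσ m a
  have imD : σ * Dp.im = b := sign_mul_im_mk hσ x₂ b
  have imE : σ * Ep.im = b := sign_mul_im_mk hσ m b
  obtain ⟨η, hη0, hη4, hηa, hηb, hηδ, hηb'⟩ : ∃ η > 0, η ≤ 1 / 4 ∧ η ≤ δ + a ∧ η ≤ δ - b ∧
      η ≤ δ ∧ η ≤ b := by
    refine ⟨min (1 / 4) (min (δ + a) (min (δ - b) (min δ b))), ?_, min_le_left _ _, ?_, ?_, ?_, ?_⟩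
    · refine lt_min (by norm_num) (lt_min (by linarith) (lt_min (by linarith) (lt_min ?_ hb0)))
      linarith
    · exact (min_le_right _ _).trans (min_le_left _ _)
    · exact (min_le_right _ _).trans ((min_le_right _ _).trans (min_le_left _ _))
    · exact (min_le_right _ _).trans ((min_le_right _ _).trans ((min_le_right _ _).trans
        (min_le_left _ _)))
    · exact (min_le_right _ _).trans ((min_le_right _ _).trans ((min_le_right _ _).trans
        (min_le_right _ _)))
  -- Five convex regions free of both cuts, heights being measured by $\sigma\operatorname{Im}$:
  -- before the cut of `f` and below the height of `υ`; between the two cuts; above the cut of `f`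
  -- and beyond the end of the other one; above both; and, for `υ` far to the left, the gap between
  -- the ends of the cuts.
  have sub1 : ∀ υ : ℂ, pairBox σ (-δ) δ (m + 1) 0 δ (-m + 1) υ ⊆
      {y | y ∈ slitStrip δ (m + 1) (M + 1) ∧ υ - y ∈ slitStrip δ (-M + 1) (-m + 1)} := fun υ =>
    pairBox_subset hσ le_rfl le_rfl (by linarith) (Or.inl le_rfl) (by linarith) le_rfl le_rfl
      (Or.inr (Or.inl le_rfl))
  have sub2 : ∀ υ : ℂ, pairBox σ 0 δ (M + 1) 0 δ (-m + 1) υ ⊆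
      {y | y ∈ slitStrip δ (m + 1) (M + 1) ∧ υ - y ∈ slitStrip δ (-M + 1) (-m + 1)} := fun υ =>
    pairBox_subset hσ (by linarith) le_rfl le_rfl (Or.inr (Or.inl le_rfl)) (by linarith) le_rfl
      le_rfl (Or.inr (Or.inl le_rfl))
  have sub3 : ∀ υ : ℂ, pairBox σ 0 δ (M + 1) (-δ) δ (-M + 1) υ ⊆
      {y | y ∈ slitStrip δ (m + 1) (M + 1) ∧ υ - y ∈ slitStrip δ (-M + 1) (-m + 1)} := fun υ =>
    pairBox_subset hσ (by linarith) le_rfl le_rfl (Or.inr (Or.inl le_rfl)) le_rfl le_rfl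
      (by linarith) (Or.inl le_rfl)
  have sub4 : ∀ υ : ℂ, pairBox σ 0 δ (M + 1) (-δ) 0 (-m + 1) υ ⊆
      {y | y ∈ slitStrip δ (m + 1) (M + 1) ∧ υ - y ∈ slitStrip δ (-M + 1) (-m + 1)} := fun υ =>
    pairBox_subset hσ (by linarith) le_rfl le_rfl (Or.inr (Or.inl le_rfl)) le_rfl (by linarith)
      le_rfl (Or.inr (Or.inr le_rfl))
  have sub5 : ∀ υ : ℂ, pairBox σ (-δ) δ (m + 1) (-δ) δ (-M + 1) υ ⊆
      {y | y ∈ slitStrip δ (m + 1) (M + 1) ∧ υ - y ∈ slitStrip δ (-M + 1) (-m + 1)} := fun υ =>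
    pairBox_subset hσ le_rfl le_rfl (by linarith) (Or.inl le_rfl) le_rfl le_rfl (by linarith)
      (Or.inl le_rfl)
  have dE : ∀ υ : ℂ, DifferentiableOn ℂ (pairKernel f g υ)
      {y | y ∈ slitStrip δ (m + 1) (M + 1) ∧ υ - y ∈ slitStrip δ (-M + 1) (-m + 1)} := fun υ =>
    pairKernel_differentiableOn_right hfo hgo hf hg υ
  have dU := pairKernel_differentiableOn hfo hgo hf hg
  have reB : ∀ υ : ℂ, ((x₁ : ℂ) + υ / 2).re = x₁ + υ.re / 2 := fun υ => by simp
  have imB : ∀ υ : ℂ, σ * ((x₁ : ℂ) + υ / 2).im = σ * υ.im / 2 := fun υ => by simp; ring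
  have reC : ∀ υ : ℂ, ((x₂ : ℂ) + υ / 2).re = x₂ + υ.re / 2 := fun υ => by simp
  have imC : ∀ υ : ℂ, σ * ((x₂ : ℂ) + υ / 2).im = σ * υ.im / 2 := fun υ => by simp; ring
  have memA1 : ∀ υ : ℂ, -η < σ * υ.im → σ * υ.im < η → υ.re < η → a + η ≤ 0 ∨ 0 < σ * υ.im →
      A ∈ pairBox σ (-δ) δ (m + 1) 0 δ (-m + 1) υ := fun υ h0 h1 h2 h3 => by
    refine ⟨⟨?_, ?_, ?_⟩, ?_, ?_, ?_⟩ <;>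
      simp only [sub_im, sub_re, mul_sub, reA, imA] <;> try linarith
    rcases h3 with h3 | h3 <;> linarith
  have memB1 : ∀ υ ∈ sideSector σ η, (x₁ : ℂ) + υ / 2 ∈
      pairBox σ (-δ) δ (m + 1) 0 δ (-m + 1) υ := fun υ h => by
    refine ⟨⟨?_, ?_, ?_⟩, ?_, ?_, ?_⟩ <;>
      simp only [sub_im, sub_re, mul_sub, reB, imB] <;> linarith [h.1, h.2.1, h.2.2, hx₁.1, hx₁.2]
  have memB2 : ∀ υ ∈ sideSector σ η, (x₁ : ℂ) + υ / 2 ∈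
      pairBox σ 0 δ (M + 1) 0 δ (-m + 1) υ := fun υ h => by
    refine ⟨⟨?_, ?_, ?_⟩, ?_, ?_, ?_⟩ <;>
      simp only [sub_im, sub_re, mul_sub, reB, imB] <;> linarith [h.1, h.2.1, h.2.2, hx₁.1, hx₁.2]
  have memC2 : ∀ υ ∈ sideSector σ η, (x₂ : ℂ) + υ / 2 ∈
      pairBox σ 0 δ (M + 1) 0 δ (-m + 1) υ := fun υ h => by
    refine ⟨⟨?_, ?_, ?_⟩, ?_, ?_, ?_⟩ <;>
      simp only [sub_im, sub_re, mul_sub, reC, imC] <;> linarith [h.1, h.2.1, h.2.2, hx₂.1, hx₂.2]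
  have memC3 : ∀ υ ∈ sideSector σ η, (x₂ : ℂ) + υ / 2 ∈
      pairBox σ 0 δ (M + 1) (-δ) δ (-M + 1) υ := fun υ h => by
    refine ⟨⟨?_, ?_, ?_⟩, ?_, ?_, ?_⟩ <;>
      simp only [sub_im, sub_re, mul_sub, reC, imC] <;> linarith [h.1, h.2.1, h.2.2, hx₂.1, hx₂.2]
  have memD3 : ∀ υ : ℂ, -η < σ * υ.im → σ * υ.im < η → υ.re < η → Dp ∈
      pairBox σ 0 δ (M + 1) (-δ) δ (-M + 1) υ := fun υ h0 h1 h2 => by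
    refine ⟨⟨?_, ?_, ?_⟩, ?_, ?_, ?_⟩ <;>
      simp only [sub_im, sub_re, mul_sub, reD, imD] <;> linarith [hx₂.1, hx₂.2]
  have memD4 : ∀ υ : ℂ, -η < σ * υ.im → σ * υ.im < η → υ.re < η → Dp ∈
      pairBox σ 0 δ (M + 1) (-δ) 0 (-m + 1) υ := fun υ h0 h1 h2 => by
    refine ⟨⟨?_, ?_, ?_⟩, ?_, ?_, ?_⟩ <;>
      simp only [sub_im, sub_re, mul_sub, reD, imD] <;> linarith [hx₂.1, hx₂.2]
  have memE4 : ∀ υ : ℂ, -η < σ * υ.im → σ * υ.im < η → υ.re < η → Ep ∈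
      pairBox σ 0 δ (M + 1) (-δ) 0 (-m + 1) υ := fun υ h0 h1 h2 => by
    refine ⟨⟨?_, ?_, ?_⟩, ?_, ?_, ?_⟩ <;>
      simp only [sub_im, sub_re, mul_sub, reE, imE] <;> linarith
  -- The path enters at height `a`, runs between the cuts along the translate by $\upsilon/2$ of the
  -- real segment, and comes back at height `b`. The translate depends holomorphically on `υ` and
  -- stays midway between the cuts.
  set T : ℂ → ℂ := fun υ => segInt (pairKernel f g υ) A (x₁ + υ / 2) +
    segInt (pairKernel f g υ) (x₁ + υ / 2) (x₂ + υ / 2) +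
    segInt (pairKernel f g υ) (x₂ + υ / 2) Dp + segInt (pairKernel f g υ) Dp Ep with hT
  refine ⟨η, hη0, 2 * (M - m), T, ?_, ?_, ?_⟩
  · have hs := isOpen_sideSector σ η
    have dB : DifferentiableOn ℂ (fun υ : ℂ => (x₁ : ℂ) + υ / 2) (sideSector σ η) := by fun_prop
    have dC : DifferentiableOn ℂ (fun υ : ℂ => (x₂ : ℂ) + υ / 2) (sideSector σ η) := by fun_prop
    have dc : ∀ c : ℂ, DifferentiableOn ℂ (fun _ : ℂ => c) (sideSector σ η) :=
      fun c => differentiableOn_const c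
    refine ((DifferentiableOn.add ?_ ?_).add ?_).add ?_
    · exact differentiableOn_segInt hs (dc A) dB dU fun υ h y hy => sub1 υ
        (convex_pairBox.segment_subset (memA1 υ (by linarith [h.1]) h.2.1 h.2.2 (Or.inr h.1))
          (memB1 υ h) hy)
    · exact differentiableOn_segInt hs dB dC dU fun υ h y hy => sub2 υ
        (convex_pairBox.segment_subset (memB2 υ h) (memC2 υ h) hy)
    · exact differentiableOn_segInt hs dC (dc Dp) dU fun υ h y hy => sub3 υ
        (convex_pairBox.segment_subset (memC3 υ h) (memD3 υ (by linarith [h.1]) h.2.1 h.2.2) hy)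
    · exact differentiableOn_segInt hs (dc Dp) (dc Ep) dU fun υ h y hy => sub4 υ
        (convex_pairBox.segment_subset (memD4 υ (by linarith [h.1]) h.2.1 h.2.2)
          (memE4 υ (by linarith [h.1]) h.2.1 h.2.2) hy)
  -- Once the cuts are far apart, the detour collapses onto the vertical segment from `A` to `Ep`,
  -- within the third and fifth regions.
  · intro υ h hN
    have A5 : A ∈ pairBox σ (-δ) δ (m + 1) (-δ) δ (-M + 1) υ := by
      refine ⟨⟨?_, ?_, ?_⟩, ?_, ?_, ?_⟩ <;>
        simp only [sub_im, sub_re, mul_sub, reA, imA] <;> linarith [h.1, h.2.1, h.2.2]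
    have B5 : (x₁ : ℂ) + υ / 2 ∈ pairBox σ (-δ) δ (m + 1) (-δ) δ (-M + 1) υ := by
      refine ⟨⟨?_, ?_, ?_⟩, ?_, ?_, ?_⟩ <;>
        simp only [sub_im, sub_re, mul_sub, reB, imB] <;> linarith [h.1, h.2.1, h.2.2, hx₁.1, hx₁.2]
    have E5 : Ep ∈ pairBox σ (-δ) δ (m + 1) (-δ) δ (-M + 1) υ := by
      refine ⟨⟨?_, ?_, ?_⟩, ?_, ?_, ?_⟩ <;>
        simp only [sub_im, sub_re, mul_sub, reE, imE] <;> linarith [h.1, h.2.1, h.2.2]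
    have B3 : (x₁ : ℂ) + υ / 2 ∈ pairBox σ 0 δ (M + 1) (-δ) δ (-M + 1) υ := by
      refine ⟨⟨?_, ?_, ?_⟩, ?_, ?_, ?_⟩ <;>
        simp only [sub_im, sub_re, mul_sub, reB, imB] <;> linarith [h.1, h.2.1, h.2.2, hx₁.1, hx₁.2]
    have E3 : Ep ∈ pairBox σ 0 δ (M + 1) (-δ) δ (-M + 1) υ := by
      refine ⟨⟨?_, ?_, ?_⟩, ?_, ?_, ?_⟩ <;>
        simp only [sub_im, sub_re, mul_sub, reE, imE] <;> linarith [h.1, h.2.1, h.2.2]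
    have d3 := (dE υ).mono (sub3 υ)
    have d5 := (dE υ).mono (sub5 υ)
    have C3 := memC3 υ h
    have D3 := memD3 υ (by linarith [h.1]) h.2.1 h.2.2
    have k1 := segInt_add isOpen_pairBox convex_pairBox d3 B3 C3 D3
    have k2 := segInt_add isOpen_pairBox convex_pairBox d3 B3 D3 E3
    have k3 := segInt_add isOpen_pairBox convex_pairBox d5 A5 B5 E5
    rw [hT]
    linear_combination k1 + k2 + k3
  · obtain ⟨rf, hrf, Qf, dQf, eQf⟩ := ef
    obtain ⟨rg, hrg, Qg, dQg, eQg⟩ := eg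
    obtain ⟨d, hd0, hdη, hda, hdb, hdf, hdg, hdδ⟩ : ∃ d > 0, d ≤ η ∧ d ≤ -a ∧ d ≤ b ∧ 2 * d ≤ rf ∧
        2 * d ≤ rg ∧ 2 * d ≤ δ := by
      refine ⟨min η (min (-a) (min b (min (rf / 2) (min (rg / 2) (δ / 2))))), ?_, min_le_left _ _,
        ?_, ?_, ?_, ?_, ?_⟩
      · refine lt_min hη0 (lt_min (by linarith) (lt_min hb0 (lt_min (by linarith)
          (lt_min (by linarith) (by linarith)))))
      · exact (min_le_right _ _).trans (min_le_left _ _)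
      · exact (min_le_right _ _).trans ((min_le_right _ _).trans (min_le_left _ _))
      · have := (min_le_right η _).trans ((min_le_right (-a) _).trans ((min_le_right b _).trans
          (min_le_left (rf / 2) (min (rg / 2) (δ / 2)))))
        linarith
      · have := (min_le_right η _).trans ((min_le_right (-a) _).trans ((min_le_right b _).trans
          ((min_le_right (rf / 2) _).trans (min_le_left (rg / 2) (δ / 2)))))
        linarith
      · have := (min_le_right η _).trans ((min_le_right (-a) _).trans ((min_le_right b _).trans
          ((min_le_right (rf / 2) _).trans (min_le_right (rg / 2) (δ / 2)))))
        linarith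
    set A' : ℂ := x₁ + (σ * (-d) : ℝ) * I with hA'
    set D' : ℂ := x₂ + (σ * d : ℝ) * I with hD'
    have reA' : A'.re = x₁ := by simp [hA']
    have reD' : D'.re = x₂ := by simp [hD']
    have imA' : σ * A'.im = -d := sign_mul_im_mk hσ x₁ (-d)
    have imD' : σ * D'.im = d := sign_mul_im_mk hσ x₂ d
    have σ1 : |σ| = 1 := by rcases hσ with rfl | rfl <;> simp
    have nA' : ‖A' - x₁‖ = d := by
      rw [hA', add_sub_cancel_left, norm_mul, Complex.norm_I, mul_one, Complex.norm_real,
        Real.norm_eq_abs, abs_mul, σ1, one_mul, abs_neg, abs_of_pos hd0]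
    have nD' : ‖D' - x₂‖ = d := by
      rw [hD', add_sub_cancel_left, norm_mul, Complex.norm_I, mul_one, Complex.norm_real,
        Real.norm_eq_abs, abs_mul, σ1, one_mul, abs_of_pos hd0]
    have segA' : ∀ y ∈ segment ℝ A' (x₁ : ℂ), ‖y - x₁‖ ≤ d := fun y hy => by
      have := (convex_closedBall (x₁ : ℂ) d).segment_subset (x := A') (y := x₁)
        (by rw [Metric.mem_closedBall, dist_eq_norm, nA']) (Metric.mem_closedBall_self hd0.le) hy
      rwa [Metric.mem_closedBall, dist_eq_norm] at this
    have ball_small : ∀ υ : ℂ, ‖υ‖ < d → -d < σ * υ.im ∧ σ * υ.im < d ∧ υ.re < d ∧ -d < υ.re := by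
      intro υ h
      have h1 := abs_lt.1 ((Complex.abs_im_le_norm υ).trans_lt h)
      have h2 := abs_lt.1 ((Complex.abs_re_le_norm υ).trans_lt h)
      refine ⟨?_, ?_, h2.2, h2.1⟩ <;> rcases hσ with rfl | rfl <;> linarith [h1.1, h1.2]
    have ballg : ∀ υ y : ℂ, ‖υ‖ < d → ‖y - x₁‖ ≤ d → υ - y ∈ Metric.ball (-x₁ : ℂ) rg := by
      intro υ y h1 h2
      rw [Metric.mem_ball, dist_eq_norm, show υ - y - -(x₁ : ℂ) = υ - (y - x₁) by ring]
      exact (norm_sub_le _ _).trans_lt (by linarith)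
    have hcast : ((-x₁ : ℝ) : ℂ) = -(x₁ : ℂ) := by push_cast; ring
    rw [hcast] at dQg eQg
    have memA'1 : ∀ υ : ℂ, ‖υ‖ < d → A' ∈ pairBox σ (-δ) δ (m + 1) 0 δ (-m + 1) υ := fun υ h => by
      obtain ⟨h1, h2, h3, h4⟩ := ball_small υ h
      refine ⟨⟨?_, ?_, ?_⟩, ?_, ?_, ?_⟩ <;>
        simp only [sub_im, sub_re, mul_sub, reA', imA'] <;> linarith [hx₁.1, hx₁.2]
    have memA1' : ∀ υ : ℂ, ‖υ‖ < d → A ∈ pairBox σ (-δ) δ (m + 1) 0 δ (-m + 1) υ := fun υ h => by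
      obtain ⟨h1, h2, h3, h4⟩ := ball_small υ h
      refine ⟨⟨?_, ?_, ?_⟩, ?_, ?_, ?_⟩ <;>
        simp only [sub_im, sub_re, mul_sub, reA, imA] <;> linarith
    have memD'3 : ∀ υ : ℂ, ‖υ‖ < d → D' ∈ pairBox σ 0 δ (M + 1) (-δ) δ (-M + 1) υ := fun υ h => by
      obtain ⟨h1, h2, h3, h4⟩ := ball_small υ h
      refine ⟨⟨?_, ?_, ?_⟩, ?_, ?_, ?_⟩ <;>
        simp only [sub_im, sub_re, mul_sub, reD', imD'] <;> linarith [hx₂.1, hx₂.2]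
    have memA'f : ∀ y ∈ segment ℝ A' (x₁ : ℂ), y ∈ slitStrip δ (m + 1) (M + 1) := fun y hy => by
      have h1 := segA' y hy
      have h2 := abs_le.1 ((Complex.abs_im_le_norm (y - x₁)).trans h1)
      have h3 := abs_le.1 ((Complex.abs_re_le_norm (y - x₁)).trans h1)
      simp only [sub_im, sub_re, ofReal_im, ofReal_re, sub_zero] at h2 h3
      refine ⟨abs_lt.2 ⟨by linarith [h2.1], by linarith [h2.2]⟩, ?_, Or.inl ?_⟩ <;>
        linarith [h3.2, hx₁.2]
    have gregion : ∀ υ y : ℂ, ‖υ‖ < d → ‖y - x₂‖ ≤ d →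
        υ - y ∈ {z : ℂ | |z.im| < δ ∧ z.re < -M + 1} := fun υ y h h1 => by
      have h2 := abs_le.1 ((Complex.abs_im_le_norm (y - x₂)).trans h1)
      have h3 := abs_le.1 ((Complex.abs_re_le_norm (y - x₂)).trans h1)
      have h4 := abs_lt.1 ((Complex.abs_im_le_norm υ).trans_lt h)
      have h5 := abs_lt.1 ((Complex.abs_re_le_norm υ).trans_lt h)
      simp only [sub_im, sub_re, ofReal_im, ofReal_re, sub_zero] at h2 h3
      refine ⟨abs_lt.2 ⟨?_, ?_⟩, ?_⟩ <;> simp only [sub_im, sub_re] <;>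
        linarith [h2.1, h2.2, h3.1, h3.2, h4.1, h4.2, h5.1, h5.2, hx₂.1]
    have gsub : {z : ℂ | |z.im| < δ ∧ z.re < -M + 1} ⊆ slitStrip δ (-M + 1) (-m + 1) :=
      fun z hz => ⟨hz.1, by linarith [hz.2], Or.inl hz.2⟩
    have segD' : ∀ y ∈ segment ℝ (x₂ : ℂ) D', ‖y - x₂‖ ≤ d := fun y hy => by
      have := (convex_closedBall (x₂ : ℂ) d).segment_subset (x := (x₂ : ℂ)) (y := D')
        (Metric.mem_closedBall_self hd0.le) (by rw [Metric.mem_closedBall, dist_eq_norm, nD']) hy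
      rwa [Metric.mem_closedBall, dist_eq_norm] at this
    have ballf : ∀ y : ℂ, ‖y - x₂‖ ≤ d → y ∈ Metric.ball (x₂ : ℂ) rf := fun y h => by
      rw [Metric.mem_ball, dist_eq_norm]; linarith
    -- The rest of the path, outside `[x₁, x₂]`. Its parts ending at `x₁` and `x₂` would be caught
    -- by a cut when `υ` turns round $0$; replacing `g` by `Qg` and `f` by `Qf` there makes `W`
    -- holomorphic on a full disc.
    set W : ℂ → ℂ := fun υ => segInt (pairKernel f g υ) A A' + segInt (pairKernel f Qg υ) A' x₁ +
      segInt (pairKernel Qf g υ) x₂ D' + segInt (pairKernel f g υ) D' Dp +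
      segInt (pairKernel f g υ) Dp Ep with hW
    have dW : DifferentiableOn ℂ W (Metric.ball 0 d) := by
      have hs : IsOpen (Metric.ball (0 : ℂ) d) := Metric.isOpen_ball
      have dc : ∀ c : ℂ, DifferentiableOn ℂ (fun _ : ℂ => c) (Metric.ball 0 d) :=
        fun c => differentiableOn_const c
      have nb : ∀ υ ∈ Metric.ball (0 : ℂ) d, ‖υ‖ < d := fun υ h => by simpa using h
      refine (((DifferentiableOn.add ?_ ?_).add ?_).add ?_).add ?_
      · exact differentiableOn_segInt hs (dc A) (dc A') dU fun υ h y hy => sub1 υ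
          (convex_pairBox.segment_subset (memA1' υ (nb υ h)) (memA'1 υ (nb υ h)) hy)
      · exact differentiableOn_segInt hs (dc A') (dc x₁)
          (pairKernel_differentiableOn hfo Metric.isOpen_ball hf dQg) fun υ h y hy =>
            ⟨memA'f y hy, ballg υ y (nb υ h) (segA' y hy)⟩
      · exact differentiableOn_segInt hs (dc x₂) (dc D')
          (pairKernel_differentiableOn Metric.isOpen_ball hgo dQf hg) fun υ h y hy =>
            ⟨ballf y (segD' y hy), gsub (gregion υ y (nb υ h) (segD' y hy))⟩
      · exact differentiableOn_segInt hs (dc D') (dc Dp) dU fun υ h y hy => sub3 υ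
          (convex_pairBox.segment_subset (memD'3 υ (nb υ h)) (by
            obtain ⟨h1, h2, h3, h4⟩ := ball_small υ (nb υ h)
            exact memD3 υ (by linarith) (by linarith) (by linarith)) hy)
      · exact differentiableOn_segInt hs (dc Dp) (dc Ep) dU fun υ h y hy => sub4 υ (by
          obtain ⟨h1, h2, h3, h4⟩ := ball_small υ (nb υ h)
          exact convex_pairBox.segment_subset
            (memD4 υ (by linarith) (by linarith) (by linarith))
            (memE4 υ (by linarith) (by linarith) (by linarith)) hy)
    have hsum := hD.add (isPinch_of_differentiableOn (σ := σ) hd0 dW)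
      (L := fun υ c => ∃ c₁, HasSideIntegral f g σ x₁ x₂ υ c₁ ∧ c = c₁ + W υ)
      fun υ c₁ c₂ h1 h2 => ⟨c₁, h1, by rw [h2]⟩
    simp only [add_zero] at hsum
    refine hsum.mono hσ hd0 ?_
    rintro υ _ hυ him ⟨c, ⟨-, hc⟩, rfl⟩
    obtain ⟨h1, h2, h3, h4⟩ := ball_small υ hυ
    have hsec : υ ∈ sideSector σ η := ⟨him, by linarith, by linarith⟩
    have d1 := (dE υ).mono (sub1 υ)
    have d2 := (dE υ).mono (sub2 υ)
    have d3 := (dE υ).mono (sub3 υ)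
    have A1 := memA1' υ hυ
    have A'1 := memA'1 υ hυ
    have X1 : (x₁ : ℂ) ∈ pairBox σ (-δ) δ (m + 1) 0 δ (-m + 1) υ := by
      refine ⟨⟨?_, ?_, ?_⟩, ?_, ?_, ?_⟩ <;>
        simp only [sub_im, sub_re, ofReal_im, ofReal_re, mul_zero, sub_zero] <;>
        linarith [hx₁.1, hx₁.2]
    have tx₁ : Tendsto (fun h : ℝ => (x₁ : ℂ) + (σ * h : ℝ) * I) (𝓝[>] 0) (𝓝 x₁) := by
      have : Continuous fun h : ℝ => (x₁ : ℂ) + (σ * h : ℝ) * I := by fun_prop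
      have h := this.tendsto 0
      simp only [mul_zero, ofReal_zero, zero_mul, add_zero] at h
      exact h.mono_left nhdsWithin_le_nhds
    have tx₂ : Tendsto (fun h : ℝ => (x₂ : ℂ) + (σ * h : ℝ) * I) (𝓝[>] 0) (𝓝 x₂) := by
      have : Continuous fun h : ℝ => (x₂ : ℂ) + (σ * h : ℝ) * I := by fun_prop
      have h := this.tendsto 0
      simp only [mul_zero, ofReal_zero, zero_mul, add_zero] at h
      exact h.mono_left nhdsWithin_le_nhds
    have lim1 := tendsto_segInt_right isOpen_pairBox convex_pairBox d1 A1 X1 tx₁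
    have e1 : segInt (pairKernel f g υ) A x₁ =
        segInt (pairKernel f g υ) A A' + segInt (pairKernel f Qg υ) A' x₁ := by
      rw [← segInt_add isOpen_pairBox convex_pairBox d1 A1 A'1 X1]
      congr 1
      refine segInt_congr fun y hy => ?_
      have h5 := (convex_pairBox.segment_subset A'1 X1 hy).2.1
      rw [pairKernel, pairKernel, eQg _ (ballg υ y hυ (segA' y hy)) h5]
    set K : Set ℂ := Metric.ball (x₂ : ℂ) rf ∩ {y | υ - y ∈ {z : ℂ | |z.im| < δ ∧ z.re < -M + 1}}
      with hK
    have hKo : IsOpen K := Metric.isOpen_ball.inter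
      ((IsOpen.and (isOpen_lt continuous_im.abs continuous_const)
        (isOpen_lt continuous_re continuous_const)).preimage (continuous_const.sub continuous_id))
    have hKc : Convex ℝ K := by
      refine (convex_ball _ _).inter ?_
      have : {y : ℂ | υ - y ∈ {z : ℂ | |z.im| < δ ∧ z.re < -M + 1}} =
          ({y : ℂ | υ.im - δ < y.im} ∩ {y : ℂ | y.im < υ.im + δ}) ∩ {y : ℂ | υ.re + M - 1 < y.re} := by
        ext y
        simp only [mem_ofPred_eq, mem_inter_iff, sub_im, sub_re, abs_lt]
        constructor
        · rintro ⟨⟨p, q⟩, r⟩; exact ⟨⟨by linarith, by linarith⟩, by linarith⟩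
        · rintro ⟨⟨p, q⟩, r⟩; exact ⟨⟨by linarith, by linarith⟩, by linarith⟩
      rw [this]
      exact ((convex_halfSpace_im_gt _).inter (convex_halfSpace_im_lt _)).inter
        (convex_halfSpace_re_gt _)
    have dK : DifferentiableOn ℂ (pairKernel Qf g υ) K :=
      (pairKernel_differentiableOn_right Metric.isOpen_ball hgo dQf hg υ).mono
        fun y hy => ⟨hy.1, gsub hy.2⟩
    have X2K : (x₂ : ℂ) ∈ K := ⟨Metric.mem_ball_self hrf, gregion υ x₂ hυ (by simpa using hd0.le)⟩
    have D'K : D' ∈ K := ⟨ballf D' nD'.le, gregion υ D' hυ nD'.le⟩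
    have lim3 := tendsto_segInt_right hKo hKc dK D'K X2K tx₂
    -- For $0<h<\sigma\operatorname{Im}\upsilon$ the segment at height `h` still passes between the
    -- cuts, so the path through it gives `T υ`. Letting $h\to0$ yields the side integral plus `W
    -- υ`.
    have key : ∀ᶠ h : ℝ in 𝓝[>] 0, segInt (pairKernel f g υ) A (x₁ + (σ * h : ℝ) * I) +
        (∫ x in x₁..x₂, pairKernel f g υ ((x : ℂ) + (σ * h : ℝ) * I)) -
        segInt (pairKernel Qf g υ) D' (x₂ + (σ * h : ℝ) * I) + segInt (pairKernel f g υ) D' Dp +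
        segInt (pairKernel f g υ) Dp Ep = T υ := by
      have hmin : 0 < min d (σ * υ.im) := lt_min hd0 him
      filter_upwards [Ioo_mem_nhdsGT hmin, tx₂.eventually (hKo.mem_nhds X2K)] with h hh hhK
      have hh1 : h < d := hh.2.trans_le (min_le_left _ _)
      have hh2 : h < σ * υ.im := hh.2.trans_le (min_le_right _ _)
      have hh0 := hh.1
      have imBh := sign_mul_im_mk hσ x₁ h
      have imCh := sign_mul_im_mk hσ x₂ h
      have reBh : ((x₁ : ℂ) + (σ * h : ℝ) * I).re = x₁ := by simp
      have reCh : ((x₂ : ℂ) + (σ * h : ℝ) * I).re = x₂ := by simp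
      rw [← segInt_horizontal (pairKernel f g υ) x₁ x₂]
      set Bh : ℂ := (x₁ : ℂ) + (σ * h : ℝ) * I
      set Ch : ℂ := (x₂ : ℂ) + (σ * h : ℝ) * I
      have Bh1 : Bh ∈ pairBox σ (-δ) δ (m + 1) 0 δ (-m + 1) υ := by
        refine ⟨⟨?_, ?_, ?_⟩, ?_, ?_, ?_⟩ <;>
          simp only [sub_im, sub_re, mul_sub, reBh, imBh] <;> linarith [hx₁.1, hx₁.2]
      have Bh2 : Bh ∈ pairBox σ 0 δ (M + 1) 0 δ (-m + 1) υ := by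
        refine ⟨⟨?_, ?_, ?_⟩, ?_, ?_, ?_⟩ <;>
          simp only [sub_im, sub_re, mul_sub, reBh, imBh] <;> linarith [hx₁.1, hx₁.2]
      have Ch2 : Ch ∈ pairBox σ 0 δ (M + 1) 0 δ (-m + 1) υ := by
        refine ⟨⟨?_, ?_, ?_⟩, ?_, ?_, ?_⟩ <;>
          simp only [sub_im, sub_re, mul_sub, reCh, imCh] <;> linarith [hx₂.1, hx₂.2]
      have Ch3 : Ch ∈ pairBox σ 0 δ (M + 1) (-δ) δ (-M + 1) υ := by
        refine ⟨⟨?_, ?_, ?_⟩, ?_, ?_, ?_⟩ <;>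
          simp only [sub_im, sub_re, mul_sub, reCh, imCh] <;> linarith [hx₂.1, hx₂.2]
      have B1 := memB1 υ hsec
      have B2 := memB2 υ hsec
      have C2 := memC2 υ hsec
      have C3 := memC3 υ hsec
      have D3 := memD3 υ (by linarith) (by linarith) (by linarith)
      have D'3 := memD'3 υ hυ
      have q1 := segInt_add isOpen_pairBox convex_pairBox d1 A1 Bh1 B1
      have q2 := segInt_add isOpen_pairBox convex_pairBox d2 Bh2 B2 C2
      have q3 := segInt_add isOpen_pairBox convex_pairBox d2 Bh2 Ch2 C2
      have q4 := segInt_add isOpen_pairBox convex_pairBox d3 Ch3 C3 D3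
      have q5 := segInt_add isOpen_pairBox convex_pairBox d3 Ch3 D'3 D3
      have q6 : segInt (pairKernel Qf g υ) D' Ch = segInt (pairKernel f g υ) D' Ch := by
        refine segInt_congr fun y hy => ?_
        have h5 := (convex_pairBox.segment_subset D'3 Ch3 hy).1.1
        rw [pairKernel, pairKernel, eQf y (hKc.segment_subset D'K hhK hy).1 h5]
      have q7 := segInt_symm (pairKernel f g υ) D' Ch
      have q8 : segInt (pairKernel f g υ) Bh (x₁ + υ / 2) + segInt (pairKernel f g υ) (x₁ + υ / 2)
        (x₂ + υ / 2) + segInt (pairKernel f g υ) (x₂ + υ / 2) Dp =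
        segInt (pairKernel f g υ) Bh Ch + segInt (pairKernel f g υ) Ch Dp := by
        linear_combination q2 - q3 + q4
      rw [hT]
      linear_combination q1 - q8 - q6 - q7 + q5
    have lim := (((lim1.add hc).sub lim3).add_const (segInt (pairKernel f g υ) D' Dp)).add_const
      (segInt (pairKernel f g υ) Dp Ep)
    have huniq := tendsto_nhds_unique (lim.congr' key) tendsto_const_nhds
    have q9 := segInt_symm (pairKernel Qf g υ) D' x₂
    rw [← huniq, hW]
    linear_combination -e1 + q9

end

noncomputable section

/-! ### Continuation across a direction without pinch -/

/-- A truncated strip around the real axis. -/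
def truncatedStrip (η : ℝ) : Set ℂ := {υ | |υ.im| < η ∧ υ.re < η}

theorem isOpen_truncatedStrip (η : ℝ) : IsOpen (truncatedStrip η) :=
  IsOpen.and (isOpen_lt continuous_im.abs continuous_const)
    (isOpen_lt continuous_re continuous_const)

theorem convex_truncatedStrip (η : ℝ) : Convex ℝ (truncatedStrip η) := by
  have : truncatedStrip η = ({υ : ℂ | -η < υ.im} ∩ {υ | υ.im < η}) ∩ {υ | υ.re < η} := by
    ext υ
    simp only [truncatedStrip, mem_ofPred_eq, mem_inter_iff, abs_lt]
  rw [this]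
  exact ((convex_halfSpace_im_gt _).inter (convex_halfSpace_im_lt _)).inter
    (convex_halfSpace_re_lt _)

/-- The cut of `f` starts at $X+\varepsilon$, and that of $y\mapsto g(\upsilon-y)$ ends at
$\operatorname{Re}\upsilon+X-\varepsilon$; the vertical segment at abscissa `X` separates them as
long as $\operatorname{Re}\upsilon<\varepsilon$. The path goes out to it at height `a` and back at
height `b`. -/
theorem exists_continuation_to_truncatedStrip {f g : ℂ → ℂ} {σ δ m M a b X ε : ℝ}
    (hσ : σ = 1 ∨ σ = -1) (hf : DifferentiableOn ℂ f (slitStrip δ (X + ε) (M + 1)))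
    (hg : DifferentiableOn ℂ g (slitStrip δ (-X + ε) (-m + 1))) (hε : 0 < ε) (hmX : m ≤ X)
    (hXM : X ≤ M) (ha : -δ < a) (ha0 : a < 0) (hb0 : 0 < b) (hb : b < δ) :
    ∃ η > 0, ∃ N : ℝ, ∃ T : ℂ → ℂ, DifferentiableOn ℂ T (truncatedStrip η) ∧
      ∀ υ ∈ truncatedStrip η, υ.re < -N →
        T υ = segInt (pairKernel f g υ) (m + (σ * a : ℝ) * I) (m + (σ * b : ℝ) * I) := by
  have hfo := isOpen_slitStrip δ (X + ε) (M + 1)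
  have hgo := isOpen_slitStrip δ (-X + ε) (-m + 1)
  have dU := pairKernel_differentiableOn hfo hgo hf hg
  obtain ⟨η, hη0, hη1, hηε, hηa, hηb, hηa', hηb'⟩ : ∃ η > 0, η ≤ 1 ∧ η ≤ ε ∧ η ≤ δ + a ∧
      η ≤ δ - b ∧ η ≤ -a ∧ η ≤ b := by
    refine ⟨min 1 (min ε (min (δ + a) (min (δ - b) (min (-a) b)))), ?_, min_le_left _ _,
      ?_, ?_, ?_, ?_, ?_⟩
    · exact lt_min one_pos (lt_min hε (lt_min (by linarith) (lt_min (by linarith)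
        (lt_min (by linarith) hb0))))
    · exact (min_le_right _ _).trans (min_le_left _ _)
    · exact (min_le_right _ _).trans ((min_le_right _ _).trans (min_le_left _ _))
    · exact (min_le_right _ _).trans ((min_le_right _ _).trans ((min_le_right _ _).trans
        (min_le_left _ _)))
    · exact (min_le_right _ _).trans ((min_le_right _ _).trans ((min_le_right _ _).trans
        ((min_le_right _ _).trans (min_le_left _ _))))
    · exact (min_le_right _ _).trans ((min_le_right _ _).trans ((min_le_right _ _).trans
        ((min_le_right _ _).trans (min_le_right _ _))))
  have strip_im : ∀ υ ∈ truncatedStrip η, -η < σ * υ.im ∧ σ * υ.im < η := fun υ h => by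
    have := abs_lt.1 h.1
    rcases hσ with rfl | rfl <;> constructor <;> linarith [this.1, this.2]
  have sub1 : ∀ υ : ℂ, pairBox σ (-δ) 0 (M + 1) 0 δ (-m + 1) υ ⊆
      {y | y ∈ slitStrip δ (X + ε) (M + 1) ∧ υ - y ∈ slitStrip δ (-X + ε) (-m + 1)} := fun υ =>
    pairBox_subset hσ le_rfl (by linarith) le_rfl (Or.inr (Or.inr le_rfl)) (by linarith) le_rfl
      le_rfl (Or.inr (Or.inl le_rfl))
  have sub2 : ∀ υ : ℂ, pairBox σ (-δ) δ (X + η) (-δ) δ (-X + η) υ ⊆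
      {y | y ∈ slitStrip δ (X + ε) (M + 1) ∧ υ - y ∈ slitStrip δ (-X + ε) (-m + 1)} := fun υ =>
    pairBox_subset hσ le_rfl le_rfl (by linarith) (Or.inl (by linarith)) le_rfl le_rfl
      (by linarith) (Or.inl (by linarith))
  have sub3 : ∀ υ : ℂ, pairBox σ 0 δ (M + 1) (-δ) 0 (-m + 1) υ ⊆
      {y | y ∈ slitStrip δ (X + ε) (M + 1) ∧ υ - y ∈ slitStrip δ (-X + ε) (-m + 1)} := fun υ =>
    pairBox_subset hσ (by linarith) le_rfl le_rfl (Or.inr (Or.inl le_rfl)) le_rfl (by linarith)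
      le_rfl (Or.inr (Or.inr le_rfl))
  have re : ∀ x c : ℝ, ((x : ℂ) + (σ * c : ℝ) * I).re = x := fun x c => by simp
  have im := fun x c : ℝ => sign_mul_im_mk hσ x c
  have mem : ∀ {l₁ u₁ r₁ l₂ u₂ r₂ x c : ℝ} {υ : ℂ}, l₁ < c → c < u₁ → x < r₁ → l₂ < σ * υ.im - c →
      σ * υ.im - c < u₂ → υ.re - x < r₂ →
      (x : ℂ) + (σ * c : ℝ) * I ∈ pairBox σ l₁ u₁ r₁ l₂ u₂ r₂ υ := by
    intro l₁ u₁ r₁ l₂ u₂ r₂ x c υ h1 h2 h3 h4 h5 h6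
    refine ⟨⟨?_, ?_, ?_⟩, ?_, ?_, ?_⟩ <;> simp only [sub_im, sub_re, mul_sub, re, im] <;> assumption
  refine ⟨η, hη0, M - m, fun υ =>
    segInt (pairKernel f g υ) (m + (σ * a : ℝ) * I) (X + (σ * a : ℝ) * I) +
    segInt (pairKernel f g υ) (X + (σ * a : ℝ) * I) (X + (σ * b : ℝ) * I) +
    segInt (pairKernel f g υ) (X + (σ * b : ℝ) * I) (m + (σ * b : ℝ) * I), ?_, ?_⟩
  · have hs := isOpen_truncatedStrip η
    have dc : ∀ c : ℂ, DifferentiableOn ℂ (fun _ : ℂ => c) (truncatedStrip η) :=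
      fun c => differentiableOn_const c
    refine (DifferentiableOn.add ?_ ?_).add ?_
    · refine differentiableOn_segInt hs (dc _) (dc _) dU fun υ h y hy => sub1 υ
        (convex_pairBox.segment_subset (mem ?_ ?_ ?_ ?_ ?_ ?_) (mem ?_ ?_ ?_ ?_ ?_ ?_) hy) <;>
        linarith [h.2, (strip_im υ h).1, (strip_im υ h).2]
    · refine differentiableOn_segInt hs (dc _) (dc _) dU fun υ h y hy => sub2 υ
        (convex_pairBox.segment_subset (mem ?_ ?_ ?_ ?_ ?_ ?_) (mem ?_ ?_ ?_ ?_ ?_ ?_) hy) <;>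
        linarith [h.2, (strip_im υ h).1, (strip_im υ h).2]
    · refine differentiableOn_segInt hs (dc _) (dc _) dU fun υ h y hy => sub3 υ
        (convex_pairBox.segment_subset (mem ?_ ?_ ?_ ?_ ?_ ?_) (mem ?_ ?_ ?_ ?_ ?_ ?_) hy) <;>
        linarith [h.2, (strip_im υ h).1, (strip_im υ h).2]
  · intro υ h hN
    have d2 := (pairKernel_differentiableOn_right hfo hgo hf hg υ).mono (sub2 υ)
    have q := strip_im υ h
    have A2 : (m : ℂ) + (σ * a : ℝ) * I ∈ pairBox σ (-δ) δ (X + η) (-δ) δ (-X + η) υ := by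
      apply mem <;> linarith [h.2, q.1, q.2]
    have A2' : (X : ℂ) + (σ * a : ℝ) * I ∈ pairBox σ (-δ) δ (X + η) (-δ) δ (-X + η) υ := by
      apply mem <;> linarith [h.2, q.1, q.2]
    have E2' : (X : ℂ) + (σ * b : ℝ) * I ∈ pairBox σ (-δ) δ (X + η) (-δ) δ (-X + η) υ := by
      apply mem <;> linarith [h.2, q.1, q.2]
    have E2 : (m : ℂ) + (σ * b : ℝ) * I ∈ pairBox σ (-δ) δ (X + η) (-δ) δ (-X + η) υ := by
      apply mem <;> linarith [h.2, q.1, q.2]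
    beta_reduce
    rw [segInt_add isOpen_pairBox convex_pairBox d2 A2 A2' E2',
      segInt_add isOpen_pairBox convex_pairBox d2 A2 E2' E2]

/-! ### Composition over a full turn -/

/-- Chaining alone gives endpoints near $0$ and $2\pi$ that need not differ by exactly $2\pi$; one
more application of the local relation across $2\pi$ reaches $a+2\pi$. -/
theorem exists_full_turn {P : ℝ → ℝ → Prop} (htrans : ∀ x y z, P x y → P y z → P x z)
    (hloc : ∀ t, ∃ δ > 0, ∀ x ∈ Ioo (t - δ) t, ∀ y ∈ Ioo t (t + δ), P x y) :
    ∃ a, P a (a + 2 * Real.pi) := by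
  obtain ⟨δ₁, hδ₁, h1⟩ := hloc (2 * Real.pi)
  obtain ⟨δ, hδ, hδ1, hδ2⟩ : ∃ δ > 0, δ ≤ δ₁ ∧ δ ≤ 1 :=
    ⟨min δ₁ 1, lt_min hδ₁ one_pos, min_le_left _ _, min_le_right _ _⟩
  have hpi := Real.pi_gt_three
  obtain ⟨a, ha, b, hb, hab⟩ := exists_rel_of_locally htrans (a := δ / 2)
    (b := 2 * Real.pi - δ / 2) (by linarith) (fun s _ => hloc s) (ε := δ / 2) (by linarith)
  refine ⟨a, htrans _ _ _ hab (h1 b ⟨by linarith [hb.1], by linarith [hb.2]⟩ _ ⟨?_, ?_⟩)⟩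
  · linarith [ha.1]
  · linarith [ha.2]

/-! ### The Hadamard product as an integral -/

theorem hasSum_taylorCoeff {f F : ℂ → ℂ} {r : ℝ} (hF : DifferentiableOn ℂ F (Metric.ball 0 r))
    (hfF : F =ᶠ[𝓝 0] f) {u : ℂ} (hu : ‖u‖ < r) : HasSum (fun n => taylorCoeff f n * u ^ n) (F u) := by
  have h := Complex.hasSum_taylorSeries_on_ball hF (z := u) (by simpa using hu)
  refine h.congr_fun fun n => ?_
  rw [taylorCoeff, (hfF.iteratedDeriv n).eq_of_nhds, sub_zero, smul_eq_mul, smul_eq_mul]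
  ring

theorem integral_exp_int_mul {n k : ℕ} (c : ℂ) {σ : ℝ} (hσ : σ = 1 ∨ σ = -1) :
    ∫ t in (0 : ℝ)..1, exp (((n : ℂ) - k) * (c + t * (2 * Real.pi * σ * I))) =
      if n = k then 1 else 0 := by
  split_ifs with h
  · simp [h]
  · have hne : ((n : ℂ) - k) * (2 * Real.pi * σ * I) ≠ 0 := by
      have h1 : (n : ℂ) - k ≠ 0 := sub_ne_zero.2 (by exact_mod_cast h)
      have h2 : (σ : ℂ) ≠ 0 := by rcases hσ with rfl | rfl <;> norm_num
      have h3 : (Real.pi : ℂ) ≠ 0 := by exact_mod_cast Real.pi_ne_zero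
      simp [h1, h2, h3]
    have h4 : ∀ t : ℝ, exp (((n : ℂ) - k) * (c + t * (2 * Real.pi * σ * I))) =
        exp (((n : ℂ) - k) * c) * exp (((n : ℂ) - k) * (2 * Real.pi * σ * I) * t) := fun t => by
      rw [← Complex.exp_add]; ring_nf
    simp only [h4]
    rw [intervalIntegral.integral_const_mul, integral_exp_mul_complex hne]
    have h5 : exp (((n : ℂ) - k) * (2 * Real.pi * σ * I)) = 1 := by
      rw [Complex.exp_eq_one_iff]
      rcases hσ with rfl | rfl
      · exact ⟨(n : ℤ) - k, by push_cast; ring⟩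
      · exact ⟨(k : ℤ) - n, by push_cast; ring⟩
    simp [h5]

/-- Multiply the two power series and integrate term by term over the circle through $e^c$: only the
diagonal terms survive. The parameter `t` over $[0,1]$ absorbs the factor $2\pi i$ and the
orientation σ. -/
theorem hadamardProduct_eq_integral {f g F G : ℂ → ℂ} {r s σ : ℝ}
    (hF : DifferentiableOn ℂ F (Metric.ball 0 r)) (hfF : F =ᶠ[𝓝 0] f)
    (hG : DifferentiableOn ℂ G (Metric.ball 0 s)) (hgG : G =ᶠ[𝓝 0] g) (hσ : σ = 1 ∨ σ = -1)
    {c z : ℂ} (hc : ‖exp c‖ < r) (hz : ‖z * exp (-c)‖ < s) :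
    hadamardProduct f g z = ∫ t in (0 : ℝ)..1,
      F (exp (c + t * (2 * Real.pi * σ * I))) * G (z * exp (-(c + t * (2 * Real.pi * σ * I)))) := by
  set x : ℝ → ℂ := fun t => c + t * (2 * Real.pi * σ * I) with hx
  have hxre : ∀ t, (x t).re = c.re := fun t => by simp [hx]
  have hu : ∀ t, ‖exp (x t)‖ = ‖exp c‖ := fun t => by
    rw [Complex.norm_exp, Complex.norm_exp, hxre]
  have hv : ∀ t, ‖z * exp (-x t)‖ = ‖z * exp (-c)‖ := fun t => by
    rw [norm_mul, norm_mul, Complex.norm_exp, Complex.norm_exp, neg_re, neg_re, hxre]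
  obtain ⟨term, hterm⟩ : ∃ term : ℕ × ℕ → ℝ → ℂ, ∀ q t, term q t =
      (taylorCoeff f q.1 * exp (x t) ^ q.1) * (taylorCoeff g q.2 * (z * exp (-x t)) ^ q.2) :=
    ⟨_, fun _ _ => rfl⟩
  have sF : Summable fun n => ‖taylorCoeff f n * exp c ^ n‖ :=
    (hasSum_taylorCoeff hF hfF hc).summable.norm
  have sG : Summable fun n => ‖taylorCoeff g n * (z * exp (-c)) ^ n‖ :=
    (hasSum_taylorCoeff hG hgG hz).summable.norm
  have hbound : Summable fun q : ℕ × ℕ => ‖taylorCoeff f q.1 * exp c ^ q.1‖ *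
      ‖taylorCoeff g q.2 * (z * exp (-c)) ^ q.2‖ :=
    sF.mul_of_nonneg sG (fun _ => norm_nonneg _) fun _ => norm_nonneg _
  have hnorm : ∀ q t, ‖term q t‖ = ‖taylorCoeff f q.1 * exp c ^ q.1‖ *
      ‖taylorCoeff g q.2 * (z * exp (-c)) ^ q.2‖ := fun q t => by
    rw [hterm, norm_mul, norm_mul (taylorCoeff f q.1), norm_mul (taylorCoeff g q.2), norm_pow,
      norm_pow, hu, hv, ← norm_pow, ← norm_pow, ← norm_mul, ← norm_mul]
  have hsum : ∀ t, HasSum (fun q => term q t) (F (exp (x t)) * G (z * exp (-x t))) := fun t => by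
    have h1 := hasSum_taylorCoeff hF hfF (u := exp (x t)) (by rw [hu]; exact hc)
    have h2 := hasSum_taylorCoeff hG hgG (u := z * exp (-x t)) (by rw [hv]; exact hz)
    have h3 : Summable fun q : ℕ × ℕ => term q t :=
      Summable.of_norm (hbound.congr fun q => (hnorm q t).symm)
    exact (h1.mul h2 (h3.congr fun q => hterm q t)).congr_fun fun q => hterm q t
  have hcont : ∀ q, Continuous (term q) := fun q => by
    rw [show term q = _ from funext (hterm q)]
    simp only [hx]
    fun_prop
  have hint : HasSum (fun q => ∫ t in (0 : ℝ)..1, term q t)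
      (∫ t in (0 : ℝ)..1, F (exp (x t)) * G (z * exp (-x t))) :=
    intervalIntegral.hasSum_integral_of_dominated_convergence
      (fun q _ => ‖taylorCoeff f q.1 * exp c ^ q.1‖ * ‖taylorCoeff g q.2 * (z * exp (-c)) ^ q.2‖)
      (fun q => (hcont q).aestronglyMeasurable)
      (fun q => MeasureTheory.ae_of_all _ fun t _ => (hnorm q t).le)
      (MeasureTheory.ae_of_all _ fun t _ => hbound)
      (by simp)
      (MeasureTheory.ae_of_all _ fun t _ => hsum t)
  have hval : ∀ q : ℕ × ℕ, ∫ t in (0 : ℝ)..1, term q t =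
      if q.1 = q.2 then taylorCoeff f q.1 * taylorCoeff g q.2 * z ^ q.2 else 0 := fun q => by
    have : ∀ t, term q t = taylorCoeff f q.1 * taylorCoeff g q.2 * z ^ q.2 *
        exp (((q.1 : ℂ) - q.2) * (c + t * (2 * Real.pi * σ * I))) := fun t => by
      have e : exp (((q.1 : ℂ) - q.2) * x t) = exp (x t) ^ q.1 * exp (-x t) ^ q.2 := by
        rw [← Complex.exp_nat_mul, ← Complex.exp_nat_mul, ← Complex.exp_add]
        ring_nf
      change _ = _ * exp (((q.1 : ℂ) - q.2) * x t)
      rw [e, hterm]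
      ring
    simp only [this]
    rw [intervalIntegral.integral_const_mul, integral_exp_int_mul c hσ]
    split_ifs <;> simp
  simp only [hval] at hint
  have hinj : Function.Injective fun n : ℕ => (n, n) := fun a b h => (Prod.ext_iff.1 h).1
  have hdiag := (hinj.hasSum_iff (f := fun q : ℕ × ℕ =>
    if q.1 = q.2 then taylorCoeff f q.1 * taylorCoeff g q.2 * z ^ q.2 else 0) (fun q hq => by
      rw [if_neg]
      intro h
      exact hq ⟨q.1, Prod.ext rfl h⟩)).2 hint
  simp only [Function.comp_def, if_true] at hdiag
  exact hdiag.tsum_eq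

end

noncomputable section

/-! ### Convolution of principal branches along arcs -/

/-- The integral of `F(u) G(z/u) du/u`, `z = p * exp υ`, along an arc of the circle of radius
`exp m`. -/
def arcIntegral (F G : ℂ → ℂ) (p : ℂ) (σ m a b : ℝ) (υ : ℂ) : ℂ :=
  segInt (pairKernel (fun x => F (exp x)) (fun y => G (p * exp y)) υ)
    (m + (σ * a : ℝ) * I) (m + (σ * b : ℝ) * I)

/-- Singularities of the first factor have modulus at least `exp (m + 1)`, and the opposed
singularities of the second one have modulus at most `exp (M - 1)`. -/
structure IsArcRange (A B : Set ℂ) (p : ℂ) (m M : ℝ) : Prop where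
  le : m + 1 ≤ M
  left : ∀ x : ℂ, x.re < m + 1 → exp x ∈ starDomain A
  right : ∀ y : ℂ, y.re < -M + 1 → p * exp y ∈ starDomain B

/-- Standing assumptions on the set of singularities. -/
structure IsDiscreteAway (A : Set ℂ) : Prop where
  zero_notMem : (0 : ℂ) ∉ A
  finite_inter : ∀ R : ℝ, (A ∩ Metric.closedBall 0 R).Finite

section Basic

variable {F G : ℂ → ℂ} {A B : Set ℂ} {p q : ℂ} {σ m M : ℝ}

theorem notMem_starDomain {α : ℂ} (h : α ∈ A) : α ∉ starDomain A := fun h' =>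
  h' α h 1 le_rfl (by simp)

theorem IsDiscreteAway.isOpen (hA : IsDiscreteAway A) : IsOpen (starDomain A) :=
  isOpen_starDomain hA.zero_notMem hA.finite_inter

theorem IsDiscreteAway.eventually_notMem (hA : IsDiscreteAway A) (hq : q ≠ 0) (X : ℝ) :
    ∀ᶠ x : ℝ in 𝓝[≠] X, q * exp x ∉ A := by
  have hfin : {x : ℝ | q * exp x ∈ A ∩ Metric.closedBall 0 (‖q‖ * Real.exp (X + 1))}.Finite := by
    refine (hA.finite_inter _).preimage fun x _ y _ h => ?_
    have h1 : exp (x : ℂ) = exp (y : ℂ) := mul_left_cancel₀ hq h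
    rw [← ofReal_exp, ← ofReal_exp] at h1
    exact Real.exp_injective (by exact_mod_cast h1)
  have hcl := (hfin.subset (sdiff_subset (t := {X}))).isClosed
  have h1 : ∀ᶠ x : ℝ in 𝓝 X, x ∉ {x : ℝ | q * exp x ∈ A ∩ Metric.closedBall 0
      (‖q‖ * Real.exp (X + 1))} \ {X} := hcl.isOpen_compl.mem_nhds fun h => h.2 rfl
  filter_upwards [nhdsWithin_le_nhds h1, nhdsWithin_le_nhds (Iio_mem_nhds (lt_add_one X)),
    self_mem_nhdsWithin] with x hx1 hx2 hx3 hx4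
  refine hx1 ⟨⟨hx4, ?_⟩, hx3⟩
  rw [mem_closedBall_zero_iff, norm_mul, Complex.norm_exp, ofReal_re]
  gcongr
  exact (mem_Iio.1 hx2).le

theorem differentiableOn_slitStrip (hA : IsDiscreteAway A) (dF : DifferentiableOn ℂ F (starDomain A))
    {δ a b : ℝ} (h1 : ∀ υ : ℂ, υ.im ≠ 0 → |υ.im| < δ → υ.re < b → q * exp υ ∈ starDomain A)
    (h2 : ∀ υ : ℂ, |υ.im| < δ → υ.re < a → q * exp υ ∈ starDomain A) :
    DifferentiableOn ℂ (fun y => F (q * exp y)) (slitStrip δ a b) := by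
  rintro y ⟨hy1, hy2, hy3⟩
  have hmem : q * exp y ∈ starDomain A := by
    rcases hy3 with h | h
    · exact h2 y hy1 h
    · exact h1 y h hy1 hy2
  exact (DifferentiableAt.comp y (dF.differentiableAt (hA.isOpen.mem_nhds hmem))
    ((Complex.differentiable_exp y).const_mul q)).differentiableWithinAt

theorem IsRegularFromSide.extendsAcross (hσ : σ = 1 ∨ σ = -1) (hq : q ≠ 0) {x : ℝ}
    (h : IsRegularFromSide F σ (q * exp x)) : ExtendsAcross σ (fun y => F (q * exp y)) x := by
  obtain ⟨r, hr, Q, dQ, eQ⟩ := h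
  have hc : ContinuousAt (fun y : ℂ => q * exp y) x := by fun_prop
  obtain ⟨s, hs, hs'⟩ := Metric.continuousAt_iff.1 hc r hr
  have hpi := Real.pi_gt_three
  refine ⟨min s 3, lt_min hs (by norm_num), fun y => Q (q * exp y), ?_, fun y hy hy0 => ?_⟩
  · refine dQ.comp (by fun_prop) fun y hy => hs' ?_
    exact (Metric.mem_ball.1 hy).trans_le (min_le_left _ _)
  · refine (eQ _ (hs' ((Metric.mem_ball.1 hy).trans_le (min_le_left _ _))) ?_).symm
    rw [mul_div_mul_left _ _ hq, ← Complex.exp_sub]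
    have him : (y - x).im = y.im := by simp
    refine sign_im_exp_pos hσ (by rwa [him]) ?_
    have h3 : |y.im| < 3 := by
      have := (Complex.abs_im_le_norm (y - x)).trans_lt
        (lt_of_lt_of_le (by rw [← dist_eq_norm]; exact Metric.mem_ball.1 hy) (min_le_right s 3))
      rwa [him] at this
    rw [him]
    have := abs_lt.1 h3
    rcases hσ with rfl | rfl <;> linarith [this.1, this.2]

/-- Rotating `u` moves the direction $e^c$ to the positive real axis, so that one model strip serves
for every direction. -/
theorem pairKernel_rotate (F G : ℂ → ℂ) (p c υ y : ℂ) :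
    pairKernel (fun x => F (exp x)) (fun y => G (p * exp y)) υ (c + y) =
      pairKernel (fun y => F (exp c * exp y)) (fun y => G (p * exp (-c) * exp y)) υ y := by
  rw [pairKernel, pairKernel, ← Complex.exp_add, mul_assoc, ← Complex.exp_add]
  ring_nf

theorem arcIntegral_rotate (F G : ℂ → ℂ) (p : ℂ) (σ m t a b : ℝ) (υ : ℂ) :
    arcIntegral F G p σ m (t + a) (t + b) υ =
      segInt (pairKernel (fun y => F (exp ((σ * t : ℝ) * I) * exp y))
        (fun y => G (p * exp (-((σ * t : ℝ) * I)) * exp y)) υ)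
        (m + (σ * a : ℝ) * I) (m + (σ * b : ℝ) * I) := by
  rw [arcIntegral]
  have e : ∀ a : ℝ, (m : ℂ) + (σ * (t + a) : ℝ) * I = (σ * t : ℝ) * I + (m + (σ * a : ℝ) * I) :=
    fun a => by push_cast; ring
  rw [e, e, segInt_translate]
  simp only [pairKernel_rotate]

theorem arcIntegral_add (hA : IsDiscreteAway A) (hB : IsDiscreteAway B)
    (dF : DifferentiableOn ℂ F (starDomain A)) (dG : DifferentiableOn ℂ G (starDomain B))
    (hr : IsArcRange A B p m M) {a b c : ℝ} {υ : ℂ} (hυ : υ.re < m - M) :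
    arcIntegral F G p σ m a b υ + arcIntegral F G p σ m b c υ = arcIntegral F G p σ m a c υ := by
  have d1 : DifferentiableOn ℂ (fun x => F (exp x)) {x | x.re < m + 1} := fun x hx =>
    (DifferentiableAt.comp x (dF.differentiableAt (hA.isOpen.mem_nhds (hr.left x hx)))
      (Complex.differentiable_exp x)).differentiableWithinAt
  have d2 : DifferentiableOn ℂ (fun y => G (p * exp y)) {y | y.re < -M + 1} := fun x hx =>
    (DifferentiableAt.comp x (dG.differentiableAt (hB.isOpen.mem_nhds (hr.right x hx)))
      ((Complex.differentiable_exp x).const_mul p)).differentiableWithinAt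
  have o1 : IsOpen {x : ℂ | x.re < m + 1} := isOpen_lt continuous_re continuous_const
  have o2 : IsOpen {y : ℂ | y.re < -M + 1} := isOpen_lt continuous_re continuous_const
  have hK : {y : ℂ | y ∈ {x : ℂ | x.re < m + 1} ∧ υ - y ∈ {y : ℂ | y.re < -M + 1}} =
      {y : ℂ | y.re < m + 1} ∩ {y : ℂ | υ.re + M - 1 < y.re} := by
    ext y
    simp only [mem_ofPred_eq, mem_inter_iff, sub_re, and_congr_right_iff]
    intro _
    constructor <;> intro h <;> linarith
  have hd := pairKernel_differentiableOn_right o1 o2 d1 d2 υ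
  rw [hK] at hd
  have mem : ∀ a : ℝ, (m : ℂ) + (σ * a : ℝ) * I ∈ {y : ℂ | y.re < m + 1} ∩
      {y : ℂ | υ.re + M - 1 < y.re} := fun a => by
    have : ((m : ℂ) + (σ * a : ℝ) * I).re = m := by simp
    simp only [mem_inter_iff, mem_ofPred_eq, this]
    constructor <;> linarith
  exact segInt_add (o1.inter (isOpen_lt continuous_const continuous_re))
    ((convex_halfSpace_re_lt _).inter (convex_halfSpace_re_gt _)) hd (mem a) (mem b) (mem c)

end Basic

/-! ### Principal branch: continuation of the full circle integral -/

section Open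

variable {F G : ℂ → ℂ} {A B : Set ℂ} {p : ℂ} {σ m M : ℝ}

/-- In every direction there is a radius separating the opposed singularities. -/
theorem exists_separating_radius (hA : IsDiscreteAway A) (hB : IsDiscreteAway B)
    (hr : IsArcRange A B p m M) (hp : p ∈ starDomain (image2 (· * ·) A B)) (c : ℂ)
    (hc : c.re = 0) : ∃ X ∈ Icc m M, exp c * exp X ∈ starDomain A ∧
      p * exp (-c) * exp (-X) ∈ starDomain B := by
  have c1 : Continuous fun x : ℝ => exp c * exp (x : ℂ) := by fun_prop
  have c2 : Continuous fun x : ℝ => p * exp (-c) * exp (-(x : ℂ)) := by fun_prop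
  -- If both factors were cut at the same radius, `p` would be $st\,\alpha\beta$ with $st\ge1$,
  -- hence on a cut of the product set.
  have hcover : Icc m M ⊆ {x : ℝ | exp c * exp (x : ℂ) ∈ starDomain A} ∪
      {x : ℝ | p * exp (-c) * exp (-(x : ℂ)) ∈ starDomain B} := by
    intro x _
    by_contra hcon
    simp only [mem_union, mem_ofPred_eq, not_or] at hcon
    obtain ⟨h1, h2⟩ := hcon
    simp only [starDomain, mem_ofPred_eq, ne_eq] at h1 h2
    push Not at h1 h2
    obtain ⟨α, hα, s, hs, e1⟩ := h1
    obtain ⟨β, hβ, t, ht, e2⟩ := h2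
    refine hp _ ⟨α, hα, β, hβ, rfl⟩ (s * t) (one_le_mul_of_one_le_of_one_le hs ht) ?_
    have : p = (exp c * exp (x : ℂ)) * (p * exp (-c) * exp (-(x : ℂ))) := by
      rw [Complex.exp_neg, Complex.exp_neg]
      have h3 := Complex.exp_ne_zero c
      have h4 := Complex.exp_ne_zero (x : ℂ)
      field_simp
    rw [this, e1, e2]
    push_cast
    ring
  have hmM : m ≤ M := by linarith [hr.le]
  -- Two open sets cover $[m,M]$ and contain `m` and `M` respectively, so by connectedness they meet
  -- inside it.
  obtain ⟨X, hX, hX1, hX2⟩ := isPreconnected_Icc _ _ (hA.isOpen.preimage c1) (hB.isOpen.preimage c2)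
    hcover ⟨m, ⟨le_rfl, hmM⟩, by
      change exp c * exp (m : ℂ) ∈ starDomain A
      rw [← Complex.exp_add]
      exact hr.left _ (by simp [hc])⟩ ⟨M, ⟨hmM, le_rfl⟩, by
      change p * exp (-c) * exp (-(M : ℂ)) ∈ starDomain B
      rw [mul_assoc, ← Complex.exp_add]
      exact hr.right _ (by simp [hc])⟩
  exact ⟨X, hX, hX1, hX2⟩

/-- Off the axis a thin sector is free of cuts; on the axis star-shapedness propagates from a
neighbourhood of `X` to all smaller abscissas. -/
theorem exists_thin_strip_subset (hA : IsDiscreteAway A) {q : ℂ} (hq : q ≠ 0) (R : ℝ) {X : ℝ}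
    (hX : q * exp X ∈ starDomain A) :
    ∃ δ > 0, (∀ υ : ℂ, υ.im ≠ 0 → |υ.im| < δ → υ.re < R → q * exp υ ∈ starDomain A) ∧
      ∀ υ : ℂ, |υ.im| < δ → υ.re < min R (X + δ) → q * exp υ ∈ starDomain A := by
  obtain ⟨δ₁, hδ₁, h1⟩ := exists_sector_subset_starDomain hA.zero_notMem hA.finite_inter hq R
  have hc : Continuous fun x : ℝ => q * exp (x : ℂ) := by fun_prop
  obtain ⟨δ₂, hδ₂, h2⟩ := Metric.isOpen_iff.1 (hA.isOpen.preimage hc) X hX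
  refine ⟨min δ₁ δ₂, lt_min hδ₁ hδ₂, fun υ h h' h'' => h1 υ h (h'.trans_le (min_le_left _ _)) h'',
    fun υ h h' => ?_⟩
  by_cases him : υ.im = 0
  swap
  · exact h1 υ him (h.trans_le (min_le_left _ _)) (h'.trans_le (min_le_left _ _))
  have hυ : υ = (υ.re : ℂ) := Complex.ext (by simp) (by simp [him])
  set x₀ := max υ.re X with hx₀
  have hx₀m : q * exp (x₀ : ℂ) ∈ starDomain A := by
    refine h2 ?_
    have h3 := h'.trans_le (min_le_right _ _)
    have h4 := min_le_right δ₁ δ₂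
    rw [Metric.mem_ball, Real.dist_eq, abs_lt]
    constructor
    · linarith [le_max_right υ.re X]
    · have : x₀ < X + δ₂ := max_lt (by linarith) (by linarith)
      linarith
  have h5 := smul_mem_starDomain hA.zero_notMem hx₀m (s := Real.exp (υ.re - x₀)) (Real.exp_pos _).le
    (Real.exp_le_one_iff.2 (by linarith [le_max_left υ.re X]))
  have h6 : ((Real.exp (υ.re - x₀) : ℝ) : ℂ) * (q * exp (x₀ : ℂ)) = q * exp υ := by
    rw [ofReal_exp, mul_left_comm, ← Complex.exp_add]
    conv_rhs => rw [hυ]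
    push_cast
    ring_nf
  rwa [h6] at h5

/-- Continuability of an arc integral is transitive in the endpoints by additivity, and holds
locally by the separating radius of each direction. -/
theorem exists_open_continuation (hA : IsDiscreteAway A) (hB : IsDiscreteAway B)
    (dF : DifferentiableOn ℂ F (starDomain A)) (dG : DifferentiableOn ℂ G (starDomain B))
    (hσ : σ = 1 ∨ σ = -1) (hr : IsArcRange A B p m M) (hp0 : p ≠ 0)
    (hp : p ∈ starDomain (image2 (· * ·) A B)) :
    ∃ a : ℝ, ∃ η > 0, ∃ N : ℝ, ∃ T : ℂ → ℂ, DifferentiableOn ℂ T (truncatedStrip η) ∧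
      ∀ υ ∈ truncatedStrip η, υ.re < -N →
        T υ = arcIntegral F G p σ m a (a + 2 * Real.pi) υ := by
  refine exists_full_turn (P := fun a b => ∃ η > 0, ∃ N : ℝ, ∃ T : ℂ → ℂ,
    DifferentiableOn ℂ T (truncatedStrip η) ∧
      ∀ υ ∈ truncatedStrip η, υ.re < -N → T υ = arcIntegral F G p σ m a b υ) ?_ ?_
  · rintro x y z ⟨η₁, hη₁, N₁, T₁, d₁, e₁⟩ ⟨η₂, hη₂, N₂, T₂, d₂, e₂⟩
    have s1 : truncatedStrip (min η₁ η₂) ⊆ truncatedStrip η₁ := fun υ h =>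
      ⟨h.1.trans_le (min_le_left _ _), h.2.trans_le (min_le_left _ _)⟩
    have s2 : truncatedStrip (min η₁ η₂) ⊆ truncatedStrip η₂ := fun υ h =>
      ⟨h.1.trans_le (min_le_right _ _), h.2.trans_le (min_le_right _ _)⟩
    refine ⟨min η₁ η₂, lt_min hη₁ hη₂, max (max N₁ N₂) (M - m), fun υ => T₁ υ + T₂ υ,
      (d₁.mono s1).add (d₂.mono s2), fun υ h hN => ?_⟩
    have k1 := (le_max_left N₁ N₂).trans (le_max_left _ (M - m))
    have k2 := (le_max_right N₁ N₂).trans (le_max_left _ (M - m))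
    have k3 := le_max_right (max N₁ N₂) (M - m)
    beta_reduce
    rw [e₁ υ (s1 h) (by linarith), e₂ υ (s2 h) (by linarith),
      arcIntegral_add hA hB dF dG hr (by linarith)]
  · intro t
    set c : ℂ := (σ * t : ℝ) * I with hc
    obtain ⟨X, hX, hX1, hX2⟩ := exists_separating_radius hA hB hr hp c (by simp [hc])
    obtain ⟨δ₁, hδ₁, f1, f2⟩ := exists_thin_strip_subset hA (Complex.exp_ne_zero c) (M + 1) hX1
    obtain ⟨δ₂, hδ₂, g1, g2⟩ := exists_thin_strip_subset hB (q := p * exp (-c)) (X := -X)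
      (mul_ne_zero hp0 (Complex.exp_ne_zero _)) (-m + 1) (by rw [ofReal_neg]; exact hX2)
    obtain ⟨δ, hδ, hδ1, hδ2, hδ3⟩ : ∃ δ > 0, δ ≤ δ₁ ∧ δ ≤ δ₂ ∧ δ ≤ 1 :=
      ⟨min δ₁ (min δ₂ 1), lt_min hδ₁ (lt_min hδ₂ one_pos), min_le_left _ _,
        (min_le_right _ _).trans (min_le_left _ _), (min_le_right _ _).trans (min_le_right _ _)⟩
    refine ⟨δ, hδ, fun a ha b hb => ?_⟩
    have df : DifferentiableOn ℂ (fun y => F (exp c * exp y)) (slitStrip δ (X + δ) (M + 1)) :=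
      differentiableOn_slitStrip hA dF (fun υ h h' => f1 υ h (h'.trans_le hδ1)) fun υ h h' =>
        f2 υ (h.trans_le hδ1) (lt_min (by linarith [hX.2]) (by linarith))
    have dg : DifferentiableOn ℂ (fun y => G (p * exp (-c) * exp y))
        (slitStrip δ (-X + δ) (-m + 1)) :=
      differentiableOn_slitStrip hB dG (fun υ h h' => g1 υ h (h'.trans_le hδ2)) fun υ h h' =>
        g2 υ (h.trans_le hδ2) (lt_min (by linarith [hX.1]) (by linarith))
    obtain ⟨η, hη, N, T, dT, eT⟩ := exists_continuation_to_truncatedStrip (a := a - t) (b := b - t)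
      hσ df dg hδ hX.1 hX.2 (by linarith [ha.1]) (by linarith [ha.2]) (by linarith [hb.1])
      (by linarith [hb.2])
    refine ⟨η, hη, N, T, dT, fun υ h hN => ?_⟩
    rw [eT υ h hN, ← arcIntegral_rotate, add_sub_cancel, add_sub_cancel]

end Open

end

noncomputable section

/-! ### Continuation of the full circle integral up to a singularity -/

/-- The value of a convergent convolution integral. -/
def convValue (φ ψ : ℂ → ℂ) (w : ℂ) : ℂ := Classical.epsilon (HasConvolutionIntegral φ ψ w)

theorem HasConvolutionIntegral.convValue_eq {φ ψ : ℂ → ℂ} {w L : ℂ}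
    (h : HasConvolutionIntegral φ ψ w L) : convValue φ ψ w = L :=
  HasConvolutionIntegral.unique (Classical.epsilon_spec (p := HasConvolutionIntegral φ ψ w) ⟨L, h⟩) h

/-- Logarithms `x` of the singularities `α = exp x` of the first factor for which `p / α` is a
singularity of the second one. -/
def opposedPoints (A B : Set ℂ) (p : ℂ) : Set ℂ := {x | exp x ∈ A ∧ p * exp (-x) ∈ B}

/-- The convolution of the variations at the point `exp x` and at the opposed point. -/
def opposedConv (Φ Ψ : ℂ → ℂ → ℂ) (p x ω : ℂ) : ℂ :=
  convValue (monodromyDelta (Φ (exp x))) (monodromyDelta (Ψ (p * exp (-x)))) ω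

/-- Principal branches with isolated singularities, together with a choice of integrable
local branches. -/
structure HasSmallBranches (F : ℂ → ℂ) (A : Set ℂ) (σ : ℝ) (Φ : ℂ → ℂ → ℂ) : Prop where
  discrete : IsDiscreteAway A
  differentiableOn : DifferentiableOn ℂ F (starDomain A)
  regular : ∀ q : ℂ, q ∉ A → IsRegularFromSide F σ q
  isLocalBranch : ∀ α : ℂ, α ≠ 0 → IsLocalBranch F σ α (Φ α)
  isSmallBranch : ∀ α : ℂ, α ≠ 0 → IsSmallBranch (Φ α)
  delta_eq_zero : ∀ α : ℂ, α ≠ 0 → α ∉ A → ∀ w, monodromyDelta (Φ α) w = 0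

section

variable {F G : ℂ → ℂ} {A B : Set ℂ} {p : ℂ} {σ m M : ℝ} {Φ Ψ : ℂ → ℂ → ℂ}

theorem re_mem_of_mem_opposedPoints (hr : IsArcRange A B p m M) {x : ℂ}
    (hx : x ∈ opposedPoints A B p) : m + 1 ≤ x.re ∧ x.re ≤ M - 1 := by
  constructor
  · by_contra hcon
    exact notMem_starDomain hx.1 (hr.left x (not_le.1 hcon))
  · by_contra hcon
    exact notMem_starDomain hx.2 (hr.right (-x) (by rw [neg_re]; linarith [not_le.1 hcon]))

theorem finite_opposedPoints (hA : IsDiscreteAway A) (hr : IsArcRange A B p m M) (C : ℝ) :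
    {x | x ∈ opposedPoints A B p ∧ |x.im| ≤ C}.Finite := by
  have hfin := hA.finite_inter (Real.exp (M - 1))
  obtain ⟨N, hN⟩ := exists_nat_gt ((C + Real.pi) / (2 * Real.pi))
  have hpi := Real.pi_pos
  rw [div_lt_iff₀ (by positivity)] at hN
  refine ((hfin.image2 (fun α (n : ℤ) => Complex.log α + n * (2 * Real.pi * I))
    (finite_Icc (-(N : ℤ)) N))).subset fun x hx => ?_
  have h0 : exp x ≠ 0 := Complex.exp_ne_zero x
  have hex : exp x = exp (Complex.log (exp x)) := (Complex.exp_log h0).symm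
  obtain ⟨n, hn⟩ := Complex.exp_eq_exp_iff_exists_int.1 hex
  refine ⟨exp x, ⟨hx.1.1, ?_⟩, n, ?_, hn.symm⟩
  · rw [mem_closedBall_zero_iff, Complex.norm_exp]
    exact Real.exp_le_exp.2 (re_mem_of_mem_opposedPoints hr hx.1).2
  · have him : x.im = (Complex.log (exp x)).im + n * (2 * Real.pi) := by
      conv_lhs => rw [hn]
      simp
    have h1 := abs_le.1 (abs_log_im_le_pi (exp x))
    have h2 := abs_le.1 hx.2
    have h3 : (n : ℝ) * (2 * Real.pi) < (N : ℝ) * (2 * Real.pi) := by linarith [h1.1, h2.2]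
    have h4 : (-(N : ℝ)) * (2 * Real.pi) < (n : ℝ) * (2 * Real.pi) := by linarith [h1.2, h2.1]
    have h5 := lt_of_mul_lt_mul_right h3 (by positivity)
    have h6 := lt_of_mul_lt_mul_right h4 (by positivity)
    constructor
    · exact_mod_cast h6.le
    · exact_mod_cast h5.le

/-- The pinch produced by the opposed singularities on a segment of the half-line of direction
`exp c`. -/
theorem exists_radial_pinch_locally (hσ : σ = 1 ∨ σ = -1) (hF : HasSmallBranches F A σ Φ)
    (hG : HasSmallBranches G B σ Ψ) (hp : p ≠ 0) (c : ℂ) (X : ℝ) :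
    ∃ δ > 0, ∀ x ∈ Ioo (X - δ) X, ∀ y ∈ Ioo X (X + δ),
      ((exp c * exp x ∉ A ∧ p * exp (-c) * exp (-x) ∉ B) ∧
        (exp c * exp y ∉ A ∧ p * exp (-c) * exp (-y) ∉ B)) ∧
      IsPinch σ (HasSideIntegral (fun y => F (exp c * exp y)) (fun y => G (p * exp (-c) * exp y))
        σ x y) fun ω => -σ * ∑ᶠ s ∈ {s : ℂ | s ∈ opposedPoints A B p ∧ s.im = c.im ∧
          x < (s - c).re ∧ (s - c).re < y}, opposedConv Φ Ψ p s ω := by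
  set α := exp (c + X) with hα
  set β := p * exp (-(c + X)) with hβ
  have hα0 : α ≠ 0 := Complex.exp_ne_zero _
  have hβ0 : β ≠ 0 := mul_ne_zero hp (Complex.exp_ne_zero _)
  obtain ⟨δ₁, hδ₁, h1⟩ := exists_local_convolution hσ (hF.isLocalBranch α hα0)
    (hG.isLocalBranch β hβ0) (hF.isSmallBranch α hα0) (hG.isSmallBranch β hβ0)
  have e1 := hF.discrete.eventually_notMem (Complex.exp_ne_zero c) X
  have e2 := hG.discrete.eventually_notMem (mul_ne_zero hp (Complex.exp_ne_zero (-c))) (-X)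
  have tneg : Tendsto (fun x : ℝ => -x) (𝓝[≠] X) (𝓝[≠] (-X)) := by
    refine tendsto_nhdsWithin_iff.2 ⟨?_, ?_⟩
    · exact (continuous_neg.tendsto X).mono_left nhdsWithin_le_nhds
    · filter_upwards [self_mem_nhdsWithin] with x hx h
      exact hx (neg_injective h)
  have e3 := e1.and (tneg.eventually e2)
  rw [eventually_nhdsWithin_iff, Metric.eventually_nhds_iff] at e3
  obtain ⟨δ₂, hδ₂, h2⟩ := e3
  have reg : ∀ x : ℝ, |x - X| < δ₂ → x ≠ X →
      exp c * exp (x : ℂ) ∉ A ∧ p * exp (-c) * exp (-(x : ℂ)) ∉ B := fun x hx hne => by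
    have := h2 (y := x) (by rwa [Real.dist_eq]) hne
    rwa [ofReal_neg] at this
  refine ⟨min δ₁ δ₂, lt_min hδ₁ hδ₂, fun x hx y hy => ?_⟩
  have l1 := min_le_left δ₁ δ₂
  have l2 := min_le_right δ₁ δ₂
  refine ⟨⟨reg x (abs_lt.2 ⟨by linarith [hx.1], by linarith [hx.2]⟩) hx.2.ne,
    reg y (abs_lt.2 ⟨by linarith [hy.1], by linarith [hy.2]⟩) hy.1.ne'⟩, ?_⟩
  obtain ⟨ρ, hρ, Θ, d, s, lim, conv⟩ := h1 (x - X) ⟨by linarith [hx.1], by linarith [hx.2]⟩ (y - X)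
    ⟨by linarith [hy.1], by linarith [hy.2]⟩
  have lt1 : ∀ {w : ℂ}, ‖exp w‖ < min ρ (1 / 4) → ‖exp w‖ < ρ := fun h => h.trans_le (min_le_left _ _)
  refine ⟨min ρ (1 / 4), lt_min hρ (by norm_num), Θ, d.mono fun w hw => lt1 hw, s,
    fun ω hω h0 hpi => ?_, fun ω hω => ?_⟩
  · obtain ⟨k1, k2⟩ := lim ω (lt1 hω) h0 hpi
    have hexp : exp (Complex.log (1 + exp ω)) = 1 + exp ω :=
      Complex.exp_log (one_add_exp_ne_zero le_rfl (hω.trans_le (min_le_right _ _)))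
    have ker : ∀ h t : ℝ, pairKernel (fun y => F (exp c * exp y))
        (fun y => G (p * exp (-c) * exp y)) (Complex.log (1 + exp ω)) ((t : ℂ) + (σ * h : ℝ) * I) =
        F (α * exp (((t - X : ℝ) : ℂ) + (σ * h : ℝ) * I)) *
          G (β * (1 + exp ω) * exp (-(((t - X : ℝ) : ℂ) + (σ * h : ℝ) * I))) := by
      intro h t
      rw [pairKernel]
      congr 2
      · rw [hα, ← Complex.exp_add, ← Complex.exp_add]
        push_cast
        ring_nf
      · generalize Complex.log (1 + exp ω) = υ at hexp
        rw [hβ, ← hexp, mul_assoc, mul_assoc, mul_assoc, ← Complex.exp_add, ← Complex.exp_add,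
          ← Complex.exp_add]
        push_cast
        ring_nf
    refine ⟨?_, ?_⟩
    · filter_upwards [k1] with h hh
      have := hh.comp_sub_right X
      rw [sub_add_cancel, sub_add_cancel] at this
      refine this.congr (fun t _ => (ker h t).symm)
    · refine k2.congr fun h => ?_
      simp only [ker]
      exact (intervalIntegral.integral_comp_sub_right (fun t : ℝ => F (α * exp ((t : ℂ) +
        (σ * h : ℝ) * I)) * G (β * (1 + exp ω) * exp (-((t : ℂ) + (σ * h : ℝ) * I)))) X).symm
  · have hconv := conv ω (lt1 hω)
    have hσσ : (σ : ℂ) * σ = 1 := by rcases hσ with rfl | rfl <;> norm_num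
    -- Within `δ₂` of `X` the ray carries no other singularity, so at most the point over `X` is
    -- opposed.
    have hsub : {s : ℂ | s ∈ opposedPoints A B p ∧ s.im = c.im ∧ x < (s - c).re ∧ (s - c).re < y} ⊆
        {c + X} := by
      rintro s ⟨hs, him, hs1, hs2⟩
      have hsc : s = c + ((s - c).re : ℂ) := by
        apply Complex.ext <;> simp [him]
      by_contra hne
      refine (reg (s - c).re (abs_lt.2 ⟨by linarith [hx.1], by linarith [hy.2]⟩) fun h => ?_).1 ?_
      · exact hne (by rw [mem_singleton_iff, hsc, h])
      · rw [← Complex.exp_add, ← hsc]; exact hs.1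
    have hval : ∑ᶠ s ∈ {s : ℂ | s ∈ opposedPoints A B p ∧ s.im = c.im ∧ x < (s - c).re ∧
        (s - c).re < y}, opposedConv Φ Ψ p s ω = -σ * (Θ (ω + 2 * Real.pi * I) - Θ ω) := by
      by_cases hX : c + X ∈ opposedPoints A B p
      · have : {s : ℂ | s ∈ opposedPoints A B p ∧ s.im = c.im ∧ x < (s - c).re ∧ (s - c).re < y} =
            {c + (X : ℂ)} := by
          refine subset_antisymm hsub (singleton_subset_iff.2 ⟨hX, by simp, ?_, ?_⟩)
          · simpa using hx.2
          · simpa using hy.1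
        rw [this, finsum_mem_singleton]
        exact hconv.convValue_eq
      · have : {s : ℂ | s ∈ opposedPoints A B p ∧ s.im = c.im ∧ x < (s - c).re ∧ (s - c).re < y} =
            ∅ := by
          refine eq_empty_of_forall_notMem fun s hs => hX ?_
          have := hsub hs
          rw [mem_singleton_iff] at this
          exact this ▸ hs.1
        rw [this, finsum_mem_empty]
        -- When $c+X$ is not opposed, one of the two factors is regular and has no variation;
        -- uniqueness of the limit then makes the variation of `Θ` vanish.
        have hzero : ∀ u v, monodromyDelta (Φ α) u * monodromyDelta (Ψ β) v = 0 := fun u v => by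
          by_cases h : α ∈ A
          · rw [hG.delta_eq_zero β hβ0 (fun h' => hX ⟨h, h'⟩) v, mul_zero]
          · rw [hF.delta_eq_zero α hα0 h u, zero_mul]
        exact (hasConvolutionIntegral_of_mul_eq_zero hzero ω).unique hconv
    beta_reduce
    rw [hval]
    linear_combination -(Θ (ω + 2 * Real.pi * I) - Θ ω) * hσσ

/-- Pinches over adjacent segments add up. Keeping the endpoints regular in the relation ensures
that no opposed point is lost at a junction. -/
theorem exists_radial_pinch (hσ : σ = 1 ∨ σ = -1) (hF : HasSmallBranches F A σ Φ)
    (hG : HasSmallBranches G B σ Ψ) (hp : p ≠ 0) (hr : IsArcRange A B p m M) (c : ℂ) :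
    ∃ x ∈ Ioo m (m + 1 / 2), ∃ y ∈ Ioo (M - 1 / 2) M,
      ((exp c * exp x ∉ A ∧ p * exp (-c) * exp (-x) ∉ B) ∧
        (exp c * exp y ∉ A ∧ p * exp (-c) * exp (-y) ∉ B)) ∧
      IsPinch σ (HasSideIntegral (fun y => F (exp c * exp y)) (fun y => G (p * exp (-c) * exp y))
        σ x y) fun ω => -σ * ∑ᶠ s ∈ {s : ℂ | s ∈ opposedPoints A B p ∧ s.im = c.im ∧
          x < (s - c).re ∧ (s - c).re < y}, opposedConv Φ Ψ p s ω := by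
  set P : ℝ → ℝ → Prop := fun x y => x < y ∧
    ((exp c * exp x ∉ A ∧ p * exp (-c) * exp (-x) ∉ B) ∧
      (exp c * exp y ∉ A ∧ p * exp (-c) * exp (-y) ∉ B)) ∧
    IsPinch σ (HasSideIntegral (fun y => F (exp c * exp y)) (fun y => G (p * exp (-c) * exp y))
      σ x y) fun ω => -σ * ∑ᶠ s ∈ {s : ℂ | s ∈ opposedPoints A B p ∧ s.im = c.im ∧
        x < (s - c).re ∧ (s - c).re < y}, opposedConv Φ Ψ p s ω with hP
  have trans : ∀ x y z, P x y → P y z → P x z := by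
    rintro x y z ⟨hxy, ⟨r1, r2⟩, h1⟩ ⟨hyz, ⟨-, r3⟩, h2⟩
    refine ⟨hxy.trans hyz, ⟨r1, r3⟩, (h1.add h2 fun υ c₁ c₂ k1 k2 => k1.add k2).congr_variation
      fun ω => ?_⟩
    have fin : ∀ a b : ℝ, {s : ℂ | s ∈ opposedPoints A B p ∧ s.im = c.im ∧
        a < (s - c).re ∧ (s - c).re < b}.Finite := fun a b =>
      (finite_opposedPoints hF.discrete hr |c.im|).subset fun s hs => ⟨hs.1, by rw [hs.2.1]⟩
    have hunion : {s : ℂ | s ∈ opposedPoints A B p ∧ s.im = c.im ∧ x < (s - c).re ∧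
        (s - c).re < z} = {s : ℂ | s ∈ opposedPoints A B p ∧ s.im = c.im ∧ x < (s - c).re ∧
        (s - c).re < y} ∪ {s : ℂ | s ∈ opposedPoints A B p ∧ s.im = c.im ∧ y < (s - c).re ∧
        (s - c).re < z} := by
      refine subset_antisymm ?_ (union_subset ?_ ?_)
      · rintro s ⟨hs, him, k1, k2⟩
        rcases lt_trichotomy (s - c).re y with h | h | h
        · exact Or.inl ⟨hs, him, k1, h⟩
        · refine absurd ?_ r2.1
          have hsc : s = c + (y : ℂ) := by
            apply Complex.ext <;> simp [him, ← h]
          rw [← Complex.exp_add, ← hsc]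
          exact hs.1
        · exact Or.inr ⟨hs, him, h, k2⟩
      · exact fun s hs => ⟨hs.1, hs.2.1, hs.2.2.1, hs.2.2.2.trans hyz⟩
      · exact fun s hs => ⟨hs.1, hs.2.1, hxy.trans hs.2.2.1, hs.2.2.2⟩
    rw [← mul_add, hunion, finsum_mem_union _ (fin x y) (fin y z)]
    rw [disjoint_left]
    rintro s ⟨_, _, _, k1⟩ ⟨_, _, k2, _⟩
    linarith
  have hloc : ∀ X : ℝ, ∃ δ > 0, ∀ x ∈ Ioo (X - δ) X, ∀ y ∈ Ioo X (X + δ), P x y := fun X => by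
    obtain ⟨δ, hδ, h⟩ := exists_radial_pinch_locally hσ hF hG hp c X
    exact ⟨δ, hδ, fun x hx y hy => ⟨hx.2.trans hy.1, h x hx y hy⟩⟩
  obtain ⟨x, hx, y, hy, -, h⟩ := exists_rel_of_locally trans (a := m + 1 / 2)
    (b := M - 1 / 2) (by linarith [hr.le]) (fun X _ => hloc X) (ε := 1 / 2) (by norm_num)
  exact ⟨x, ⟨by linarith [hx.1], hx.2⟩, y, ⟨hy.1, by linarith [hy.2]⟩, h⟩

end

end

/-! ### Pinched arcs and their composition over a full turn -/

noncomputable section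

section

variable {F G : ℂ → ℂ} {A B : Set ℂ} {p : ℂ} {σ m M : ℝ} {Φ Ψ : ℂ → ℂ → ℂ}

/-- The points of `opposedPoints A B p` whose argument lies between `a` and `b`. -/
def opposedPointsBetween (A B : Set ℂ) (p : ℂ) (σ a b : ℝ) : Set ℂ :=
  {s | s ∈ opposedPoints A B p ∧ a < σ * s.im ∧ σ * s.im < b}

theorem abs_sign_mul (hσ : σ = 1 ∨ σ = -1) (x : ℝ) : |σ * x| = |x| := by
  rcases hσ with rfl | rfl <;> simp

theorem finite_opposedPointsBetween (hσ : σ = 1 ∨ σ = -1) (hA : IsDiscreteAway A)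
    (hr : IsArcRange A B p m M) (a b : ℝ) : (opposedPointsBetween A B p σ a b).Finite := by
  refine (finite_opposedPoints hA hr (max |a| |b|)).subset fun s hs => ⟨hs.1, ?_⟩
  rw [← abs_sign_mul hσ]
  refine abs_le.2 ⟨?_, ?_⟩
  · linarith [neg_abs_le a, le_max_left |a| |b|, hs.2.1]
  · linarith [le_abs_self b, le_max_right |a| |b|, hs.2.2]

theorem sideSector_subset {η η' : ℝ} (h : η ≤ η') : sideSector σ η ⊆ sideSector σ η' :=
  fun _ hυ => ⟨hυ.1, hυ.2.1.trans_le h, hυ.2.2.trans_le h⟩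

/-- The integral along the arc from `a` to `b` continues to a thin sector on the side `σ`, where it
is pinched by the opposed singularities. -/
def IsPinchedArc (F G : ℂ → ℂ) (A B : Set ℂ) (Φ Ψ : ℂ → ℂ → ℂ) (p : ℂ) (σ m a b : ℝ) : Prop :=
  ∃ η > 0, ∃ N : ℝ, ∃ T : ℂ → ℂ, DifferentiableOn ℂ T (sideSector σ η) ∧
    (∀ υ ∈ sideSector σ η, υ.re < -N → T υ = arcIntegral F G p σ m a b υ) ∧
    IsPinch σ (fun υ c => c = T υ) fun ω =>
      -σ * ∑ᶠ s ∈ opposedPointsBetween A B p σ a b, opposedConv Φ Ψ p s ω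

theorem IsPinchedArc.add (hσ : σ = 1 ∨ σ = -1) (hF : HasSmallBranches F A σ Φ)
    (hG : HasSmallBranches G B σ Ψ) (hr : IsArcRange A B p m M) {a b c : ℝ} (hab : a < b)
    (hbc : b < c) (hb : ∀ s ∈ opposedPoints A B p, σ * s.im ≠ b)
    (h₁ : IsPinchedArc F G A B Φ Ψ p σ m a b) (h₂ : IsPinchedArc F G A B Φ Ψ p σ m b c) :
    IsPinchedArc F G A B Φ Ψ p σ m a c := by
  obtain ⟨η₁, hη₁, N₁, T₁, d₁, e₁, p₁⟩ := h₁
  obtain ⟨η₂, hη₂, N₂, T₂, d₂, e₂, p₂⟩ := h₂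
  have s1 := sideSector_subset (σ := σ) (min_le_left η₁ η₂)
  have s2 := sideSector_subset (σ := σ) (min_le_right η₁ η₂)
  refine ⟨min η₁ η₂, lt_min hη₁ hη₂, max (max N₁ N₂) (M - m), fun υ => T₁ υ + T₂ υ,
    (d₁.mono s1).add (d₂.mono s2), fun υ h hN => ?_, ?_⟩
  · have k1 := (le_max_left N₁ N₂).trans (le_max_left _ (M - m))
    have k2 := (le_max_right N₁ N₂).trans (le_max_left _ (M - m))
    have k3 := le_max_right (max N₁ N₂) (M - m)
    beta_reduce
    rw [e₁ υ (s1 h) (by linarith), e₂ υ (s2 h) (by linarith),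
      arcIntegral_add hF.discrete hG.discrete hF.differentiableOn hG.differentiableOn hr
        (by linarith)]
  · refine (p₁.add p₂ fun υ c₁ c₂ k1 k2 => by rw [k1, k2]).congr_variation fun ω => ?_
    have hunion : opposedPointsBetween A B p σ a c =
        opposedPointsBetween A B p σ a b ∪ opposedPointsBetween A B p σ b c := by
      refine subset_antisymm ?_ (union_subset ?_ ?_)
      · rintro s ⟨hs, k1, k2⟩
        rcases lt_or_gt_of_ne (hb s hs) with h | h
        · exact Or.inl ⟨hs, k1, h⟩
        · exact Or.inr ⟨hs, h, k2⟩
      · exact fun s hs => ⟨hs.1, hs.2.1, hs.2.2.trans hbc⟩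
      · exact fun s hs => ⟨hs.1, hab.trans hs.2.1, hs.2.2⟩
    rw [← mul_add, hunion, finsum_mem_union _ (finite_opposedPointsBetween hσ hF.discrete hr _ _)
      (finite_opposedPointsBetween hσ hF.discrete hr _ _)]
    rw [disjoint_left]
    rintro s ⟨_, _, k1⟩ ⟨_, k2, _⟩
    linarith

/-- In a thin angle around `t` all opposed points lie in the direction `t` itself, so the sum over
the arc is the sum over one ray, and `exists_continuation_to_sideSector` applies to the pinch along
it. -/
theorem exists_isPinchedArc_locally (hσ : σ = 1 ∨ σ = -1) (hF : HasSmallBranches F A σ Φ)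
    (hG : HasSmallBranches G B σ Ψ) (hp : p ≠ 0) (hr : IsArcRange A B p m M) (t : ℝ) :
    ∃ δ > 0, ∀ a ∈ Ioo (t - δ) t, ∀ b ∈ Ioo t (t + δ),
      (∀ s ∈ opposedPoints A B p, σ * s.im ≠ b) ∧ IsPinchedArc F G A B Φ Ψ p σ m a b := by
  set c : ℂ := (σ * t : ℝ) * I with hc
  have hcim : c.im = σ * t := by simp [hc]
  have hcre : c.re = 0 := by simp [hc]
  have hσσ : σ * σ = 1 := by rcases hσ with rfl | rfl <;> norm_num
  obtain ⟨δ₁, hδ₁, f1⟩ := exists_sector_subset_starDomain hF.discrete.zero_notMem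
    hF.discrete.finite_inter (Complex.exp_ne_zero c) (M + 1)
  obtain ⟨δ₂, hδ₂, g1⟩ := exists_sector_subset_starDomain hG.discrete.zero_notMem
    hG.discrete.finite_inter (mul_ne_zero hp (Complex.exp_ne_zero (-c))) (-m + 1)
  have hδ := lt_min hδ₁ hδ₂
  have hδ1 := min_le_left δ₁ δ₂
  have hδ2 := min_le_right δ₁ δ₂
  set δ := min δ₁ δ₂
  have angle : ∀ s ∈ opposedPoints A B p, |σ * s.im - t| < δ → σ * s.im = t := by
    intro s hs h
    by_contra hne
    have e : σ * s.im - t = σ * (s - c).im := by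
      rw [sub_im, hcim, mul_sub, ← mul_assoc σ σ, hσσ, one_mul]
    rw [e, abs_sign_mul hσ] at h
    have h0 : (s - c).im ≠ 0 := fun h0 => hne (by linarith [h0 ▸ e])
    refine notMem_starDomain hs.1 ?_
    have := f1 (s - c) h0 (h.trans_le hδ1)
      (by rw [sub_re, hcre]; linarith [(re_mem_of_mem_opposedPoints hr hs).2])
    rwa [← Complex.exp_add, add_sub_cancel] at this
  refine ⟨δ, hδ, fun a ha b hb => ⟨fun s hs h => ?_, ?_⟩⟩
  · have := angle s hs (abs_lt.2 ⟨by linarith [hb.1], by linarith [hb.2]⟩)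
    linarith [hb.1]
  obtain ⟨x₁, hx₁, x₂, hx₂, ⟨⟨_, r1⟩, r2, _⟩, hpinch⟩ := exists_radial_pinch hσ hF hG hp hr c
  have df : DifferentiableOn ℂ (fun y => F (exp c * exp y)) (slitStrip δ (m + 1) (M + 1)) :=
    differentiableOn_slitStrip hF.discrete hF.differentiableOn
      (fun υ h h' => f1 υ h (h'.trans_le hδ1)) fun υ h h' => by
        rw [← Complex.exp_add]
        exact hr.left _ (by rwa [add_re, hcre, zero_add])
  have dg : DifferentiableOn ℂ (fun y => G (p * exp (-c) * exp y))
      (slitStrip δ (-M + 1) (-m + 1)) :=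
    differentiableOn_slitStrip hG.discrete hG.differentiableOn
      (fun υ h h' => g1 υ h (h'.trans_le hδ2)) fun υ h h' => by
        rw [mul_assoc, ← Complex.exp_add]
        exact hr.right _ (by rwa [add_re, neg_re, hcre, neg_zero, zero_add])
  have ef := (hF.regular _ r2).extendsAcross hσ (Complex.exp_ne_zero c)
  have eg := IsRegularFromSide.extendsAcross (x := -x₁) hσ
    (mul_ne_zero hp (Complex.exp_ne_zero (-c))) (by
      rw [ofReal_neg]; exact hG.regular _ r1)
  obtain ⟨η, hη, N, T, dT, eT, hT⟩ := exists_continuation_to_sideSector (a := a - t) (b := b - t)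
    hσ df dg hr.le (by linarith [ha.1]) (by linarith [ha.2]) (by linarith [hb.1])
    (by linarith [hb.2]) hx₁ hx₂ ef eg hpinch
  refine ⟨η, hη, N, T, dT, fun υ h hN => ?_, hT.congr_variation fun ω => ?_⟩
  · rw [eT υ h hN, ← arcIntegral_rotate, add_sub_cancel, add_sub_cancel]
  · have : {s : ℂ | s ∈ opposedPoints A B p ∧ s.im = c.im ∧ x₁ < (s - c).re ∧ (s - c).re < x₂} =
        opposedPointsBetween A B p σ a b := by
      refine subset_antisymm ?_ ?_
      · rintro s ⟨hs, him, _⟩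
        have : σ * s.im = t := by rw [him, hcim, ← mul_assoc, hσσ, one_mul]
        exact ⟨hs, by rw [this]; exact ha.2, by rw [this]; exact hb.1⟩
      · rintro s ⟨hs, k1, k2⟩
        have := angle s hs (abs_lt.2 ⟨by linarith [ha.1], by linarith [hb.2]⟩)
        have hre := re_mem_of_mem_opposedPoints hr hs
        refine ⟨hs, ?_, ?_, ?_⟩
        · rw [hcim, ← this, ← mul_assoc, hσσ, one_mul]
        · rw [sub_re, hcre, sub_zero]; linarith [hx₁.2, hre.1]
        · rw [sub_re, hcre, sub_zero]; linarith [hx₂.1, hre.2]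
    rw [this]

theorem exists_isPinchedArc_full_turn (hσ : σ = 1 ∨ σ = -1) (hF : HasSmallBranches F A σ Φ)
    (hG : HasSmallBranches G B σ Ψ) (hp : p ≠ 0) (hr : IsArcRange A B p m M) :
    ∃ a : ℝ, (∀ s ∈ opposedPoints A B p, σ * s.im ≠ a + 2 * Real.pi) ∧
      IsPinchedArc F G A B Φ Ψ p σ m a (a + 2 * Real.pi) := by
  obtain ⟨a, -, h⟩ := exists_full_turn (P := fun a b => a < b ∧
    (∀ s ∈ opposedPoints A B p, σ * s.im ≠ b) ∧ IsPinchedArc F G A B Φ Ψ p σ m a b)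
    (fun x y z ⟨hxy, h1, h2⟩ ⟨hyz, h3, h4⟩ => ⟨hxy.trans hyz, h3,
      h2.add hσ hF hG hr hxy hyz h1 h4⟩) fun t => by
      obtain ⟨δ, hδ, h⟩ := exists_isPinchedArc_locally hσ hF hG hp hr t
      exact ⟨δ, hδ, fun x hx y hy => ⟨hx.2.trans hy.1, h x hx y hy⟩⟩
  exact ⟨a, h⟩

end

end

/-! ### The principal branch of the Hadamard product -/

noncomputable section

theorem eqOn_of_eq_left {U : Set ℂ} (hU : IsOpen U) (hc : Convex ℝ U) {T₁ T₂ : ℂ → ℂ}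
    (d₁ : DifferentiableOn ℂ T₁ U) (d₂ : DifferentiableOn ℂ T₂ U) {N : ℝ}
    (hne : ∃ υ ∈ U, υ.re < -N) (h : ∀ υ ∈ U, υ.re < -N → T₁ υ = T₂ υ) : EqOn T₁ T₂ U := by
  obtain ⟨υ₀, h0, hN⟩ := hne
  refine (d₁.analyticOnNhd hU).eqOn_of_preconnected_of_eventuallyEq (d₂.analyticOnNhd hU)
    hc.isPreconnected h0 ?_
  filter_upwards [hU.mem_nhds h0, (isOpen_lt continuous_re continuous_const).mem_nhds hN] with υ k1 k2
  exact h υ k1 k2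

theorem exists_mem_truncatedStrip {η : ℝ} (hη : 0 < η) (N : ℝ) :
    ∃ υ ∈ truncatedStrip η, υ.re < -N := by
  refine ⟨((-(|N| + 1) : ℝ) : ℂ), ⟨by simpa using hη, ?_⟩, ?_⟩
  · rw [ofReal_re]; linarith [abs_nonneg N]
  · rw [ofReal_re]; linarith [le_abs_self N]

theorem exists_mem_sideSector {σ η : ℝ} (hσ : σ = 1 ∨ σ = -1) (hη : 0 < η) (N : ℝ) :
    ∃ υ ∈ sideSector σ η, υ.re < -N := by
  have h := sign_mul_im_mk hσ (-(|N| + 1)) (η / 2)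
  have hre : (((-(|N| + 1) : ℝ) : ℂ) + (σ * (η / 2) : ℝ) * I).re = -(|N| + 1) := by simp
  refine ⟨((-(|N| + 1) : ℝ) : ℂ) + (σ * (η / 2) : ℝ) * I, ⟨?_, ?_, ?_⟩, ?_⟩
  · rw [h]; linarith
  · rw [h]; linarith
  · rw [hre]; linarith [abs_nonneg N]
  · rw [hre]; linarith [le_abs_self N]

theorem truncatedStrip_subset {η η' : ℝ} (h : η ≤ η') : truncatedStrip η ⊆ truncatedStrip η' :=
  fun _ hυ => ⟨hυ.1.trans_le h, hυ.2.trans_le h⟩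

theorem zero_mem_truncatedStrip {η : ℝ} (hη : 0 < η) : (0 : ℂ) ∈ truncatedStrip η := by
  simpa [truncatedStrip] using hη

/-- A germ at `0` which continues along thin strips around all segments from `0` to the points
of an open set `S` defines a holomorphic function on `S`. -/
theorem exists_continuation_of_strips {S : Set ℂ} {h : ℂ → ℂ} {R : ℝ} (hR : 0 < R)
    (hh : DifferentiableOn ℂ h (Metric.ball 0 R)) (hS : IsOpen S)
    (hT : ∀ z ∈ S, z ≠ 0 → ∃ η > 0, ∃ N : ℝ, ∃ T : ℂ → ℂ, DifferentiableOn ℂ T (truncatedStrip η) ∧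
      ∀ υ ∈ truncatedStrip η, υ.re < -N → T υ = h (z * exp υ)) :
    ∃ H : ℂ → ℂ, DifferentiableOn ℂ H S ∧ (0 ∈ S → H =ᶠ[𝓝 0] h) := by
  classical
  choose! η hη N T dT eT using hT
  -- The continuations belonging to `z` and to $w=ze^\upsilon$ both reproduce `h` far to the left,
  -- so they agree by the identity theorem. Hence near `z` the value at `w` is `T z` at $\log(w/z)$,
  -- which is holomorphic.
  have key : ∀ z ∈ S, z ≠ 0 → ∀ υ ∈ truncatedStrip (η z), z * exp υ ∈ S →
      T (z * exp υ) 0 = T z υ := by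
    intro z hz hz0 υ hυ hw
    have hw0 : z * exp υ ≠ 0 := mul_ne_zero hz0 (Complex.exp_ne_zero υ)
    set w := z * exp υ with hwdef
    obtain ⟨ε, hε, e1, e2, e3⟩ : ∃ ε > 0, ε ≤ η w ∧ ε ≤ η z - |υ.im| ∧ ε ≤ η z - υ.re :=
      ⟨min (η w) (min (η z - |υ.im|) (η z - υ.re)),
        lt_min (hη w hw hw0) (lt_min (by linarith [hυ.1]) (by linarith [hυ.2])), min_le_left _ _,
        (min_le_right _ _).trans (min_le_left _ _), (min_le_right _ _).trans (min_le_right _ _)⟩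
    have maps : ∀ x ∈ truncatedStrip ε, υ + x ∈ truncatedStrip (η z) := fun x hx => by
      refine ⟨?_, ?_⟩
      · rw [add_im]; linarith [abs_add_le υ.im x.im, hx.1]
      · rw [add_re]; linarith [hx.2]
    have h1 := eqOn_of_eq_left (isOpen_truncatedStrip ε) (convex_truncatedStrip ε)
      ((dT w hw hw0).mono (truncatedStrip_subset e1))
      ((dT z hz hz0).comp (f := fun x => υ + x) (by fun_prop) maps)
      (N := max (N w) (N z + υ.re)) (exists_mem_truncatedStrip hε _) fun x hx hxN => by
        have k1 := le_max_left (N w) (N z + υ.re)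
        have k2 := le_max_right (N w) (N z + υ.re)
        rw [eT w hw hw0 x (truncatedStrip_subset e1 hx) (by linarith), Function.comp_apply,
          eT z hz hz0 _ (maps x hx) (by rw [add_re]; linarith), hwdef, Complex.exp_add, mul_assoc]
    have h2 := h1 (zero_mem_truncatedStrip hε)
    simpa using h2
  have small : ∀ z ∈ S, z ≠ 0 → ‖z‖ < R → T z 0 = h z := by
    intro z hz hz0 hzR
    have hzpos := norm_pos_iff.2 hz0
    obtain ⟨ε, hε, e1, e2⟩ : ∃ ε > 0, ε ≤ η z ∧ ε ≤ Real.log (R / ‖z‖) :=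
      ⟨min (η z) (Real.log (R / ‖z‖)), lt_min (hη z hz hz0)
        (Real.log_pos ((one_lt_div hzpos).2 hzR)), min_le_left _ _, min_le_right _ _⟩
    have h1 := eqOn_of_eq_left (isOpen_truncatedStrip ε) (convex_truncatedStrip ε)
      ((dT z hz hz0).mono (truncatedStrip_subset e1))
      (hh.comp (f := fun x => z * exp x) (by fun_prop) fun x hx => by
        rw [mem_ball_zero_iff, norm_mul, Complex.norm_exp, ← lt_div_iff₀' hzpos,
          ← Real.lt_log_iff_exp_lt (by positivity)]
        exact hx.2.trans_le e2)
      (N := N z) (exists_mem_truncatedStrip hε _) fun x hx hxN =>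
        eT z hz hz0 x (truncatedStrip_subset e1 hx) hxN
    have h2 := h1 (zero_mem_truncatedStrip hε)
    simpa using h2
  have hloc : ∀ z ∈ S, ‖z‖ < R → (if z = 0 then h 0 else T z 0) = h z := fun z hz hzR => by
    split_ifs with h0
    · rw [h0]
    · exact small z hz h0 hzR
  refine ⟨fun z => if z = 0 then h 0 else T z 0, fun z hz => ?_, fun h0 => ?_⟩
  · by_cases hz0 : z = 0
    · have : (fun z => if z = 0 then h 0 else T z 0) =ᶠ[𝓝 z] h := by
        filter_upwards [hS.mem_nhds hz, Metric.isOpen_ball.mem_nhds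
          (show z ∈ Metric.ball 0 R by rw [hz0]; exact Metric.mem_ball_self hR)] with w k1 k2
        exact hloc w k1 (mem_ball_zero_iff.1 k2)
      refine ((hh.differentiableAt (Metric.isOpen_ball.mem_nhds ?_)).congr_of_eventuallyEq
        this).differentiableWithinAt
      rw [hz0]; exact Metric.mem_ball_self hR
    · have hc : ContinuousAt (fun w => Complex.log (w / z)) z := by
        refine ContinuousAt.clog (by fun_prop) ?_
        rw [div_self hz0]; exact one_mem_slitPlane
      have hlog0 : Complex.log (z / z) = 0 := by rw [div_self hz0, Complex.log_one]
      have hmem : ∀ᶠ w in 𝓝 z, Complex.log (w / z) ∈ truncatedStrip (η z) :=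
        hc.eventually_mem ((isOpen_truncatedStrip _).mem_nhds (by
          rw [hlog0]; exact zero_mem_truncatedStrip (hη z hz hz0)))
      have : (fun z => if z = 0 then h 0 else T z 0) =ᶠ[𝓝 z]
          fun w => T z (Complex.log (w / z)) := by
        filter_upwards [hS.mem_nhds hz, hmem, isOpen_ne.mem_nhds hz0] with w k1 k2 k3
        have e : z * exp (Complex.log (w / z)) = w := by
          rw [Complex.exp_log (div_ne_zero k3 hz0), mul_div_cancel₀ _ hz0]
        have := key z hz hz0 _ k2 (by rwa [e])
        rw [e] at this
        rw [if_neg k3, this]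
      refine (DifferentiableAt.congr_of_eventuallyEq ?_ this).differentiableWithinAt
      refine DifferentiableAt.comp z (g := T z) ?_ ?_
      · refine (dT z hz hz0).differentiableAt ((isOpen_truncatedStrip _).mem_nhds ?_)
        rw [hlog0]; exact zero_mem_truncatedStrip (hη z hz hz0)
      · refine DifferentiableAt.clog (by fun_prop) ?_
        rw [div_self hz0]; exact one_mem_slitPlane
  · filter_upwards [hS.mem_nhds h0, Metric.ball_mem_nhds 0 hR] with w k1 k2
    exact hloc w k1 (mem_ball_zero_iff.1 k2)

section

variable {f g F G : ℂ → ℂ} {A B : Set ℂ} {p : ℂ} {σ m M : ℝ}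

theorem IsDiscreteAway.exists_ball (hA : IsDiscreteAway A) :
    ∃ r > 0, ∀ z : ℂ, ‖z‖ < r → z ∈ starDomain A :=
  exists_ball_subset_starDomain hA.zero_notMem hA.finite_inter

theorem exists_isArcRange (hA : IsDiscreteAway A) (hB : IsDiscreteAway B) (p : ℂ) :
    ∃ m M, IsArcRange A B p m M := by
  obtain ⟨r, hr, h1⟩ := hA.exists_ball
  obtain ⟨s, hs, h2⟩ := hB.exists_ball
  have t1 : Tendsto (fun m : ℝ => Real.exp (m + 1)) atBot (𝓝 0) :=
    Real.tendsto_exp_atBot.comp (tendsto_atBot_add_const_right _ _ tendsto_id)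
  have t2 : Tendsto (fun m : ℝ => ‖p‖ * Real.exp (m + 1)) atBot (𝓝 0) := by
    simpa using t1.const_mul ‖p‖
  obtain ⟨m, hm1, hm2, hm3⟩ := ((t1.eventually_lt_const hr).and ((t2.eventually_lt_const hs).and
    (eventually_le_atBot (-1)))).exists
  refine ⟨m, -m, by linarith, fun x hx => h1 _ ?_, fun y hy => h2 _ ?_⟩
  · rw [Complex.norm_exp]
    exact (Real.exp_le_exp.2 hx.le).trans_lt hm1
  · rw [norm_mul, Complex.norm_exp]
    refine lt_of_le_of_lt ?_ hm2
    gcongr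
    linarith

theorem differentiableOn_ball_left (hA : IsDiscreteAway A)
    (dF : DifferentiableOn ℂ F (starDomain A)) (hr : IsArcRange A B p m M) :
    DifferentiableOn ℂ F (Metric.ball 0 (Real.exp (m + 1))) := by
  refine dF.mono fun z hz => ?_
  by_cases h0 : z = 0
  · rw [h0]; exact zero_mem_starDomain hA.zero_notMem
  · rw [← Complex.exp_log h0]
    refine hr.left _ ?_
    rw [Complex.log_re, Real.log_lt_iff_lt_exp (norm_pos_iff.2 h0)]
    exact mem_ball_zero_iff.1 hz

theorem differentiableOn_ball_right (hB : IsDiscreteAway B)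
    (dG : DifferentiableOn ℂ G (starDomain B)) (hp : p ≠ 0) (hr : IsArcRange A B p m M) :
    DifferentiableOn ℂ G (Metric.ball 0 (‖p‖ * Real.exp (-M + 1))) := by
  refine dG.mono fun z hz => ?_
  have hp' := norm_pos_iff.2 hp
  by_cases h0 : z = 0
  · rw [h0]; exact zero_mem_starDomain hB.zero_notMem
  · have := hr.right (Complex.log (z / p)) (by
      rw [Complex.log_re, Real.log_lt_iff_lt_exp (norm_pos_iff.2 (div_ne_zero h0 hp)), norm_div,
        div_lt_iff₀' hp']
      exact mem_ball_zero_iff.1 hz)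
    rwa [Complex.exp_log (div_ne_zero h0 hp), mul_div_cancel₀ _ hp] at this

theorem arcIntegral_full_turn (hA : IsDiscreteAway A) (hB : IsDiscreteAway B)
    (dF : DifferentiableOn ℂ F (starDomain A)) (dG : DifferentiableOn ℂ G (starDomain B))
    (hfF : F =ᶠ[𝓝 0] f) (hgG : G =ᶠ[𝓝 0] g) (hσ : σ = 1 ∨ σ = -1) (hp : p ≠ 0)
    (hr : IsArcRange A B p m M) (a : ℝ) {υ : ℂ} (hυ : υ.re < m - M) :
    arcIntegral F G p σ m a (a + 2 * Real.pi) υ =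
      2 * Real.pi * σ * I * hadamardProduct f g (p * exp υ) := by
  set c : ℂ := m + (σ * a : ℝ) * I with hc
  have hcre : c.re = m := by simp [hc]
  have e : (m : ℂ) + (σ * (a + 2 * Real.pi) : ℝ) * I - c = 2 * Real.pi * σ * I := by
    rw [hc]; push_cast; ring
  rw [hadamardProduct_eq_integral (differentiableOn_ball_left hA dF hr) hfF
    (differentiableOn_ball_right hB dG hp hr) hgG hσ (c := c), arcIntegral, segInt, e,
    intervalIntegral.integral_mul_const, mul_comm]
  · congr 1
    refine intervalIntegral.integral_congr fun t _ => ?_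
    simp only [pairKernel]
    rw [mul_assoc p, ← Complex.exp_add, ← hc]
    ring_nf
  · rw [Complex.norm_exp, hcre]
    exact Real.exp_lt_exp.2 (by linarith)
  · rw [mul_assoc, ← Complex.exp_add, norm_mul, Complex.norm_exp, add_re, neg_re, hcre]
    exact mul_lt_mul_of_pos_left (Real.exp_lt_exp.2 (by linarith)) (norm_pos_iff.2 hp)

/-- On the circle $|u|=r/2$ and for $|z|<rs/2$ one has $|z/u|<s$, so a fixed contour serves a whole
disc of `z`. -/
theorem exists_differentiableOn_hadamardProduct (hA : IsDiscreteAway A) (hB : IsDiscreteAway B)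
    (dF : DifferentiableOn ℂ F (starDomain A)) (dG : DifferentiableOn ℂ G (starDomain B))
    (hfF : F =ᶠ[𝓝 0] f) (hgG : G =ᶠ[𝓝 0] g) :
    ∃ R > 0, DifferentiableOn ℂ (hadamardProduct f g) (Metric.ball 0 R) := by
  obtain ⟨r, hr, h1⟩ := hA.exists_ball
  obtain ⟨s, hs, h2⟩ := hB.exists_ball
  have dF' : DifferentiableOn ℂ F (Metric.ball 0 r) :=
    dF.mono fun z hz => h1 z (mem_ball_zero_iff.1 hz)
  have dG' : DifferentiableOn ℂ G (Metric.ball 0 s) :=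
    dG.mono fun z hz => h2 z (mem_ball_zero_iff.1 hz)
  set c : ℂ := ((Real.log (r / 2) : ℝ) : ℂ) with hc
  have hec : exp c = ((r / 2 : ℝ) : ℂ) := by rw [hc, ← ofReal_exp, Real.exp_log (by linarith)]
  set x : ℝ → ℂ := fun t => c + t * (2 * Real.pi * (1 : ℝ) * I) with hx
  have hxc : Continuous x := by rw [hx]; fun_prop
  have hxre : ∀ t, (x t).re = c.re := fun t => by simp [hx]
  have n1 : ∀ t, ‖exp (x t)‖ = r / 2 := fun t => by
    rw [Complex.norm_exp, hxre, ← Complex.norm_exp, hec, norm_real, Real.norm_of_nonneg (by linarith)]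
  have n2 : ∀ t z, z ∈ Metric.ball (0 : ℂ) (s * r / 2) → ‖z * exp (-x t)‖ < s := fun t z hz => by
    rw [norm_mul, Complex.exp_neg, norm_inv, n1, ← div_eq_mul_inv, div_lt_iff₀ (by linarith)]
    have := mem_ball_zero_iff.1 hz
    linarith
  refine ⟨s * r / 2, by positivity, ?_⟩
  refine (differentiableOn_intervalIntegral (g := fun z t => F (exp (x t)) * G (z * exp (-x t)))
    (zero_le_one' ℝ) Metric.isOpen_ball ?_ fun t _ => ?_).congr fun z hz => ?_
  · refine ContinuousOn.mul ?_ ?_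
    · refine dF'.continuousOn.comp (f := fun q : ℂ × ℝ => exp (x q.2)) (by fun_prop) fun q _ => ?_
      rw [mem_ball_zero_iff, n1]; linarith
    · refine dG'.continuousOn.comp (f := fun q : ℂ × ℝ => q.1 * exp (-x q.2)) (by fun_prop)
        fun q hq => mem_ball_zero_iff.2 (n2 _ _ hq.1)
  · refine DifferentiableOn.const_mul ?_ _
    exact dG'.comp (f := fun z => z * exp (-x t)) (by fun_prop)
      fun z hz => mem_ball_zero_iff.2 (n2 _ _ hz)
  · have h0 : x 0 = c := by simp [hx]
    refine hadamardProduct_eq_integral dF' hfF dG' hgG (Or.inl rfl) ?_ ?_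
    · rw [← h0, n1]; linarith
    · rw [← h0]; exact n2 0 z hz

end

end

/-! ### Factor pairs, local branches of the product and removable singularities -/

noncomputable section

section

variable {f g F G H : ℂ → ℂ} {A B : Set ℂ} {p : ℂ} {σ : ℝ} {Φ Ψ : ℂ → ℂ → ℂ}

/-- The pairs of singularities with product `p`. -/
def factorPairs (A B : Set ℂ) (p : ℂ) : Set (ℂ × ℂ) := {q | q.1 ∈ A ∧ q.2 ∈ B ∧ q.1 * q.2 = p}

theorem IsDiscreteAway.exists_le_norm (hA : IsDiscreteAway A) : ∃ r > 0, ∀ α ∈ A, r ≤ ‖α‖ := by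
  obtain ⟨r, hr, h⟩ := hA.exists_ball
  exact ⟨r, hr, fun α hα => not_lt.1 fun h' => notMem_starDomain hα (h α h')⟩

/-- Both sets stay away from $0$, so a bound on the product bounds each factor. -/
theorem finite_pairs_norm_mul_le (hA : IsDiscreteAway A) (hB : IsDiscreteAway B) (R : ℝ) :
    {q : ℂ × ℂ | q.1 ∈ A ∧ q.2 ∈ B ∧ ‖q.1 * q.2‖ ≤ R}.Finite := by
  obtain ⟨r, hr, h1⟩ := hA.exists_le_norm
  obtain ⟨s, hs, h2⟩ := hB.exists_le_norm
  refine ((hA.finite_inter (R / s)).prod (hB.finite_inter (R / r))).subset ?_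
  rintro ⟨α, β⟩ ⟨hα, hβ, h⟩
  rw [norm_mul] at h
  refine ⟨⟨hα, ?_⟩, hβ, ?_⟩
  · rw [mem_closedBall_zero_iff, le_div_iff₀ hs]
    exact (mul_le_mul_of_nonneg_left (h2 β hβ) (norm_nonneg α)).trans h
  · rw [mem_closedBall_zero_iff, le_div_iff₀ hr, mul_comm]
    exact (mul_le_mul_of_nonneg_right (h1 α hα) (norm_nonneg β)).trans h

theorem finite_factorPairs (hA : IsDiscreteAway A) (hB : IsDiscreteAway B) (p : ℂ) :
    (factorPairs A B p).Finite :=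
  (finite_pairs_norm_mul_le hA hB ‖p‖).subset fun _ hq => ⟨hq.1, hq.2.1, hq.2.2 ▸ le_rfl⟩

theorem IsDiscreteAway.image2_mul (hA : IsDiscreteAway A) (hB : IsDiscreteAway B) :
    IsDiscreteAway (image2 (· * ·) A B) where
  zero_notMem := by
    rintro ⟨α, hα, β, hβ, h⟩
    rcases mul_eq_zero.1 h with rfl | rfl
    · exact hA.zero_notMem hα
    · exact hB.zero_notMem hβ
  finite_inter R := by
    refine ((finite_pairs_norm_mul_le hA hB R).image fun q => q.1 * q.2).subset ?_
    rintro _ ⟨⟨α, hα, β, hβ, rfl⟩, h⟩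
    exact ⟨(α, β), ⟨hα, hβ, mem_closedBall_zero_iff.1 h⟩, rfl⟩

theorem exists_principalBranch_hadamardProduct (hA : IsDiscreteAway A) (hB : IsDiscreteAway B)
    (hF : IsPrincipalBranch f A F) (hG : IsPrincipalBranch g B G) :
    ∃ H, IsPrincipalBranch (hadamardProduct f g) (image2 (· * ·) A B) H := by
  have hAB := hA.image2_mul hB
  obtain ⟨R, hR, dh⟩ := exists_differentiableOn_hadamardProduct hA hB hF.differentiableOn
    hG.differentiableOn hF.germ_eq hG.germ_eq
  have hpi : (2 * Real.pi * (1 : ℝ) * I : ℂ) ≠ 0 := by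
    simp [Real.pi_ne_zero]
  obtain ⟨H, dH, eH⟩ := exists_continuation_of_strips hR dh hAB.isOpen fun z hz hz0 => by
    obtain ⟨m, M, hr⟩ := exists_isArcRange hA hB z
    obtain ⟨a, η, hη, N, T, dT, eT⟩ := exists_open_continuation (σ := 1) hA hB hF.differentiableOn
      hG.differentiableOn (Or.inl rfl) hr hz0 hz
    refine ⟨η, hη, max N (M - m), fun υ => T υ / (2 * Real.pi * (1 : ℝ) * I), dT.div_const _,
      fun υ hυ hN => ?_⟩
    have k1 := le_max_left N (M - m)
    have k2 := le_max_right N (M - m)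
    beta_reduce
    rw [eT υ hυ (by linarith), arcIntegral_full_turn hA hB hF.differentiableOn hG.differentiableOn
      hF.germ_eq hG.germ_eq (Or.inl rfl) hz0 hr a (by linarith), mul_div_cancel_left₀ _ hpi]
  exact ⟨H, eH (zero_mem_starDomain hAB.zero_notMem), dH⟩

/-- Arguments in an interval of length `2π` represent each pair once. -/
theorem bijOn_opposedPointsBetween (hσ : σ = 1 ∨ σ = -1) (hA0 : (0 : ℂ) ∉ A) {a : ℝ}
    (ha : ∀ s ∈ opposedPoints A B p, σ * s.im ≠ a + 2 * Real.pi) :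
    BijOn (fun s => (exp s, p * exp (-s))) (opposedPointsBetween A B p σ a (a + 2 * Real.pi))
      (factorPairs A B p) := by
  have hpi := Real.pi_pos
  have hσσ : σ * σ = 1 := by rcases hσ with rfl | rfl <;> norm_num
  refine ⟨fun s hs => ⟨hs.1.1, hs.1.2, ?_⟩, fun s hs t ht h => ?_, ?_⟩
  · rw [mul_left_comm, ← Complex.exp_add, add_neg_cancel, Complex.exp_zero, mul_one]
  · obtain ⟨n, hn⟩ := Complex.exp_eq_exp_iff_exists_int.1 (Prod.ext_iff.1 h).1
    have him : σ * s.im = σ * t.im + n * (2 * Real.pi) * σ := by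
      rw [hn]; simp; ring
    have h1 : |(n : ℝ) * (2 * Real.pi) * σ| < 2 * Real.pi := by
      rw [abs_lt]
      constructor <;> linarith [hs.2.1, hs.2.2, ht.2.1, ht.2.2]
    have h2 : |(n : ℝ)| < 1 := by
      rw [mul_comm, abs_sign_mul hσ, abs_mul, abs_of_pos (by linarith : 0 < 2 * Real.pi)] at h1
      exact (mul_lt_iff_lt_one_left (by linarith)).1 h1
    have h3 : n = 0 := by
      have : |n| < 1 := by exact_mod_cast h2
      exact Int.abs_lt_one_iff.1 this
    rw [hn, h3]; simp
  · rintro ⟨α, β⟩ ⟨hα, hβ, h⟩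
    have hα0 : α ≠ 0 := fun h => hA0 (h ▸ hα)
    set θ := σ * (Complex.log α).im with hθ
    obtain ⟨n, hn, -⟩ := existsUnique_add_zsmul_mem_Ioc (by linarith : 0 < 2 * Real.pi) θ a
    set s : ℂ := Complex.log α + (σ * (n * (2 * Real.pi)) : ℝ) * I with hs
    have hexp : exp s = α := by
      rw [hs, Complex.exp_add, Complex.exp_log hα0]
      have : exp ((σ * (n * (2 * Real.pi)) : ℝ) * I) = 1 := by
        rcases hσ with rfl | rfl
        · exact Complex.exp_eq_one_iff.2 ⟨n, by push_cast; ring⟩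
        · exact Complex.exp_eq_one_iff.2 ⟨-n, by push_cast; ring⟩
      rw [this, mul_one]
    have him : σ * s.im = θ + n • (2 * Real.pi) := by
      have : s.im = (Complex.log α).im + σ * (n * (2 * Real.pi)) := by
        simp [hs]
      rw [this, mul_add, ← mul_assoc σ σ, hσσ, one_mul, zsmul_eq_mul]
    have hβ' : p * exp (-s) = β := by
      rw [Complex.exp_neg, hexp, ← h]
      field_simp
    have hopp : s ∈ opposedPoints A B p := ⟨by rw [hexp]; exact hα, by rw [hβ']; exact hβ⟩
    refine ⟨s, ⟨hopp, by rw [him]; exact hn.1, lt_of_le_of_ne (by rw [him]; exact hn.2) (ha s hopp)⟩,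
      ?_⟩
    beta_reduce
    rw [hexp, hβ']

/-- By the identity theorem the pinched continuation over a full turn equals $2\pi\sigma
i\,H(pe^\upsilon)$ on the side sector. Dividing its variation, which carries the factor $-\sigma$,
leaves $-1/(2\pi i)$ on either side. -/
theorem exists_localBranch_hadamardProduct (hσ : σ = 1 ∨ σ = -1) (hF : HasSmallBranches F A σ Φ)
    (hG : HasSmallBranches G B σ Ψ) (hfF : F =ᶠ[𝓝 0] f) (hgG : G =ᶠ[𝓝 0] g)
    (hH : IsPrincipalBranch (hadamardProduct f g) (image2 (· * ·) A B) H) (hp : p ≠ 0) :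
    ∃ Θ : ℂ → ℂ, IsLocalBranch H σ p Θ ∧ IsSmallBranch Θ ∧ ∃ ρ > 0, ∀ ω : ℂ, ‖exp ω‖ < ρ →
      monodromyDelta Θ ω = -(1 / (2 * (Real.pi : ℂ) * I)) * ∑ᶠ q ∈ factorPairs A B p,
        convValue (monodromyDelta (Φ q.1)) (monodromyDelta (Ψ q.2)) ω := by
  have hA := hF.discrete
  have hB := hG.discrete
  have hAB := hA.image2_mul hB
  obtain ⟨m, M, hr⟩ := exists_isArcRange hA hB p
  obtain ⟨a, ha, η₁, hη₁, N, T, dT, eT, pT⟩ := exists_isPinchedArc_full_turn hσ hF hG hp hr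
  obtain ⟨η₂, hη₂, h2⟩ := exists_sector_subset_starDomain hAB.zero_notMem hAB.finite_inter hp 1
  obtain ⟨η, hη, hη1, hη2, hη3⟩ : ∃ η > 0, η ≤ η₁ ∧ η ≤ η₂ ∧ η ≤ 1 :=
    ⟨min η₁ (min η₂ 1), lt_min hη₁ (lt_min hη₂ one_pos), min_le_left _ _,
      (min_le_right _ _).trans (min_le_left _ _), (min_le_right _ _).trans (min_le_right _ _)⟩
  have hσ0 : (σ : ℂ) ≠ 0 := by rcases hσ with rfl | rfl <;> simp
  have hK : (2 * Real.pi * σ * I : ℂ) ≠ 0 := by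
    simp [Real.pi_ne_zero, hσ0]
  obtain ⟨R, hR, hgerm⟩ := Metric.eventually_nhds_iff.1 hH.germ_eq
  have hsec : ∀ υ ∈ sideSector σ η, p * exp υ ∈ starDomain (image2 (· * ·) A B) := fun υ hυ => by
    refine h2 υ (fun h0 => ?_) ?_ (by linarith [hυ.2.2])
    · have := hυ.1; rw [h0, mul_zero] at this; exact lt_irrefl _ this
    · rw [← abs_sign_mul hσ, abs_of_pos hυ.1]; linarith [hυ.2.1]
  have hTH : EqOn T (fun υ => 2 * Real.pi * σ * I * H (p * exp υ)) (sideSector σ η) := by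
    have hp' := norm_pos_iff.2 hp
    refine eqOn_of_eq_left (isOpen_sideSector σ η) (convex_sideSector σ η)
      (dT.mono (sideSector_subset hη1)) (DifferentiableOn.const_mul
        (hH.differentiableOn.comp (by fun_prop) hsec) _)
      (N := max (max N (M - m)) (-Real.log (R / ‖p‖))) (exists_mem_sideSector hσ hη _)
      fun υ hυ hN => ?_
    have k1 := (le_max_left N (M - m)).trans (le_max_left _ (-Real.log (R / ‖p‖)))
    have k2 := (le_max_right N (M - m)).trans (le_max_left _ (-Real.log (R / ‖p‖)))
    have k3 := le_max_right (max N (M - m)) (-Real.log (R / ‖p‖))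
    have k4 : dist (p * exp υ) 0 < R := by
      rw [dist_zero_right, norm_mul, Complex.norm_exp, ← lt_div_iff₀' hp',
        ← Real.lt_log_iff_exp_lt (by positivity)]
      linarith
    rw [eT υ (sideSector_subset hη1 hυ) (by linarith), arcIntegral_full_turn hA hB
      hF.differentiableOn hG.differentiableOn hfF hgG hσ hp hr a (by linarith), hgerm k4]
  obtain ⟨ρ, hρ, Θ, dΘ, sΘ, eΘ, vΘ⟩ := pT
  obtain ⟨ρ', hρ', hρ4, hlog⟩ := exists_norm_log_one_add_exp_lt hη
  refine ⟨fun ω => Θ ω / (2 * Real.pi * σ * I), ⟨min ρ ρ', lt_min hρ hρ', (dΘ.mono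
    fun w (hw : ‖exp w‖ < _) => hw.trans_le (min_le_left _ _)).div_const _,
    fun ω hω h0 hpi => ?_⟩, fun C => ?_, ρ, hρ, fun ω hω => ?_⟩
  · have hω' := hω.trans_le (min_le_right ρ ρ')
    have hn := hlog ω hω'
    have hmem : Complex.log (1 + exp ω) ∈ sideSector σ η := by
      refine ⟨sign_im_log_one_add_exp hσ h0 hpi, ?_, ?_⟩
      · refine lt_of_le_of_lt (le_abs_self _) ?_
        rw [abs_sign_mul hσ]
        exact (Complex.abs_im_le_norm _).trans_lt hn
      · exact (Complex.re_le_norm _).trans_lt hn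
    beta_reduce
    rw [eΘ ω (hω.trans_le (min_le_left _ _)) h0 hpi, hTH hmem]
    beta_reduce
    rw [mul_div_cancel_left₀ _ hK, Complex.exp_log (one_add_exp_ne_zero le_rfl (hω'.trans_le hρ4))]
  · have := (sΘ C).div_const (2 * Real.pi * σ * I : ℂ)
    rw [zero_div] at this
    exact this.congr fun w => mul_div_assoc _ _ _
  · have hsum : ∑ᶠ s ∈ opposedPointsBetween A B p σ a (a + 2 * Real.pi), opposedConv Φ Ψ p s ω =
        ∑ᶠ q ∈ factorPairs A B p,
          convValue (monodromyDelta (Φ q.1)) (monodromyDelta (Ψ q.2)) ω :=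
      finsum_mem_eq_of_bijOn _ (bijOn_opposedPointsBetween hσ hA.zero_notMem ha) fun s _ => rfl
    have := vΘ ω hω
    beta_reduce at this
    rw [hsum] at this
    rw [monodromyDelta, monodromyShift, ← sub_div, this]
    have := Real.pi_ne_zero
    field_simp

theorem apply_add_int_mul_two_pi_I {Θ : ℂ → ℂ} {ρ : ℝ}
    (hD : ∀ ω : ℂ, ‖exp ω‖ < ρ → Θ (ω + 2 * Real.pi * I) = Θ ω) (n : ℤ) {ω : ℂ}
    (hω : ‖exp ω‖ < ρ) : Θ (ω + n * (2 * Real.pi * I)) = Θ ω := by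
  have hn : ∀ n : ℤ, ‖exp (ω + n * (2 * Real.pi * I))‖ < ρ := fun n => by
    rwa [Complex.exp_add, Complex.exp_int_mul_two_pi_mul_I, mul_one]
  induction n using Int.induction_on with
  | zero => simp
  | succ k ih =>
    rw [← ih, ← hD _ (hn k)]
    push_cast
    ring_nf
  | pred k ih =>
    rw [← ih, ← hD _ (hn _)]
    push_cast
    ring_nf

/-- Without variation the branch descends to a punctured disc, and its growth $o(1/x)$ makes the
singularity removable. This yields the regularity of `H` outside $AB$, where there are no factor
pairs. -/
theorem isRegularFromSide_of_monodromyDelta_eq_zero {Θ : ℂ → ℂ} (hσ : σ = 1 ∨ σ = -1) (hp : p ≠ 0)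
    (h : IsLocalBranch H σ p Θ) (hs : IsSmallBranch Θ) {ρ : ℝ} (hρ : 0 < ρ)
    (hD : ∀ ω : ℂ, ‖exp ω‖ < ρ → monodromyDelta Θ ω = 0) : IsRegularFromSide H σ p := by
  obtain ⟨r₁, hr₁, dΘ, eΘ⟩ := h
  obtain ⟨r, hr, hr1, hr2⟩ : ∃ r > 0, r ≤ r₁ ∧ r ≤ ρ :=
    ⟨min r₁ ρ, lt_min hr₁ hρ, min_le_left _ _, min_le_right _ _⟩
  have hp' := norm_pos_iff.2 hp
  have per : ∀ w : ℂ, ‖exp w‖ < r → Θ (Complex.log (exp w)) = Θ w := fun w hw => by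
    obtain ⟨n, hn⟩ := Complex.exp_eq_exp_iff_exists_int.1 (Complex.exp_log (Complex.exp_ne_zero w))
    rw [hn]
    exact apply_add_int_mul_two_pi_I (ρ := r)
      (fun ω hω => sub_eq_zero.1 (hD ω (hω.trans_le hr2))) n hw
  have hdiff : DifferentiableOn ℂ (fun x => Θ (Complex.log x)) (Metric.ball 0 r \ {0}) := by
    rintro x ⟨hx, hx0⟩
    have hx0 : x ≠ 0 := hx0
    have hxr : ‖exp (Complex.log x)‖ < r := by
      rw [Complex.exp_log hx0]; exact mem_ball_zero_iff.1 hx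
    -- Near `x` the principal logarithm is replaced by one continuous across its cut; periodicity of
    -- `Θ` keeps the value.
    have e : (fun x => Θ (Complex.log x)) =ᶠ[𝓝 x]
        fun y => Θ (Complex.log x + Complex.log (y / x)) := by
      filter_upwards [Metric.isOpen_ball.mem_nhds hx, isOpen_ne.mem_nhds hx0] with y k1 k2
      have hy : exp (Complex.log x + Complex.log (y / x)) = y := by
        rw [Complex.exp_add, Complex.exp_log hx0, Complex.exp_log (div_ne_zero k2 hx0),
          mul_div_cancel₀ _ hx0]
      rw [← per (Complex.log x + Complex.log (y / x)) (by rw [hy]; exact mem_ball_zero_iff.1 k1), hy]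
    refine (DifferentiableAt.congr_of_eventuallyEq ?_ e).differentiableWithinAt
    refine DifferentiableAt.comp x (g := Θ) ?_ ?_
    · rw [div_self hx0, Complex.log_one, add_zero]
      exact dΘ.differentiableAt ((isOpen_norm_exp_lt _).mem_nhds (hxr.trans_le hr1))
    · refine DifferentiableAt.const_add _ (DifferentiableAt.clog (by fun_prop) ?_)
      rw [div_self hx0]; exact one_mem_slitPlane
  have hlim : Tendsto (fun x => x * Θ (Complex.log x)) (𝓝[≠] 0) (𝓝 0) := by
    have hlog : Tendsto Complex.log (𝓝[≠] 0)
        (comap Complex.re atBot ⊓ 𝓟 {v : ℂ | |v.im| ≤ Real.pi}) := by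
      refine tendsto_inf.2 ⟨tendsto_comap_iff.2 ?_, tendsto_principal.2 (Eventually.of_forall
        fun x => abs_log_im_le_pi x)⟩
      have : (Complex.re ∘ Complex.log) = fun x : ℂ => Real.log ‖x‖ := funext Complex.log_re
      rw [this]
      exact Real.tendsto_log_nhdsGT_zero.comp tendsto_norm_nhdsNE_zero
    refine ((hs Real.pi).comp hlog).congr' ?_
    filter_upwards [self_mem_nhdsWithin] with x hx
    rw [Function.comp_apply, Complex.exp_log hx]
  -- `Θ (Complex.log 0)` is a default value; any constant is $o(1/x)$.
  have hlo : (fun x => Θ (Complex.log x) - Θ (Complex.log 0)) =o[𝓝[≠] 0] fun x : ℂ => (x - 0)⁻¹ := by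
    rw [Asymptotics.isLittleO_iff_tendsto' (by
      filter_upwards [self_mem_nhdsWithin] with x hx h
      rw [sub_zero, inv_eq_zero] at h
      exact absurd h hx)]
    have h0 : Tendsto (fun x : ℂ => x * Θ (Complex.log 0)) (𝓝[≠] 0) (𝓝 0) := by
      have : Tendsto (fun x : ℂ => x * Θ (Complex.log 0)) (𝓝 0) (𝓝 (0 * Θ (Complex.log 0))) :=
        (continuous_id.mul continuous_const).tendsto 0
      rw [zero_mul] at this
      exact this.mono_left nhdsWithin_le_nhds
    have := hlim.sub h0
    rw [sub_zero] at this
    refine this.congr fun x => ?_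
    rw [sub_zero, div_inv_eq_mul]
    ring
  have hQ := differentiableOn_update_limUnder_of_isLittleO (Metric.ball_mem_nhds (0 : ℂ) hr) hdiff hlo
  set Q := Function.update (fun x => Θ (Complex.log x)) 0
    (limUnder (𝓝[≠] 0) fun x => Θ (Complex.log x)) with hQdef
  have norm_eq : ∀ z : ℂ, ‖z / p - 1‖ = ‖z - p‖ / ‖p‖ := fun z => by
    rw [← norm_div, sub_div, div_self hp]
  have hball : ∀ z ∈ Metric.ball p (r * ‖p‖), ‖z / p - 1‖ < r := fun z hz => by
    rw [norm_eq, div_lt_iff₀ hp']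
    exact mem_ball_iff_norm.1 hz
  refine ⟨r * ‖p‖, by positivity, fun z => Q (z / p - 1), hQ.comp (by fun_prop)
    fun z hz => mem_ball_zero_iff.2 (hball z hz), fun z hz him => ?_⟩
  have him' : (z / p - 1).im = (z / p).im := by simp
  have hne : z / p - 1 ≠ 0 := fun h0 => by
    rw [← him', h0, zero_im, mul_zero] at him
    exact lt_irrefl _ him
  have hlog := Complex.exp_log hne
  obtain ⟨k1, k2⟩ := sign_im_log hσ (z := z / p - 1) (by rwa [him'])
  beta_reduce
  rw [hQdef, Function.update_of_ne hne, eΘ _ (by rw [hlog]; exact (hball z hz).trans_le hr1) k1 k2,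
    hlog, add_sub_cancel, mul_div_cancel₀ _ hp]

end

end

/-! ### Independence of the chosen branches and iterated monodromy -/

noncomputable section

section

variable {f g F G H : ℂ → ℂ} {A B : Set ℂ} {p : ℂ} {σ : ℝ}

theorem HasIsolatedSingularities.isDiscreteAway (h : HasIsolatedSingularities F A) :
    IsDiscreteAway A := ⟨h.zero_notMem, h.finite_inter⟩

theorem exists_hasSmallBranches (hσ : σ = 1 ∨ σ = -1) (hF : IsPrincipalBranch f A F)
    (hFA : HasIsolatedSingularities F A) (hint : ∀ α ∈ A, IsIntegrableSingularity F α) :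
    ∃ Φ, HasSmallBranches F A σ Φ := by
  have h : ∀ α : ℂ, ∃ Φ : ℂ → ℂ, α ≠ 0 → IsLocalBranch F σ α Φ ∧ IsSmallBranch Φ ∧
      (α ∉ A → ∀ w, monodromyDelta Φ w = 0) := fun α => by
    by_cases hα : α = 0
    · exact ⟨0, fun h => absurd hα h⟩
    · obtain ⟨Φ, hΦ⟩ := exists_small_localBranch hσ hFA hint hα
      exact ⟨Φ, fun _ => hΦ⟩
  choose Φ hΦ using h
  exact ⟨Φ, hFA.isDiscreteAway, hF.differentiableOn, hFA.regular σ hσ, fun α h => (hΦ α h).1,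
    fun α h => (hΦ α h).2.1, fun α h => (hΦ α h).2.2⟩

theorem exp_add_nat_mul_two_pi_I (w : ℂ) (k : ℕ) :
    exp (w + k * (2 * Real.pi * I)) = exp w := by
  rw [Complex.exp_add, Complex.exp_nat_mul_two_pi_mul_I, mul_one]

/-- The `k`-th integral at `w` is the integral of the plain variations at $w+2\pi ik$. One ρ serves
all `k`, since the conditions depend only on $e^w$, which is the same on every sheet. -/
theorem exists_hasConvolutionIntegral_shift {Φ Ψ Φ₀ Ψ₀ : ℂ → ℂ} {α β : ℂ}
    (hσ : σ = 1 ∨ σ = -1) (hΦ : IsLocalBranch F σ α Φ) (hΨ : IsLocalBranch G σ β Ψ)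
    (hΦ₀ : IsLocalBranch F σ α Φ₀) (hΨ₀ : IsLocalBranch G σ β Ψ₀) (sΦ₀ : IsSmallBranch Φ₀)
    (sΨ₀ : IsSmallBranch Ψ₀) :
    ∃ ρ > 0, ∀ w : ℂ, ‖exp w‖ < ρ → ∀ k : ℕ,
      HasConvolutionIntegral (monodromyDelta (monodromyShift^[k] Φ))
        (monodromyDelta (monodromyShift^[k] Ψ)) w
        (convValue (monodromyDelta Φ₀) (monodromyDelta Ψ₀) (w + k * (2 * Real.pi * I))) := by
  obtain ⟨δ, hδ, h⟩ := exists_local_convolution hσ hΦ₀ hΨ₀ sΦ₀ sΨ₀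
  -- Only the convergence clause is kept, so any admissible endpoints will do.
  obtain ⟨ρ₀, hρ₀, Θ, -, -, -, conv⟩ := h (-δ / 2) ⟨by linarith, by linarith⟩ (δ / 2)
    ⟨by linarith, by linarith⟩
  obtain ⟨r₁, hr₁, e1⟩ := hΦ.eqOn hσ hΦ₀
  obtain ⟨r₂, hr₂, e2⟩ := hΨ.eqOn hσ hΨ₀
  have hr : 0 < min r₁ r₂ := lt_min hr₁ hr₂
  set r := min r₁ r₂
  refine ⟨min ρ₀ (min (1 / 2) (r / 2)), lt_min hρ₀ (lt_min (by norm_num) (by linarith)),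
    fun w hw k => ?_⟩
  have hexp := exp_add_nat_mul_two_pi_I w k
  have shift : ∀ {Φ Φ₀ : ℂ → ℂ}, (∀ v : ℂ, ‖exp v‖ < r → Φ v = Φ₀ v) → ∀ x : ℂ,
      ‖exp (w + k * (2 * Real.pi * I) + x)‖ < r → monodromyDelta (monodromyShift^[k] Φ) (w + x) =
        monodromyDelta Φ₀ (w + k * (2 * Real.pi * I) + x) := fun {Φ Φ₀} e x hx => by
    rw [monodromyDelta, monodromyDelta, monodromyShift, monodromyShift, monodromyShift_iterate,
      monodromyShift_iterate, ← e _ hx, ← e _ (by rwa [Complex.exp_add _ (2 * Real.pi * I),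
        Complex.exp_two_pi_mul_I, mul_one])]
    ring_nf
  have hL := conv (w + k * (2 * Real.pi * I)) (by
    rw [hexp]; exact hw.trans_le (min_le_left _ _))
  have hL' := hL
  rw [← hL.convValue_eq] at hL'
  refine hL'.congr (r := r) hexp.symm ?_ ?_ ?_ ?_
  · rw [hexp]; exact hw.trans_le ((min_le_right _ _).trans (min_le_left _ _))
  · rw [hexp]
    linarith [hw.trans_le ((min_le_right ρ₀ _).trans (min_le_right (1 / 2) (r / 2)))]
  · exact shift fun v hv => e1 v (hv.trans_le (min_le_left _ _))
  · exact shift fun v hv => e2 v (hv.trans_le (min_le_right _ _))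

/-- Telescoping $\Sigma^N-\mathrm{Id}=\sum_{k<N}\Delta\Sigma^k$ reduces the formula to $N=1$ at the
points $w+2\pi ik$. -/
theorem monodromyShift_iterate_sub (Θ : ℂ → ℂ) (N : ℕ) (w : ℂ) :
    (monodromyShift^[N] Θ) w - Θ w =
      ∑ k ∈ Finset.range N, monodromyDelta Θ (w + k * (2 * Real.pi * I)) := by
  have h := Finset.sum_range_sub (fun k => (monodromyShift^[k] Θ) w) N
  rw [Function.iterate_zero, id] at h
  rw [← h]
  refine Finset.sum_congr rfl fun k _ => ?_
  rw [monodromyDelta, monodromyShift, monodromyShift_iterate, monodromyShift_iterate]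
  push_cast
  ring_nf

theorem hasIsolatedSingularities_hadamardProduct (hF : IsPrincipalBranch f A F)
    (hG : IsPrincipalBranch g B G) (hFA : HasIsolatedSingularities F A)
    (hGB : HasIsolatedSingularities G B) (hFint : ∀ α ∈ A, IsIntegrableSingularity F α)
    (hGint : ∀ β ∈ B, IsIntegrableSingularity G β)
    (hH : IsPrincipalBranch (hadamardProduct f g) (image2 (· * ·) A B) H) :
    HasIsolatedSingularities H (image2 (· * ·) A B) := by
  have hAB := hFA.isDiscreteAway.image2_mul hGB.isDiscreteAway
  refine ⟨hAB.zero_notMem, hAB.finite_inter, fun σ hσ p hp => ?_, fun σ hσ γ hγ => ?_⟩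
  · by_cases hp0 : p = 0
    -- For $p=0$ the quotient $z/p$ is $0$, so the side condition is empty.
    · refine ⟨1, one_pos, 0, differentiableOn_const 0, fun z _ hz => ?_⟩
      rw [hp0, div_zero, zero_im, mul_zero] at hz
      exact absurd hz (lt_irrefl _)
    obtain ⟨Φ, hΦ⟩ := exists_hasSmallBranches hσ hF hFA hFint
    obtain ⟨Ψ, hΨ⟩ := exists_hasSmallBranches hσ hG hGB hGint
    obtain ⟨Θ, h1, h2, ρ, hρ, h3⟩ := exists_localBranch_hadamardProduct hσ hΦ hΨ hF.germ_eq
      hG.germ_eq hH hp0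
    refine isRegularFromSide_of_monodromyDelta_eq_zero hσ hp0 h1 h2 hρ fun ω hω => ?_
    have : factorPairs A B p = ∅ :=
      eq_empty_of_forall_notMem fun q hq => hp ⟨q.1, hq.1, q.2, hq.2.1, hq.2.2⟩
    rw [h3 ω hω, this, finsum_mem_empty, mul_zero]
  · obtain ⟨Φ, hΦ⟩ := exists_hasSmallBranches hσ hF hFA hFint
    obtain ⟨Ψ, hΨ⟩ := exists_hasSmallBranches hσ hG hGB hGint
    obtain ⟨Θ, h1, -⟩ := exists_localBranch_hadamardProduct hσ hΦ hΨ hF.germ_eq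
      hG.germ_eq hH (p := γ) fun h => hAB.zero_notMem (h ▸ hγ)
    exact ⟨Θ, h1⟩

end

end

theorem theorem1p1 (f g F G : ℂ → ℂ) (A B : Set ℂ)
    (hf : AnalyticAt ℂ f 0) (hg : AnalyticAt ℂ g 0)
    (hF : IsPrincipalBranch f A F) (hG : IsPrincipalBranch g B G)
    (hFA : HasIsolatedSingularities F A) (hGB : HasIsolatedSingularities G B)
    (hFint : ∀ α ∈ A, IsIntegrableSingularity F α)
    (hGint : ∀ β ∈ B, IsIntegrableSingularity G β) :
    ∃ H : ℂ → ℂ,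
      IsPrincipalBranch (hadamardProduct f g) (Set.image2 (· * ·) A B) H ∧
      HasIsolatedSingularities H (Set.image2 (· * ·) A B) ∧
      ∀ γ ∈ Set.image2 (· * ·) A B,
        ∃ hfin : {p : ℂ × ℂ | p.1 ∈ A ∧ p.2 ∈ B ∧ p.1 * p.2 = γ}.Finite,
          ∀ σ : ℝ, σ = 1 ∨ σ = -1 →
            ∀ (Φ Ψ : ℂ → ℂ → ℂ) (Θ : ℂ → ℂ),
              (∀ α ∈ A, IsLocalBranch F σ α (Φ α)) →
              (∀ β ∈ B, IsLocalBranch G σ β (Ψ β)) →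
              IsLocalBranch H σ γ Θ →
              ∃ ρ : ℝ, 0 < ρ ∧ ∀ w : ℂ, ‖exp w‖ < ρ →
                ∃ J : ℂ → ℂ → ℕ → ℂ,
                  (∀ α ∈ A, ∀ β ∈ B, α * β = γ → ∀ k : ℕ,
                    HasConvolutionIntegral
                      (monodromyDelta (monodromyShift^[k] (Φ α)))
                      (monodromyDelta (monodromyShift^[k] (Ψ β))) w (J α β k)) ∧
                  ∀ N : ℕ, 1 ≤ N →
                    (monodromyShift^[N] Θ) w - Θ w =
                      -(1 / (2 * (Real.pi : ℂ) * I)) *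
                        ∑ p ∈ hfin.toFinset, ∑ k ∈ Finset.range N, J p.1 p.2 k := by
  have hA := hFA.isDiscreteAway
  have hB := hGB.isDiscreteAway
  obtain ⟨H, hH⟩ := exists_principalBranch_hadamardProduct hA hB hF hG
  refine ⟨H, hH, hasIsolatedSingularities_hadamardProduct hF hG hFA hGB hFint hGint hH,
    fun γ hγ => ⟨finite_factorPairs hA hB γ, fun σ hσ Φ Ψ Θ hΦ hΨ hΘ => ?_⟩⟩
  have hγ0 : γ ≠ 0 := fun h => (hA.image2_mul hB).zero_notMem (h ▸ hγ)
  obtain ⟨Φ₀, hΦ₀⟩ := exists_hasSmallBranches hσ hF hFA hFint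
  obtain ⟨Ψ₀, hΨ₀⟩ := exists_hasSmallBranches hσ hG hGB hGint
  obtain ⟨Θ₀, hΘ₀, -, ρ₁, hρ₁, hvar⟩ := exists_localBranch_hadamardProduct hσ hΦ₀ hΨ₀ hF.germ_eq
    hG.germ_eq hH hγ0
  obtain ⟨ρ₂, hρ₂, heq⟩ := hΘ.eqOn hσ hΘ₀
  have hfin := finite_factorPairs hA hB γ
  -- The given local branches are compared with the chosen small ones; finiteness of the set of
  -- pairs gives a common radius.
  have hconv : ∀ᶠ ρ : ℝ in 𝓝[>] 0, ∀ q ∈ factorPairs A B γ, ∀ w : ℂ, ‖exp w‖ < ρ → ∀ k : ℕ,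
      HasConvolutionIntegral (monodromyDelta (monodromyShift^[k] (Φ q.1)))
        (monodromyDelta (monodromyShift^[k] (Ψ q.2))) w
        (convValue (monodromyDelta (Φ₀ q.1)) (monodromyDelta (Ψ₀ q.2))
          (w + k * (2 * Real.pi * I))) := by
    rw [eventually_all_finite hfin]
    intro q hq
    have h1 : q.1 ≠ 0 := fun h => hA.zero_notMem (h ▸ hq.1)
    have h2 : q.2 ≠ 0 := fun h => hB.zero_notMem (h ▸ hq.2.1)
    obtain ⟨ρ, hρ, h⟩ := exists_hasConvolutionIntegral_shift hσ (hΦ _ hq.1) (hΨ _ hq.2.1)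
      (hΦ₀.isLocalBranch _ h1) (hΨ₀.isLocalBranch _ h2) (hΦ₀.isSmallBranch _ h1)
      (hΨ₀.isSmallBranch _ h2)
    filter_upwards [Ioo_mem_nhdsGT hρ] with ρ' hρ' w hw
    exact h w (hw.trans hρ'.2)
  obtain ⟨ρ, hρconv, hρ⟩ := (hconv.and (Ioo_mem_nhdsGT (lt_min hρ₁ hρ₂))).exists
  refine ⟨ρ, hρ.1, fun w hw => ⟨fun α β k => convValue (monodromyDelta (Φ₀ α))
    (monodromyDelta (Ψ₀ β)) (w + k * (2 * Real.pi * I)), fun α hα β hβ h k =>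
      hρconv (α, β) ⟨hα, hβ, h⟩ w hw k, fun N _ => ?_⟩⟩
  rw [monodromyShift_iterate_sub, Finset.sum_comm, Finset.mul_sum]
  refine Finset.sum_congr rfl fun k _ => ?_
  have hexp := exp_add_nat_mul_two_pi_I w k
  have hk : ‖exp (w + k * (2 * Real.pi * I))‖ < min ρ₁ ρ₂ := by
    rw [hexp]; exact hw.trans hρ.2
  have hdelta : monodromyDelta Θ (w + k * (2 * Real.pi * I)) =
      monodromyDelta Θ₀ (w + k * (2 * Real.pi * I)) := by
    rw [monodromyDelta, monodromyDelta, monodromyShift, monodromyShift,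
      heq _ (hk.trans_le (min_le_right _ _)), heq _ (by
        rw [Complex.exp_add _ (2 * Real.pi * I), Complex.exp_two_pi_mul_I, mul_one]
        exact hk.trans_le (min_le_right _ _))]
  rw [hdelta, hvar _ (hk.trans_le (min_le_left _ _)), finsum_mem_eq_finite_toFinset_sum _ hfin]
  rfl
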